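/- **Theorem.** Let $a,m,q,\Lambda\in\mathbb R$ and consider the Kerr–Newman–(anti) de Sitter metric in Boyer–Lindquist coordinates $(t,r,\theta,\phi)$, $$ds^2=-\frac{\Delta_r}{\Xi^2\rho^2}\,(dt-a\sin^2\theta\,d\phi)^2+\frac{\rho^2}{\Delta_r}\,dr^2+\frac{\rho^2}{\Delta_\theta}\,d\theta^2+\frac{\Delta_\theta\sin^2\theta}{\Xi^2\rho^2}\,\bigl(a\,dt-(r^2+a^2)\,d\phi\bigr)^2,$$ $$\Delta_\theta=1+\tfrac{a^2\Lambda}{3}\cos^2\theta,\quad \Xi=1+\tfrac{a^2\Lambda}{3},\quad \Delta_r=\bigl(1-\tfrac{\Lambda}{3}r^2\bigr)(r^2+a^2)-2mr+q^2,\quad \rho^2=r^2+a^2\cos^2\theta .$$ *Conventions.* $\Gamma^\lambda_{\mu\nu}=\frac12 g^{\lambda\alpha}(g_{\mu\alpha,\nu}+g_{\nu\alpha,\mu}-g_{\mu\nu,\alpha})$, $R^\kappa{}_{\lambda\mu\nu}=\Gamma^\kappa_{\lambda\nu,\mu}-\Gamma^\kappa_{\lambda\mu,\nu}+\Gamma^\alpha_{\lambda\nu}\Gamma^\kappa_{\alpha\mu}-\Gamma^\alpha_{\lambda\mu}\Gamma^\kappa_{\alpha\nu}$,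 $R_{\mu\nu}=R^\alpha{}_{\mu\alpha\nu}$, $R=g^{\alpha\beta}R_{\alpha\beta}$; $C_{\alpha\beta\gamma\delta}$ is the Weyl tensor, and $C^*_{\alpha\beta\gamma\delta}=\frac12E_{\alpha\beta\kappa\lambda}C^{\kappa\lambda}{}_{\gamma\delta}$ its dual, where $E_{\alpha\beta\kappa\lambda}$ is the Levi-Civita pseudotensor with $E_{tr\theta\phi}=+\sqrt{|\det g|}$; $S_{\mu\nu}=R_{\mu\nu}-\frac14Rg_{\mu\nu}$ and $(S^2)_{\mu\nu}=S_\mu{}^\lambda S_{\lambda\nu}$. For tensors $P_{\mu\nu},Q_{\mu\nu}$ put $$\begin{aligned} K(P,Q)&=C_{\alpha\beta\mu}{}^{\nu}P^{\beta\mu}Q_\nu{}^\alpha,\qquad K^*(P,Q)=-C^*_{\alpha\beta\mu}{}^{\nu}P^{\beta\mu}Q_\nu{}^\alpha,\\ L(P,Q)&=P^{\alpha\beta}Q^{\mu\nu}\bigl(C_{o\alpha\beta}{}^{\rho}C_{\rho\mu\nu}{}^{o}-C^*_{o\alpha\beta}{}^{\rho}C^*_{\rho\mu\nu}{}^{o}\bigr),\\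 L^*(P,Q)&=-P^{\alpha\beta}Q^{\mu\nu}\bigl(C^*_{o\alpha\beta}{}^{\rho}C_{\rho\mu\nu}{}^{o}+C_{o\alpha\beta}{}^{\rho}C^*_{\rho\mu\nu}{}^{o}\bigr). \end{aligned}$$ The Zakhary–McIntosh invariants considered are $$\begin{aligned} I_1&=C_{\alpha\beta\gamma\delta}C^{\alpha\beta\gamma\delta},\quad K_2=C^*_{\alpha\beta\gamma\delta}C^{\alpha\beta\gamma\delta},\quad I_3=C_{\alpha\beta}{}^{\mu\nu}C_{\mu\nu}{}^{o\rho}C_{o\rho}{}^{\alpha\beta},\quad I_4=-C_{\alpha\beta}{}^{\kappa\lambda}C^*_{\kappa\lambda}{}^{o\rho}C_{o\rho}{}^{\alpha\beta},\\ I_5&=R,\quad I_6=R_{\alpha\beta}R^{\alpha\beta},\quad I_7=R_\mu{}^\nu R_\nu{}^\rho R_\rho{}^\mu,\quad I_8=R_\mu{}^\nu R_\nu{}^\rho R_\rho{}^\lambda R_\lambda{}^\mu,\\ I_9&=K(\mathrm{Ric},\mathrm{Ric}),\quad I_{10}=K^*(\mathrm{Ric},\mathrm{Ric}),\quad I_{11}=L(\mathrm{Ric},\mathrm{Ric}),\quad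 I_{12}=L^*(\mathrm{Ric},\mathrm{Ric}),\\ I_{13}&=K(S^2,S^2),\quad I_{14}=K^*(S^2,S^2),\\ I_{15}&=\tfrac1{16}R^{\alpha\beta}R^{\mu\nu}\bigl(C_{o\alpha\beta\rho}C^{o}{}_{\mu\nu}{}^{\rho}+C^*_{o\alpha\beta\rho}C^{*o}{}_{\mu\nu}{}^{\rho}\bigr),\\ I_{16}&=-\tfrac1{32}R^{\alpha\beta}R^{\mu\nu}\bigl(C_{o\eta\sigma\rho}C^{o}{}_{\alpha\beta}{}^{\rho}C^{\eta}{}_{\mu\nu}{}^{\sigma}+C_{o\eta\sigma\rho}C^{*o}{}_{\alpha\beta}{}^{\rho}C^{*\eta}{}_{\mu\nu}{}^{\sigma}-C^*_{o\eta\sigma\rho}C^{*o}{}_{\alpha\beta}{}^{\rho}C^{\eta}{}_{\mu\nu}{}^{\sigma}+C^*_{o\eta\sigma\rho}C^{o}{}_{\alpha\beta}{}^{\rho}C^{*\eta}{}_{\mu\nu}{}^{\sigma}\bigr),\\ I_{17}&=\tfrac1{32}R^{\alpha\beta}R^{\mu\nu}\bigl(C^*_{o\kappa\lambda\rho}C^{o}{}_{\alpha\beta}{}^{\rho}C^{\kappa}{}_{\mu\nu}{}^{\lambda}+C^*_{o\kappa\lambda\rho}C^{*o}{}_{\alpha\beta}{}^{\rho}C^{*\kappa}{}_{\mu\nu}{}^{\lambda}-C_{o\kappa\lambda\rho}C^{*o}{}_{\alpha\beta}{}^{\rho}C^{\kappa}{}_{\mu\nu}{}^{\lambda}+C_{o\kappa\lambda\rho}C^{o}{}_{\alpha\beta}{}^{\rho}C^{*\kappa}{}_{\mu\nu}{}^{\lambda}\bigr).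 \end{aligned}$$ *Claim.* At every point with $0<\theta<\pi$ at which $\rho^2$, $\Delta_r$, $\Delta_\theta$ and $\Xi$ are nonzero, writing $c=\cos\theta$ and $\rho^2=r^2+a^2c^2$: $$\begin{aligned} I_1&=\frac{48}{\rho^{12}}\bigl(-a^3mc^3+(-3a^2mr+a^2q^2)c^2+(3amr^2-2aq^2r)c+(mr-q^2)r^2\bigr)\\ &\quad\times\bigl(a^3mc^3+(-3a^2mr+a^2q^2)c^2+(-3amr^2+2aq^2r)c-(-mr+q^2)r^2\bigr),\\ K_2&=\frac{96a}{\rho^{12}}\bigl(c^3a^2m-3cmr^2+2cq^2r\bigr)\bigl(-3a^2c^2mr+a^2c^2q^2+mr^3-q^2r^2\bigr),\\ I_3&=\frac{96}{\rho^{18}}\Bigl(-3c^6a^6m^2+(27a^4m^2r^2-18a^4mq^2r+a^4q^4)c^4\\ &\quad+(-33a^2m^2r^4+44a^2mq^2r^3-14a^2q^4r^2)c^2+r^6m^2-2mq^2r^5+q^4r^4\Bigr)\bigl((-3a^2mr+a^2q^2)c^2+mr^3-q^2r^2\bigr),\\ I_4&=-\frac{864a}{\rho^{18}}\Bigl(\tfrac{c^3a^2m}{3}+(-mr^2+\tfrac23q^2r)c\Bigr)\Bigl(-\tfrac{c^6a^6m^2}{3}+(11a^4m^2r^2-\tfrac{22}3a^4mq^2r+a^4q^4)c^4\\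 &\quad+(-9a^2m^2r^4+12a^2mq^2r^3-\tfrac{10}3a^2q^4r^2)c^2-\tfrac{r^4(-3m^2r^2+6mq^2r-3q^4)}3\Bigr),\\ I_5&=4\Lambda,\qquad I_6=\frac{4q^4}{\rho^8}+4\Lambda^2,\\ I_7&=\frac{4\Lambda}{\rho^8}\bigl(\Lambda^2c^8a^8+4\Lambda^2c^6a^6r^2+6\Lambda^2c^4a^4r^4+4\Lambda^2c^2a^2r^6+\Lambda^2r^8+3q^4\bigr),\\ I_8&=\frac1{\rho^{16}}\Bigl(4\Lambda^4c^{16}a^{16}+32\Lambda^4c^{14}a^{14}r^2+112\Lambda^4c^{12}a^{12}r^4+224\Lambda^4c^{10}a^{10}r^6+(280\Lambda^4a^8r^8+24\Lambda^2a^8q^4)c^8\\ &\quad+96r^2(\tfrac73a^6\Lambda^4r^8+a^6q^4\Lambda^2)c^6+(112\Lambda^4a^4r^{12}+144\Lambda^2a^4q^4r^4)c^4\\ &\quad+96r^2(\tfrac13\Lambda^4a^2r^{12}+\Lambda^2a^2q^4r^4)c^2+4\Lambda^4r^{16}+24\Lambda^2q^4r^8+4q^8\Bigr),\\ I_9&=-\frac{16q^4}{\rho^{14}}\bigl(-3a^2c^2mr+a^2c^2q^2+mr^3-q^2r^2\bigr),\qquad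 I_{10}=\frac{16aq^4}{\rho^{14}}\bigl(c^3a^2m-3cmr^2+2cq^2r\bigr),\\ I_{11}&=\frac{64q^4}{\rho^{20}}\bigl(c^3a^3m+(-3a^2mr+a^2q^2)c^2+(-3amr^2+2aq^2r)c-r^2(-mr+q^2)\bigr)\\ &\quad\times\bigl(-c^3a^3m+(-3a^2mr+a^2q^2)c^2+(3amr^2-2aq^2r)c+(mr-q^2)r^2\bigr),\\ I_{12}&=-\frac{128aq^4}{\rho^{20}}\bigl(c^3a^2m-3cmr^2+2cq^2r\bigr)\bigl(-3a^2c^2mr+a^2c^2q^2+mr^3-q^2r^2\bigr),\\ I_{15}&=\frac{4q^4\bigl(c^2a^2m^2+r^2m^2-2mq^2r+q^4\bigr)}{\rho^{16}},\\ I_{16}&=-\frac{24q^4\bigl(c^2a^2m^2+(mr-q^2)^2\bigr)\bigl(a^2(mr-\frac{q^2}3)c^2-\frac{r^2(mr-q^2)}3\bigr)}{\rho^{22}},\\ I_{17}&=-\frac{24aq^4}{\rho^{22}}\Bigl(\tfrac{c^3a^2m}3+(-mr^2+\tfrac23q^2r)c\Bigr)\bigl(c^2a^2m^2+(mr-q^2)^2\bigr).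 \end{aligned}$$ Moreover $I_{13}=I_{14}=0$; indeed $K(S^2,Q)=K^*(S^2,Q)=L(S^2,Q)=L^*(S^2,Q)=0$ for every tensor $Q_{\mu\nu}$, so the pair vanishes as well if it is taken linear or quadratic in the Weyl tensor and with $Q=S$ or $Q=S^2$. -/

import Mathlib

open scoped BigOperators

noncomputable section

namespace CurvInv

/-- Coordinates of a point in a chart of a four-dimensional manifold. -/
abbrev Point := Fin 4 → ℝ

/-- Components of a tensor with two indices at a point. -/
abbrev Tensor2 := Matrix (Fin 4) (Fin 4) ℝ

/-- Components of a tensor with four indices at a point. -/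
abbrev Tensor4 := Fin 4 → Fin 4 → Fin 4 → Fin 4 → ℝ

/-- Covariant components `g_{μν}` of a metric, as functions of the coordinates. -/
abbrev Metric := Point → Tensor2

/-! ### Raising indices; `h` stands for the inverse metric `g^{μν}` -/

def raise₁ (h : Tensor2) (T : Tensor4) : Tensor4 := fun α β γ δ => ∑ e, h α e * T e β γ δ
def raise₂ (h : Tensor2) (T : Tensor4) : Tensor4 := fun α β γ δ => ∑ e, h β e * T α e γ δ
def raise₃ (h : Tensor2) (T : Tensor4) : Tensor4 := fun α β γ δ => ∑ e, h γ e * T α β e δ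
def raise₄ (h : Tensor2) (T : Tensor4) : Tensor4 := fun α β γ δ => ∑ e, h δ e * T α β γ e

/-- `T_{αβ}^{γδ}` from `T_{αβγδ}`. -/
def raise₃₄ (h : Tensor2) (T : Tensor4) : Tensor4 := raise₃ h (raise₄ h T)

/-- `T^{αβ}_{γδ}` from `T_{αβγδ}`. -/
def raise₁₂ (h : Tensor2) (T : Tensor4) : Tensor4 := raise₁ h (raise₂ h T)

/-- `T^α_{βγ}^δ` from `T_{αβγδ}`. -/
def raise₁₄ (h : Tensor2) (T : Tensor4) : Tensor4 := raise₁ h (raise₄ h T)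

/-- `P_μ^ν` from `P_{μν}`: the entry at `(μ, ν)` has `μ` down and `ν` up. -/
def mixed (h P : Tensor2) : Tensor2 := fun μ ν => ∑ e, h ν e * P μ e

/-- `P^{μν}` from `P_{μν}`. -/
def contra (h P : Tensor2) : Tensor2 := fun μ ν => ∑ d, ∑ e, h μ d * h ν e * P d e

/-! ### Curvature of a metric in a chart -/

/-- The partial derivative `∂f/∂x^i`. -/
def pderiv (i : Fin 4) (f : Point → ℝ) (x : Point) : ℝ :=
  deriv (fun s => f (Function.update x i s)) (x i)

/-- `Γ^l_{μν} = ½ g^{lα} (g_{μα,ν} + g_{να,μ} - g_{μν,α})`. -/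
def christoffel (g : Metric) (l μ ν : Fin 4) (x : Point) : ℝ :=
  1 / 2 * ∑ α, (g x)⁻¹ l α *
    (pderiv ν (fun y => g y μ α) x + pderiv μ (fun y => g y ν α) x
      - pderiv α (fun y => g y μ ν) x)

/-- `R^κ_{lμν} = Γ^κ_{lν,μ} - Γ^κ_{lμ,ν} + Γ^α_{lν} Γ^κ_{αμ} - Γ^α_{lμ} Γ^κ_{αν}`. -/
def riemannUp (g : Metric) (x : Point) : Tensor4 := fun κ l μ ν =>
  pderiv μ (christoffel g κ l ν) x - pderiv ν (christoffel g κ l μ) x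
    + ∑ α, (christoffel g α l ν x * christoffel g κ α μ x
      - christoffel g α l μ x * christoffel g κ α ν x)

/-- `R_{κlμν}`. -/
def riemann (g : Metric) (x : Point) : Tensor4 := fun κ l μ ν =>
  ∑ e, g x κ e * riemannUp g x e l μ ν

/-- `R_{μν} = R^α_{μαν}`. -/
def ricci (g : Metric) (x : Point) : Tensor2 := fun μ ν => ∑ α, riemannUp g x α μ α ν

/-- The scalar curvature `R = g^{αβ} R_{αβ}`. -/
def scalarCurv (g : Metric) (x : Point) : ℝ := ∑ α, ∑ β, (g x)⁻¹ α β * ricci g x α β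

/-- The Weyl tensor `C_{κlμν}` in dimension four. -/
def weyl (g : Metric) (x : Point) : Tensor4 := fun κ l μ ν =>
  riemann g x κ l μ ν
    + 1 / 2 * (ricci g x l μ * g x κ ν + ricci g x κ ν * g x l μ
      - ricci g x l ν * g x κ μ - ricci g x κ μ * g x l ν)
    + 1 / 6 * scalarCurv g x * (g x κ μ * g x l ν - g x κ ν * g x l μ)

/-- The Levi-Civita symbol: the sign of `(α, β, γ, δ)` as a permutation of `(0, 1, 2, 3)`, and `0`
if two indices agree. -/
def leviCivitaSymbol (α β γ δ : Fin 4) : ℤ :=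
  Matrix.det (Matrix.of fun i j : Fin 4 => if ![α, β, γ, δ] i = j then (1 : ℤ) else 0)

/-- The Levi-Civita pseudotensor `E_{αβγδ}`, for the orientation given by the order of the
coordinates. -/
def leviCivita (g : Metric) (x : Point) : Tensor4 := fun α β γ δ =>
  √|(g x).det| * (leviCivitaSymbol α β γ δ : ℝ)

/-- The dual Weyl tensor `C*_{αβγδ} = ½ E_{αβκl} C^{κl}_{γδ}`. -/
def weylDual (g : Metric) (x : Point) : Tensor4 := fun α β γ δ =>
  1 / 2 * ∑ κ, ∑ l, leviCivita g x α β κ l * raise₁₂ (g x)⁻¹ (weyl g x) κ l γ δ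

/-- The trace-free Ricci tensor `S_{μν} = R_{μν} - ¼ R g_{μν}`. -/
def tracefreeRicci (g : Metric) (x : Point) : Tensor2 := fun μ ν =>
  ricci g x μ ν - 1 / 4 * scalarCurv g x * g x μ ν

/-- The square `(S²)_{μν} = S_μ^l S_{lν}` of the trace-free Ricci tensor. -/
def tracefreeRicciSq (g : Metric) (x : Point) : Tensor2 := fun μ ν =>
  ∑ l, mixed (g x)⁻¹ (tracefreeRicci g x) μ l * tracefreeRicci g x l ν

/-! ### Weyl invariants -/

/-- `I₁ = C_{αβγδ} C^{αβγδ} = C_{αβ}^{κl} C_{κl}^{αβ}`. -/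
def I1 (g : Metric) (x : Point) : ℝ :=
  ∑ α, ∑ β, ∑ γ, ∑ δ, weyl g x α β γ δ * raise₁₂ (g x)⁻¹ (raise₃₄ (g x)⁻¹ (weyl g x)) α β γ δ

/-- The Chern-Pontryagin invariant `K₂ = C*_{αβγδ} C^{αβγδ}`. -/
def K2 (g : Metric) (x : Point) : ℝ :=
  ∑ α, ∑ β, ∑ γ, ∑ δ,
    weylDual g x α β γ δ * raise₁₂ (g x)⁻¹ (raise₃₄ (g x)⁻¹ (weyl g x)) α β γ δ

/-- `I₃ = C_{αβ}^{μν} C_{μν}^{oρ} C_{oρ}^{αβ}`. -/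
def I3 (g : Metric) (x : Point) : ℝ :=
  let C := raise₃₄ (g x)⁻¹ (weyl g x)
  ∑ α, ∑ β, ∑ μ, ∑ ν, ∑ o, ∑ ρ, C α β μ ν * C μ ν o ρ * C o ρ α β

/-- `I₄ = -C_{αβ}^{κl} C*_{κl}^{oρ} C_{oρ}^{αβ}`. -/
def I4 (g : Metric) (x : Point) : ℝ :=
  let C := raise₃₄ (g x)⁻¹ (weyl g x)
  let D := raise₃₄ (g x)⁻¹ (weylDual g x);
  -∑ α, ∑ β, ∑ κ, ∑ l, ∑ o, ∑ ρ, C α β κ l * D κ l o ρ * C o ρ α β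

/-! ### Ricci invariants -/

/-- `I₅ = R`. -/
def I5 (g : Metric) (x : Point) : ℝ := scalarCurv g x

/-- `I₆ = R_{αβ} R^{αβ}`. -/
def I6 (g : Metric) (x : Point) : ℝ :=
  ∑ α, ∑ β, ricci g x α β * contra (g x)⁻¹ (ricci g x) α β

/-- `I₇ = R_μ^ν R_ν^ρ R_ρ^μ`. -/
def I7 (g : Metric) (x : Point) : ℝ :=
  let R := mixed (g x)⁻¹ (ricci g x)
  ∑ μ, ∑ ν, ∑ ρ, R μ ν * R ν ρ * R ρ μ

/-- `I₈ = R_μ^ν R_ν^ρ R_ρ^l R_l^μ`. -/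
def I8 (g : Metric) (x : Point) : ℝ :=
  let R := mixed (g x)⁻¹ (ricci g x)
  ∑ μ, ∑ ν, ∑ ρ, ∑ l, R μ ν * R ν ρ * R ρ l * R l μ

/-! ### Mixed invariants

The first four functionals contract the Weyl tensor with two covariant tensors `P_{μν}`, `Q_{μν}`. -/

/-- `C_{αβμ}^ν P^{βμ} Q_ν^α`. -/
def mixedK (g : Metric) (x : Point) (P Q : Tensor2) : ℝ :=
  let C := raise₄ (g x)⁻¹ (weyl g x)
  ∑ α, ∑ β, ∑ μ, ∑ ν, C α β μ ν * contra (g x)⁻¹ P β μ * mixed (g x)⁻¹ Q ν α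

/-- `-C*_{αβμ}^ν P^{βμ} Q_ν^α`. -/
def mixedKDual (g : Metric) (x : Point) (P Q : Tensor2) : ℝ :=
  let D := raise₄ (g x)⁻¹ (weylDual g x);
  -∑ α, ∑ β, ∑ μ, ∑ ν, D α β μ ν * contra (g x)⁻¹ P β μ * mixed (g x)⁻¹ Q ν α

/-- `P^{αβ} Q^{μν} (C_{oαβ}^ρ C_{ρμν}^o - C*_{oαβ}^ρ C*_{ρμν}^o)`. -/
def mixedL (g : Metric) (x : Point) (P Q : Tensor2) : ℝ :=
  let C := raise₄ (g x)⁻¹ (weyl g x)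
  let D := raise₄ (g x)⁻¹ (weylDual g x)
  ∑ α, ∑ β, ∑ μ, ∑ ν, ∑ o, ∑ ρ, contra (g x)⁻¹ P α β * contra (g x)⁻¹ Q μ ν *
    (C o α β ρ * C ρ μ ν o - D o α β ρ * D ρ μ ν o)

/-- `-P^{αβ} Q^{μν} (C*_{oαβ}^ρ C_{ρμν}^o + C_{oαβ}^ρ C*_{ρμν}^o)`. -/
def mixedLDual (g : Metric) (x : Point) (P Q : Tensor2) : ℝ :=
  let C := raise₄ (g x)⁻¹ (weyl g x)
  let D := raise₄ (g x)⁻¹ (weylDual g x);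
  -∑ α, ∑ β, ∑ μ, ∑ ν, ∑ o, ∑ ρ, contra (g x)⁻¹ P α β * contra (g x)⁻¹ Q μ ν *
    (D o α β ρ * C ρ μ ν o + C o α β ρ * D ρ μ ν o)

/-- `I₉ = C_{αβμ}^ν R^{βμ} R_ν^α`. -/
def I9 (g : Metric) (x : Point) : ℝ := mixedK g x (ricci g x) (ricci g x)

/-- `I₁₀ = -C*_{αβl}^γ R^{βl} R_γ^α`. -/
def I10 (g : Metric) (x : Point) : ℝ := mixedKDual g x (ricci g x) (ricci g x)

/-- `I₁₁ = R^{αβ} R^{μν} (C_{oαβ}^ρ C_{ρμν}^o - C*_{oαβ}^ρ C*_{ρμν}^o)`. -/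
def I11 (g : Metric) (x : Point) : ℝ := mixedL g x (ricci g x) (ricci g x)

/-- `I₁₂ = -R^{αβ} R^{μν} (C*_{oαβ}^ρ C_{ρμν}^o + C_{oαβ}^ρ C*_{ρμν}^o)`. -/
def I12 (g : Metric) (x : Point) : ℝ := mixedLDual g x (ricci g x) (ricci g x)

/-- `I₁₃ = C_{αβμ}^ν (S²)^{βμ} (S²)_ν^α`. -/
def I13 (g : Metric) (x : Point) : ℝ :=
  mixedK g x (tracefreeRicciSq g x) (tracefreeRicciSq g x)

/-- `I₁₄ = -C*_{αβμ}^ν (S²)^{βμ} (S²)_ν^α`. -/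
def I14 (g : Metric) (x : Point) : ℝ :=
  mixedKDual g x (tracefreeRicciSq g x) (tracefreeRicciSq g x)

/-- `I₁₅ = 1/16 R^{αβ} R^{μν} (C_{oαβρ} C^o_{μν}^ρ + C*_{oαβρ} C*^o_{μν}^ρ)`. -/
def I15 (g : Metric) (x : Point) : ℝ :=
  let C := weyl g x
  let D := weylDual g x
  let C' := raise₁₄ (g x)⁻¹ C
  let D' := raise₁₄ (g x)⁻¹ D
  let R := contra (g x)⁻¹ (ricci g x)
  1 / 16 * ∑ α, ∑ β, ∑ μ, ∑ ν, ∑ o, ∑ ρ, R α β * R μ ν *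
    (C o α β ρ * C' o μ ν ρ + D o α β ρ * D' o μ ν ρ)

/-- `I₁₆ = -1/32 R^{αβ} R^{μν} (C_{oησρ} C^o_{αβ}^ρ C^η_{μν}^σ + C_{oησρ} C*^o_{αβ}^ρ C*^η_{μν}^σ
- C*_{oησρ} C*^o_{αβ}^ρ C^η_{μν}^σ + C*_{oησρ} C^o_{αβ}^ρ C*^η_{μν}^σ)`. -/
def I16 (g : Metric) (x : Point) : ℝ :=
  let C := weyl g x
  let D := weylDual g x
  let C' := raise₁₄ (g x)⁻¹ C
  let D' := raise₁₄ (g x)⁻¹ D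
  let R := contra (g x)⁻¹ (ricci g x);
  -(1 / 32) * ∑ α, ∑ β, ∑ μ, ∑ ν, ∑ o, ∑ η, ∑ σ, ∑ ρ, R α β * R μ ν *
    (C o η σ ρ * C' o α β ρ * C' η μ ν σ + C o η σ ρ * D' o α β ρ * D' η μ ν σ
      - D o η σ ρ * D' o α β ρ * C' η μ ν σ + D o η σ ρ * C' o α β ρ * D' η μ ν σ)

/-- `I₁₇ = 1/32 R^{αβ} R^{μν} (C*_{oκlρ} C^o_{αβ}^ρ C^κ_{μν}^l + C*_{oκlρ} C*^o_{αβ}^ρ C*^κ_{μν}^l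
- C_{oκlρ} C*^o_{αβ}^ρ C^κ_{μν}^l + C_{oκlρ} C^o_{αβ}^ρ C*^κ_{μν}^l)`. -/
def I17 (g : Metric) (x : Point) : ℝ :=
  let C := weyl g x
  let D := weylDual g x
  let C' := raise₁₄ (g x)⁻¹ C
  let D' := raise₁₄ (g x)⁻¹ D
  let R := contra (g x)⁻¹ (ricci g x)
  1 / 32 * ∑ α, ∑ β, ∑ μ, ∑ ν, ∑ o, ∑ κ, ∑ l, ∑ ρ, R α β * R μ ν *
    (D o κ l ρ * C' o α β ρ * C' κ μ ν l + D o κ l ρ * D' o α β ρ * D' κ μ ν l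
      - C o κ l ρ * D' o α β ρ * C' κ μ ν l + C o κ l ρ * C' o α β ρ * D' κ μ ν l)

/-! ### The Kerr-Newman-(anti) de Sitter metric in Boyer-Lindquist coordinates `(t, r, θ, φ)` -/

/-- `Δ_θ = 1 + (a² Λ / 3) cos² θ`. -/
def deltaTheta (a Λ θ : ℝ) : ℝ := 1 + a ^ 2 * Λ / 3 * Real.cos θ ^ 2

/-- `Ξ = 1 + a² Λ / 3`. -/
def xi (a Λ : ℝ) : ℝ := 1 + a ^ 2 * Λ / 3

/-- `Δ_r = (1 - Λ r² / 3) (r² + a²) - 2 m r + q²`. -/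
def deltaR (a m q Λ r : ℝ) : ℝ :=
  (1 - Λ / 3 * r ^ 2) * (r ^ 2 + a ^ 2) - 2 * m * r + q ^ 2

/-- `ρ² = r² + a² cos² θ`. -/
def rhoSq (a r θ : ℝ) : ℝ := r ^ 2 + a ^ 2 * Real.cos θ ^ 2

/-- The components of
`ds² = -Δ_r/(Ξ² ρ²) (dt - a sin² θ dφ)² + ρ²/Δ_r dr² + ρ²/Δ_θ dθ²
  + Δ_θ sin² θ/(Ξ² ρ²) (a dt - (r² + a²) dφ)²`. -/
def kerrNewmanDeSitter (a m q Λ : ℝ) : Metric := fun x =>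
  let r := x 1
  let θ := x 2
  let ω : Fin 4 → ℝ := ![1, 0, 0, -(a * Real.sin θ ^ 2)]
  let dr : Fin 4 → ℝ := ![0, 1, 0, 0]
  let dθ : Fin 4 → ℝ := ![0, 0, 1, 0]
  let η : Fin 4 → ℝ := ![a, 0, 0, -(r ^ 2 + a ^ 2)]
  Matrix.of fun μ ν =>
    -(deltaR a m q Λ r / (xi a Λ ^ 2 * rhoSq a r θ)) * (ω μ * ω ν)
      + rhoSq a r θ / deltaR a m q Λ r * (dr μ * dr ν)
      + rhoSq a r θ / deltaTheta a Λ θ * (dθ μ * dθ ν)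
      + deltaTheta a Λ θ * Real.sin θ ^ 2 / (xi a Λ ^ 2 * rhoSq a r θ) * (η μ * η ν)

/-! ### The closed forms; `c` stands for `cos θ` -/

def closedI1 (a m q r c : ℝ) : ℝ :=
  48 / (r ^ 2 + a ^ 2 * c ^ 2) ^ 6 *
    (-(a ^ 3 * m * c ^ 3) + (-(3 * a ^ 2 * m * r) + a ^ 2 * q ^ 2) * c ^ 2
      + (3 * a * m * r ^ 2 - 2 * a * q ^ 2 * r) * c + (m * r - q ^ 2) * r ^ 2) *
    (a ^ 3 * m * c ^ 3 + (-(3 * a ^ 2 * m * r) + a ^ 2 * q ^ 2) * c ^ 2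
      + (-(3 * a * m * r ^ 2) + 2 * a * q ^ 2 * r) * c - (-(m * r) + q ^ 2) * r ^ 2)

def closedK2 (a m q r c : ℝ) : ℝ :=
  96 * a / (r ^ 2 + a ^ 2 * c ^ 2) ^ 6 *
    (c ^ 3 * a ^ 2 * m - 3 * c * m * r ^ 2 + 2 * c * q ^ 2 * r) *
    (-(3 * a ^ 2 * c ^ 2 * m * r) + a ^ 2 * c ^ 2 * q ^ 2 + m * r ^ 3 - q ^ 2 * r ^ 2)

def closedI3 (a m q r c : ℝ) : ℝ :=
  96 / (r ^ 2 + a ^ 2 * c ^ 2) ^ 9 *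
    (-(3 * c ^ 6 * a ^ 6 * m ^ 2)
      + (27 * a ^ 4 * m ^ 2 * r ^ 2 - 18 * a ^ 4 * m * q ^ 2 * r + a ^ 4 * q ^ 4) * c ^ 4
      + (-(33 * a ^ 2 * m ^ 2 * r ^ 4) + 44 * a ^ 2 * m * q ^ 2 * r ^ 3
          - 14 * a ^ 2 * q ^ 4 * r ^ 2) * c ^ 2
      + r ^ 6 * m ^ 2 - 2 * m * q ^ 2 * r ^ 5 + q ^ 4 * r ^ 4) *
    ((-(3 * a ^ 2 * m * r) + a ^ 2 * q ^ 2) * c ^ 2 + m * r ^ 3 - q ^ 2 * r ^ 2)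

def closedI4 (a m q r c : ℝ) : ℝ :=
  -(864 * a / (r ^ 2 + a ^ 2 * c ^ 2) ^ 9) *
    (c ^ 3 * a ^ 2 * m / 3 + (-(m * r ^ 2) + 2 / 3 * q ^ 2 * r) * c) *
    (-(c ^ 6 * a ^ 6 * m ^ 2 / 3)
      + (11 * a ^ 4 * m ^ 2 * r ^ 2 - 22 / 3 * a ^ 4 * m * q ^ 2 * r + a ^ 4 * q ^ 4) * c ^ 4
      + (-(9 * a ^ 2 * m ^ 2 * r ^ 4) + 12 * a ^ 2 * m * q ^ 2 * r ^ 3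
          - 10 / 3 * a ^ 2 * q ^ 4 * r ^ 2) * c ^ 2
      - r ^ 4 * (-(3 * m ^ 2 * r ^ 2) + 6 * m * q ^ 2 * r - 3 * q ^ 4) / 3)

def closedI7 (a q Λ r c : ℝ) : ℝ :=
  4 * (Λ ^ 2 * c ^ 8 * a ^ 8 + 4 * Λ ^ 2 * c ^ 6 * a ^ 6 * r ^ 2
      + 6 * Λ ^ 2 * c ^ 4 * a ^ 4 * r ^ 4 + 4 * Λ ^ 2 * c ^ 2 * a ^ 2 * r ^ 6
      + Λ ^ 2 * r ^ 8 + 3 * q ^ 4) * Λ / (r ^ 2 + a ^ 2 * c ^ 2) ^ 4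

def closedI8 (a q Λ r c : ℝ) : ℝ :=
  1 / (r ^ 2 + a ^ 2 * c ^ 2) ^ 8 *
    (4 * Λ ^ 4 * c ^ 16 * a ^ 16 + 32 * Λ ^ 4 * c ^ 14 * a ^ 14 * r ^ 2
      + 112 * Λ ^ 4 * c ^ 12 * a ^ 12 * r ^ 4 + 224 * Λ ^ 4 * c ^ 10 * a ^ 10 * r ^ 6
      + (280 * Λ ^ 4 * a ^ 8 * r ^ 8 + 24 * Λ ^ 2 * a ^ 8 * q ^ 4) * c ^ 8
      + 96 * r ^ 2 * (7 / 3 * a ^ 6 * Λ ^ 4 * r ^ 8 + a ^ 6 * q ^ 4 * Λ ^ 2) * c ^ 6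
      + (112 * Λ ^ 4 * a ^ 4 * r ^ 12 + 144 * Λ ^ 2 * a ^ 4 * q ^ 4 * r ^ 4) * c ^ 4
      + 96 * r ^ 2 * (1 / 3 * Λ ^ 4 * a ^ 2 * r ^ 12 + Λ ^ 2 * a ^ 2 * q ^ 4 * r ^ 4) * c ^ 2
      + 4 * Λ ^ 4 * r ^ 16 + 24 * Λ ^ 2 * q ^ 4 * r ^ 8 + 4 * q ^ 8)

def closedI9 (a m q r c : ℝ) : ℝ :=
  -(16 * (-(3 * a ^ 2 * c ^ 2 * m * r) + a ^ 2 * c ^ 2 * q ^ 2 + m * r ^ 3 - q ^ 2 * r ^ 2)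
      * q ^ 4 / (r ^ 2 + a ^ 2 * c ^ 2) ^ 7)

def closedI10 (a m q r c : ℝ) : ℝ :=
  16 * a * q ^ 4 / (r ^ 2 + a ^ 2 * c ^ 2) ^ 7 *
    (c ^ 3 * a ^ 2 * m - 3 * c * m * r ^ 2 + 2 * c * q ^ 2 * r)

def closedI11 (a m q r c : ℝ) : ℝ :=
  64 * q ^ 4 / (r ^ 2 + a ^ 2 * c ^ 2) ^ 10 *
    (c ^ 3 * a ^ 3 * m + (-(3 * a ^ 2 * m * r) + a ^ 2 * q ^ 2) * c ^ 2
      + (-(3 * a * m * r ^ 2) + 2 * a * q ^ 2 * r) * c - r ^ 2 * (-(m * r) + q ^ 2)) *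
    (-(c ^ 3 * a ^ 3 * m) + (-(3 * a ^ 2 * m * r) + a ^ 2 * q ^ 2) * c ^ 2
      + (3 * a * m * r ^ 2 - 2 * a * q ^ 2 * r) * c + (m * r - q ^ 2) * r ^ 2)

def closedI12 (a m q r c : ℝ) : ℝ :=
  -(128 * a * q ^ 4 / (r ^ 2 + a ^ 2 * c ^ 2) ^ 10) *
    (c ^ 3 * a ^ 2 * m - 3 * c * m * r ^ 2 + 2 * c * q ^ 2 * r) *
    (-(3 * a ^ 2 * c ^ 2 * m * r) + a ^ 2 * c ^ 2 * q ^ 2 + m * r ^ 3 - q ^ 2 * r ^ 2)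

def closedI15 (a m q r c : ℝ) : ℝ :=
  4 * q ^ 4 * (c ^ 2 * a ^ 2 * m ^ 2 + r ^ 2 * m ^ 2 - 2 * m * q ^ 2 * r + q ^ 4)
    / (r ^ 2 + a ^ 2 * c ^ 2) ^ 8

def closedI16 (a m q r c : ℝ) : ℝ :=
  -(24 * q ^ 4 * (c ^ 2 * a ^ 2 * m ^ 2 + (m * r - q ^ 2) ^ 2) *
      (a ^ 2 * (m * r - q ^ 2 / 3) * c ^ 2 - r ^ 2 * (m * r - q ^ 2) / 3)
    / (r ^ 2 + a ^ 2 * c ^ 2) ^ 11)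

def closedI17 (a m q r c : ℝ) : ℝ :=
  -(24 * a * q ^ 4 / (r ^ 2 + a ^ 2 * c ^ 2) ^ 11) *
    (c ^ 3 * a ^ 2 * m / 3 + (-(m * r ^ 2) + 2 / 3 * q ^ 2 * r) * c) *
    (c ^ 2 * a ^ 2 * m ^ 2 + (m * r - q ^ 2) ^ 2)

end CurvInv

end

open scoped BigOperators

noncomputable section

namespace CurvInv

open Matrix

/-! ### Partial derivatives of matrix-valued functions -/

/-! Put X = Δ_r, Z = Δ_θ sin² θ, P = ρ² and u = cos θ. In the Carter coframe the metric is diagonal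
with entries -X/P, P/X, P/Z, Z/P. The coframe is deliberately not orthonormal: all components are
then rational, with no square roots and no case distinction on the signs of X and Z. The table
`carterConn` is the Levi-Civita connection because it is metric (`carterConn_metric`) and
torsion-free (`carterFrame_torsion`), and Cartan's second structure equation
(`riemannUp_eq_frameCurv`) turns it into the coordinate Riemann tensor.

The resulting curvature (`frameCurv_eq_typeDRiemann`) depends on Λ and three numbers: e = q²/P² and
the parts of z = w + iy, where z = ζ²(mζ - q²)/P³ with ζ = r - iau. The Ricci tensor has the
eigenvalue Λ - e on the plane 01 and Λ + e on the plane 23. The Weyl tensor is of type D: on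
self-dual bivectors it acts as 2z in the planes 01 and 23, and as -z in the other planes.
`IsTypeDFrame` records exactly this pointwise data.

The rest is algebra. Bivector maps of this shape compose like complex numbers
(`pairMatrix_planeMap_mul`), and dualising is multiplication by -i (`weylDual_eq`), so I₁, K₂, I₃,
I₄ are 48 Re z², 48 Im z², 96 Re z³, -96 Im z³. For the mixed invariants, contracting the Weyl
tensor with a symmetric tensor of eigenvalues (p, p, s, s) gives a tensor of the same kind,
proportional to w(p - s) (`contr_typeDWeyl`); the dual gives y(p - s). All mixed invariants thereby
become traces of diagonal matrices. The trace-free Ricci tensor has eigenvalues -e, -e, e, e, so its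
square is e² times the metric; contracting that with the Weyl tensor or its dual gives zero, which
yields every vanishing statement at once. -/

/-- The entries of `M` have the entries of `M'` as partial derivatives in the direction `μ`. -/
def HasPDeriv (M : Point → Tensor2) (M' : Tensor2) (μ : Fin 4) (x : Point) : Prop :=
  ∀ i j, HasDerivAt (fun s => M (Function.update x μ s) i j) (M' i j) (x μ)

namespace HasPDeriv

variable {M N : Point → Tensor2} {M' N' : Tensor2} {μ : Fin 4} {x : Point}

theorem pderiv_eq (h : HasPDeriv M M' μ x) (i j : Fin 4) :
    pderiv μ (fun y => M y i j) x = M' i j := (h i j).deriv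

theorem mul (hM : HasPDeriv M M' μ x) (hN : HasPDeriv N N' μ x) :
    HasPDeriv (fun y => M y * N y) (M' * N x + M x * N') μ x := by
  intro i j
  have := HasDerivAt.fun_sum (u := Finset.univ) fun k _ => (hM i k).mul (hN k j)
  simpa [Matrix.mul_apply, Finset.sum_add_distrib] using this

theorem add (hM : HasPDeriv M M' μ x) (hN : HasPDeriv N N' μ x) :
    HasPDeriv (fun y => M y + N y) (M' + N') μ x := fun i j => (hM i j).add (hN i j)

theorem transpose (hM : HasPDeriv M M' μ x) :
    HasPDeriv (fun y => (M y)ᵀ) M'ᵀ μ x := fun i j => hM j i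

theorem sum_smul {f : Fin 4 → Point → ℝ} {f' : Fin 4 → ℝ} {A : Fin 4 → Point → Tensor2}
    {A' : Fin 4 → Tensor2}
    (hf : ∀ c, HasDerivAt (fun s => f c (Function.update x μ s)) (f' c) (x μ))
    (hA : ∀ c, HasPDeriv (A c) (A' c) μ x) :
    HasPDeriv (fun y => ∑ c, f c y • A c y) (∑ c, (f' c • A c x + f c x • A' c)) μ x := by
  intro i j
  have := HasDerivAt.fun_sum (u := Finset.univ) fun c _ => (hf c).mul (hA c i j)
  simpa [Matrix.sum_apply] using this

theorem congr_of_eventuallyEq (h : HasPDeriv M M' μ x)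
    (e : ∀ᶠ s in nhds (x μ), N (Function.update x μ s) = M (Function.update x μ s)) :
    HasPDeriv N M' μ x := fun i j =>
  (h i j).congr_of_eventuallyEq (by filter_upwards [e] with s hs; rw [hs])

theorem congr' (h : HasPDeriv M M' μ x) (e : M' = N') : HasPDeriv M N' μ x := e ▸ h

end HasPDeriv

/-! ### Curvature from a moving frame -/

/-- The Christoffel symbols are the unique symmetric solution of the compatibility equation. -/
theorem christoffel_eq_of_compatible {g : Metric} {x : Point} {G : Fin 4 → Tensor2}
    (hu : (g x)⁻¹ * g x = 1)
    (hg : ∀ μ, HasPDeriv g (g x * G μ + (g x * G μ)ᵀ) μ x)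
    (hs : ∀ l μ ν, G ν l μ = G μ l ν) (l μ ν : Fin 4) :
    christoffel g l μ ν x = G ν l μ := by
  have hN : ∀ μ ν α, (g x * G ν) α μ = (g x * G μ) α ν := by
    intro μ ν α
    simp [Matrix.mul_apply, hs _ μ ν]
  -- The Koszul computation: compatibility splits the three derivatives into six terms, of which
  -- four cancel in pairs by symmetry and the other two coincide.
  have key : ∀ α, (pderiv ν (fun y => g y μ α) x + pderiv μ (fun y => g y ν α) x
      - pderiv α (fun y => g y μ ν) x) = 2 * (g x * G ν) α μ := by
    intro α
    rw [(hg ν).pderiv_eq, (hg μ).pderiv_eq, (hg α).pderiv_eq]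
    simp only [Matrix.add_apply, Matrix.transpose_apply]
    rw [hN μ ν α, hN α ν μ, hN α μ ν]
    ring
  unfold christoffel
  simp_rw [key]
  have : ∑ α, (g x)⁻¹ l α * (g x * G ν) α μ = G ν l μ := by
    rw [← Matrix.mul_apply, ← Matrix.mul_assoc, hu, Matrix.one_mul]
  rw [← this, Finset.mul_sum]
  refine Finset.sum_congr rfl fun α _ => by ring

/-- The connection matrix in the coordinate direction `μ`, from its values along the frame. -/
def connForm (E : Tensor2) (A : Fin 4 → Tensor2) (μ : Fin 4) : Tensor2 := ∑ c, E c μ • A c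

/-- The coordinate connection obtained from a frame connection `A` by a change of frame. -/
def coordConn (E F : Tensor2) (dE A : Fin 4 → Tensor2) (μ : Fin 4) : Tensor2 :=
  F * (connForm E A μ * E + dE μ)

/-- The Leibniz rule applied to `Eᵀ * diagonal d * E` shows that the gauge-transformed connection is
metric, and `hT` (vanishing torsion) makes it symmetric in its lower indices; uniqueness of the
Levi-Civita connection does the rest. -/
theorem christoffel_eq_coordConn {g : Metric} {E : Point → Tensor2} {d : Point → Fin 4 → ℝ}
    {F : Tensor2} {dE A : Fin 4 → Tensor2} {x : Point} (hgx : g x = (E x)ᵀ * diagonal (d x) * E x)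
    (hg : ∀ μ, ∀ᶠ s in nhds (x μ), g (Function.update x μ s) = (E (Function.update x μ s))ᵀ *
      diagonal (d (Function.update x μ s)) * E (Function.update x μ s))
    (hEF : E x * F = 1) (hd : ∀ i, d x i ≠ 0)
    (hE : ∀ μ, HasPDeriv E (dE μ) μ x)
    (hD : ∀ μ, HasPDeriv (fun y => diagonal (d y)) (diagonal (d x) * connForm (E x) A μ +
      (diagonal (d x) * connForm (E x) A μ)ᵀ) μ x)
    (hT : ∀ μ ν c, (connForm (E x) A μ * E x + dE μ) c ν = (connForm (E x) A ν * E x + dE ν) c μ)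
    (l μ ν : Fin 4) :
    christoffel g l μ ν x = coordConn (E x) F dE A ν l μ := by
  have hFE : F * E x = 1 := mul_eq_one_comm.1 hEF
  have hdet : IsUnit (g x).det := by
    rw [hgx, Matrix.det_mul, Matrix.det_mul, Matrix.det_transpose, Matrix.det_diagonal]
    have h1 : (E x).det ≠ 0 := by
      intro h0
      have := congrArg Matrix.det hEF
      rw [Matrix.det_mul, h0] at this
      simp at this
    exact (mul_ne_zero (mul_ne_zero h1 (Finset.prod_ne_zero_iff.2 fun i _ => hd i)) h1).isUnit
  refine christoffel_eq_of_compatible (G := fun ν => coordConn (E x) F dE A ν)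
    (Matrix.nonsing_inv_mul _ hdet) (fun μ => ?_) (fun l μ ν => ?_) l μ ν
  · have h := ((hE μ).transpose.mul (hD μ)).mul (hE μ)
    have hgG : g x * coordConn (E x) F dE A μ =
        (E x)ᵀ * diagonal (d x) * (connForm (E x) A μ * E x + dE μ) := by
      rw [hgx, coordConn, ← Matrix.mul_assoc, Matrix.mul_assoc _ (E x) F, hEF, Matrix.mul_one]
    rw [hgG]
    refine (h.congr_of_eventuallyEq (hg μ)).congr' ?_
    simp only [Matrix.transpose_mul, Matrix.transpose_add, Matrix.transpose_transpose,
      Matrix.diagonal_transpose]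
    noncomm_ring
  · simp only [coordConn, Matrix.mul_apply (M := F)]
    exact Finset.sum_congr rfl fun c _ => by rw [hT]

/-- The curvature of the frame connection `A` along the frame vectors `k` and `l`; the matrix
`B k c` is the derivative of `A c` along the frame vector `k`. -/
def frameCurv (A : Fin 4 → Tensor2) (B : Fin 4 → Fin 4 → Tensor2) (k l : Fin 4) : Tensor2 :=
  B k l - B l k + ∑ c, (A l c k - A k c l) • A c + (A k * A l - A l * A k)

theorem frameCurv_antisymm (A : Fin 4 → Tensor2) (B : Fin 4 → Fin 4 → Tensor2) (k l : Fin 4) :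
    frameCurv A B l k = -frameCurv A B k l := by
  have : ∑ c, (A k c l - A l c k) • A c = -∑ c, (A l c k - A k c l) • A c := by
    rw [← Finset.sum_neg_distrib]
    exact Finset.sum_congr rfl fun c _ => by rw [← neg_smul, neg_sub]
  rw [frameCurv, frameCurv, this]
  abel

/-- Cartan's second structure equation, dω + ω ∧ ω expanded along the frame. Vanishing torsion
trades the exterior derivative of the coframe for the structure constants of the frame, which is the
origin of the middle sum in `frameCurv`. -/
theorem frame_structure_equation {E : Tensor2} {A dE : Fin 4 → Tensor2}
    {B : Fin 4 → Fin 4 → Tensor2}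
    (hT : ∀ μ ν c, (connForm E A μ * E + dE μ) c ν = (connForm E A ν * E + dE ν) c μ)
    (μ ν : Fin 4) :
    (∑ c, (dE μ c ν • A c + E c ν • ∑ k, E k μ • B k c))
      - (∑ c, (dE ν c μ • A c + E c μ • ∑ k, E k ν • B k c))
      + (connForm E A μ * connForm E A ν - connForm E A ν * connForm E A μ)
      = ∑ k, ∑ l, (E k μ * E l ν) • frameCurv A B k l := by
  have h1 : ∀ c, dE μ c ν - dE ν c μ = ∑ k, ∑ l, (E k μ * E l ν) * (A l c k - A k c l) := by
    intro c
    have := hT μ ν c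
    simp only [Matrix.add_apply, connForm, Matrix.mul_apply, Matrix.sum_apply, Matrix.smul_apply,
      smul_eq_mul, Finset.sum_mul] at this
    simp only [mul_sub, Finset.sum_sub_distrib]
    rw [sub_eq_sub_iff_add_eq_add]
    have e1 : ∑ k, ∑ l, E k μ * E l ν * A l c k = ∑ i, ∑ x, E i ν * A i c x * E x μ := by
      rw [Finset.sum_comm]
      exact Finset.sum_congr rfl fun _ _ => Finset.sum_congr rfl fun _ _ => by ring
    have e2 : ∑ k, ∑ l, E k μ * E l ν * A k c l = ∑ i, ∑ x, E i μ * A i c x * E x ν :=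
      Finset.sum_congr rfl fun _ _ => Finset.sum_congr rfl fun _ _ => by ring
    rw [e1, e2]
    linarith
  have h2 : (∑ c, dE μ c ν • A c) - ∑ c, dE ν c μ • A c
      = ∑ k, ∑ l, (E k μ * E l ν) • ∑ c, (A l c k - A k c l) • A c := by
    rw [← Finset.sum_sub_distrib]
    simp_rw [← sub_smul, h1, Finset.sum_smul, Finset.smul_sum, smul_smul]
    rw [Finset.sum_comm]
    refine Finset.sum_congr rfl fun k _ => ?_
    rw [Finset.sum_comm]
  have h3 : connForm E A μ * connForm E A ν - connForm E A ν * connForm E A μ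
      = ∑ k, ∑ l, (E k μ * E l ν) • (A k * A l - A l * A k) := by
    simp only [connForm, Finset.sum_mul_sum, smul_sub, Finset.sum_sub_distrib, smul_mul_smul_comm]
    congr 1
    rw [Finset.sum_comm]
    exact Finset.sum_congr rfl fun _ _ => Finset.sum_congr rfl fun _ _ => by rw [mul_comm (E _ ν)]
  have h4 : (∑ c, E c ν • ∑ k, E k μ • B k c) - ∑ c, E c μ • ∑ k, E k ν • B k c
      = ∑ k, ∑ l, (E k μ * E l ν) • (B k l - B l k) := by
    simp only [Finset.smul_sum, smul_smul, smul_sub, Finset.sum_sub_distrib]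
    congr 1
    rw [Finset.sum_comm]
    exact Finset.sum_congr rfl fun _ _ => Finset.sum_congr rfl fun _ _ => by rw [mul_comm (E _ ν)]
  simp only [frameCurv, smul_add, Finset.sum_add_distrib]
  rw [← h2, ← h3, ← h4]
  abel

/-- Gauge covariance: the curvature of `F (A E + dE)` is the curvature of `A` conjugated by the
frame. The set `U` is there because the Christoffel symbols must be known near `x`, at least along
coordinate lines, before they can be differentiated. -/
theorem riemannUp_eq_frameCurv {g : Metric} {E F : Point → Tensor2} {d : Point → Fin 4 → ℝ}
    {dE A : Fin 4 → Point → Tensor2} {ddE B : Fin 4 → Fin 4 → Tensor2} {x : Point}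
    {U : Set Point} (hU : ∀ y ∈ U, ∀ μ, ∀ᶠ s in nhds (y μ), Function.update y μ s ∈ U) (hx : x ∈ U)
    (hg : ∀ y ∈ U, g y = (E y)ᵀ * diagonal (d y) * E y)
    (hEF : ∀ y ∈ U, E y * F y = 1) (hd : ∀ y ∈ U, ∀ i, d y i ≠ 0)
    (hE : ∀ y ∈ U, ∀ μ, HasPDeriv E (dE μ y) μ y)
    (hD : ∀ y ∈ U, ∀ μ, HasPDeriv (fun y => diagonal (d y))
      (diagonal (d y) * connForm (E y) (fun c => A c y) μ +
        (diagonal (d y) * connForm (E y) (fun c => A c y) μ)ᵀ) μ y)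
    (hT : ∀ y ∈ U, ∀ μ ν c, (connForm (E y) (fun c => A c y) μ * E y + dE μ y) c ν
      = (connForm (E y) (fun c => A c y) ν * E y + dE ν y) c μ)
    (hF : ∀ μ, HasPDeriv F (-(F x * dE μ x * F x)) μ x)
    (hdE : ∀ μ ν, HasPDeriv (dE ν) (ddE μ ν) μ x) (hdd : ∀ μ ν, ddE μ ν = ddE ν μ)
    (hA : ∀ μ c, HasPDeriv (A c) (∑ k, E x k μ • B k c) μ x) (κ l μ ν : Fin 4) :
    riemannUp g x κ l μ ν = (F x * (∑ k, ∑ l, (E x k μ * E x l ν) •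
      frameCurv (fun c => A c x) B k l) * E x) κ l := by
  set G : Fin 4 → Point → Tensor2 := fun ν y =>
    coordConn (E y) (F y) (fun μ => dE μ y) (fun c => A c y) ν with hGdef
  have hchr : ∀ y ∈ U, ∀ l μ ν, christoffel g l μ ν y = G ν y l μ := fun y hy l μ ν =>
    christoffel_eq_coordConn (hg y hy)
      (fun μ => by filter_upwards [hU y hy μ] with s hs using hg _ hs) (hEF y hy) (hd y hy) (hE y hy) (hD y hy) (hT y hy) l μ ν
  set W : Fin 4 → Tensor2 := connForm (E x) (fun c => A c x) with hW
  set W' : Fin 4 → Fin 4 → Tensor2 := fun μ ν =>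
    ∑ c, (dE μ x c ν • A c x + E x c ν • ∑ k, E x k μ • B k c) with hW'
  have hFE : F x * E x = 1 := mul_eq_one_comm.1 (hEF x hx)
  have hG' : ∀ μ ν, HasPDeriv (G ν)
      (-(F x * dE μ x * F x) * (W ν * E x + dE ν x)
        + F x * (W' μ ν * E x + W ν * dE μ x + ddE μ ν)) μ x := by
    intro μ ν
    have h1 : HasPDeriv (fun y => connForm (E y) (fun c => A c y) ν) (W' μ ν) μ x :=
      HasPDeriv.sum_smul (f := fun c y => E y c ν) (fun c => hE x hx μ c ν) (hA μ)
    exact (hF μ).mul ((h1.mul (hE x hx μ)).add (hdE μ ν))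
  have hpd : ∀ μ ν κ l, pderiv μ (christoffel g κ l ν) x
      = (-(F x * dE μ x * F x) * (W ν * E x + dE ν x)
        + F x * (W' μ ν * E x + W ν * dE μ x + ddE μ ν)) κ l := by
    intro μ ν κ l
    rw [← (hG' μ ν).pderiv_eq κ l]
    refine Filter.EventuallyEq.deriv_eq ?_
    filter_upwards [hU x hx μ] with s hs using hchr _ hs _ _ _
  -- The inhomogeneous terms of the gauge transformation cancel: second derivatives of the coframe
  -- by symmetry, first derivatives against the cross terms of the commutator once `E * F = 1` is
  -- used.
  have hmat : F x * (W' μ ν - W' ν μ + (W μ * W ν - W ν * W μ)) * E x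
      = (-(F x * dE μ x * F x) * (W ν * E x + dE ν x)
        + F x * (W' μ ν * E x + W ν * dE μ x + ddE μ ν))
      - (-(F x * dE ν x * F x) * (W μ * E x + dE μ x)
        + F x * (W' ν μ * E x + W μ * dE ν x + ddE ν μ))
      + (G μ x * G ν x - G ν x * G μ x) := by
    have hGG : ∀ μ ν, G μ x * G ν x = F x * W μ * (W ν * E x + dE ν x)
        + F x * dE μ x * F x * (W ν * E x + dE ν x) := by
      intro μ ν
      simp only [hGdef, coordConn, ← hW]
      have : F x * (W μ * E x + dE μ x) * (F x * (W ν * E x + dE ν x))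
          = F x * W μ * (E x * F x) * (W ν * E x + dE ν x)
            + F x * dE μ x * F x * (W ν * E x + dE ν x) := by noncomm_ring
      rw [this, hEF x hx, Matrix.mul_one]
    rw [hGG, hGG, hdd ν μ]
    noncomm_ring
  have hstr := frame_structure_equation (B := B) (hT x hx) μ ν
  rw [← hstr]
  change _ = (F x * (W' μ ν - W' ν μ + (W μ * W ν - W ν * W μ)) * E x) κ l
  rw [hmat]
  unfold riemannUp
  rw [hpd, hpd]
  simp only [Matrix.add_apply, Matrix.sub_apply, Matrix.mul_apply (M := G _ x),
    hchr x hx, Finset.sum_sub_distrib]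
  congr 2
  · exact Finset.sum_congr rfl fun _ _ => mul_comm _ _
  · exact Finset.sum_congr rfl fun _ _ => mul_comm _ _

/-! ### The connection and the curvature of the Carter frame -/

/-- The connection coefficients `Γ^a_{bc}` of the Carter frame,
        `c` first; `X` and `Z` are the radial and the
polar function, `X1` and `Z1` their derivatives, and `P = r² + a² u²`. -/
def carterConn (a r u X X1 Z Z1 P : ℝ) : Fin 4 → Tensor2 :=
  ![!![0, -(r / P) + X1 / (2 * X), a ^ 2 * u / P, 0;
      -(r * X ^ 2 / P ^ 3) + X * X1 / (2 * P ^ 2), 0, 0, a * r * X * Z / P ^ 3;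
      a ^ 2 * u * X * Z / P ^ 3, 0, 0, -(a * u * X * Z / P ^ 3);
      0, -(a * r / P), a * u * X / (Z * P), 0],
    !![-(r / P) + X1 / (2 * X), 0, 0, a * r * Z / (X * P);
      0, r / P - X1 / (2 * X), a ^ 2 * u / P, 0;
      0, -(a ^ 2 * u * Z / (X * P)), r / P, 0;
      a * r / P, 0, 0, -(r / P)],
    !![-(a ^ 2 * u / P), 0, 0, a * u / P;
      0, a ^ 2 * u / P, -(r * X / (Z * P)), 0;
      0, r / P, a ^ 2 * u / P - Z1 / (2 * Z), 0;
      a * u * X / (Z * P), 0, 0, -(a ^ 2 * u / P) + Z1 / (2 * Z)],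
    !![0, a * r * Z / (X * P), -(a * u / P), 0;
      a * r * X * Z / P ^ 3, 0, 0, -(r * X * Z / P ^ 3);
      -(a * u * X * Z / P ^ 3), 0, 0, a ^ 2 * u * Z ^ 2 / P ^ 3 - Z * Z1 / (2 * P ^ 2);
      0, r / P, -(a ^ 2 * u / P) + Z1 / (2 * Z), 0]]

/-- The radial derivative of `carterConn`. -/
def carterConnRadial (a r u X X1 X2 Z Z1 P : ℝ) : Fin 4 → Tensor2 :=
  ![!![0, 2 * r ^ 2 / P ^ 2 - 1 / P + X2 / (2 * X) - X1 ^ 2 / (2 * X ^ 2),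
        -(2 * a ^ 2 * r * u / P ^ 2), 0;
      6 * r ^ 2 * X ^ 2 / P ^ 4 - 4 * r * X * X1 / P ^ 3 - X ^ 2 / P ^ 3 + X * X2 / (2 * P ^ 2)
        + X1 ^ 2 / (2 * P ^ 2), 0, 0, -(6 * a * r ^ 2 * X * Z / P ^ 4) + a * r * X1 * Z / P ^ 3
        + a * X * Z / P ^ 3;
      -(6 * a ^ 2 * r * u * X * Z / P ^ 4) + a ^ 2 * u * X1 * Z / P ^ 3, 0, 0,
        6 * a * r * u * X * Z / P ^ 4 - a * u * X1 * Z / P ^ 3;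
      0, 2 * a * r ^ 2 / P ^ 2 - a / P, -(2 * a * r * u * X / (Z * P ^ 2)) + a * u * X1 / (Z * P),
        0],
    !![2 * r ^ 2 / P ^ 2 - 1 / P + X2 / (2 * X) - X1 ^ 2 / (2 * X ^ 2), 0, 0,
        -(2 * a * r ^ 2 * Z / (X * P ^ 2)) - a * r * X1 * Z / (X ^ 2 * P) + a * Z / (X * P);
      0, -(2 * r ^ 2 / P ^ 2) + 1 / P - X2 / (2 * X) + X1 ^ 2 / (2 * X ^ 2),
        -(2 * a ^ 2 * r * u / P ^ 2), 0;
      0, 2 * a ^ 2 * r * u * Z / (X * P ^ 2) + a ^ 2 * u * X1 * Z / (X ^ 2 * P),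
        -(2 * r ^ 2 / P ^ 2) + 1 / P, 0;
      -(2 * a * r ^ 2 / P ^ 2) + a / P, 0, 0, 2 * r ^ 2 / P ^ 2 - 1 / P],
    !![2 * a ^ 2 * r * u / P ^ 2, 0, 0, -(2 * a * r * u / P ^ 2);
      0, -(2 * a ^ 2 * r * u / P ^ 2), 2 * r ^ 2 * X / (Z * P ^ 2) - r * X1 / (Z * P)
        - X / (Z * P), 0;
      0, -(2 * r ^ 2 / P ^ 2) + 1 / P, -(2 * a ^ 2 * r * u / P ^ 2), 0;
      -(2 * a * r * u * X / (Z * P ^ 2)) + a * u * X1 / (Z * P), 0, 0, 2 * a ^ 2 * r * u / P ^ 2],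
    !![0, -(2 * a * r ^ 2 * Z / (X * P ^ 2)) - a * r * X1 * Z / (X ^ 2 * P) + a * Z / (X * P),
        2 * a * r * u / P ^ 2, 0;
      -(6 * a * r ^ 2 * X * Z / P ^ 4) + a * r * X1 * Z / P ^ 3 + a * X * Z / P ^ 3, 0, 0,
        6 * r ^ 2 * X * Z / P ^ 4 - r * X1 * Z / P ^ 3 - X * Z / P ^ 3;
      6 * a * r * u * X * Z / P ^ 4 - a * u * X1 * Z / P ^ 3, 0, 0,
        -(6 * a ^ 2 * r * u * Z ^ 2 / P ^ 4) + 2 * r * Z * Z1 / P ^ 3;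
      0, -(2 * r ^ 2 / P ^ 2) + 1 / P, 2 * a ^ 2 * r * u / P ^ 2, 0]]

/-- The derivative of `carterConn` with respect to `u`. -/
def carterConnPolar (a r u X X1 Z Z1 Z2 P : ℝ) : Fin 4 → Tensor2 :=
  ![!![0, 2 * a ^ 2 * r * u / P ^ 2, -(2 * a ^ 4 * u ^ 2 / P ^ 2) + a ^ 2 / P, 0;
      6 * a ^ 2 * r * u * X ^ 2 / P ^ 4 - 2 * a ^ 2 * u * X * X1 / P ^ 3, 0, 0,
        -(6 * a ^ 3 * r * u * X * Z / P ^ 4) + a * r * X * Z1 / P ^ 3;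
      -(6 * a ^ 4 * u ^ 2 * X * Z / P ^ 4) + a ^ 2 * u * X * Z1 / P ^ 3 + a ^ 2 * X * Z / P ^ 3, 0,
        0, 6 * a ^ 3 * u ^ 2 * X * Z / P ^ 4 - a * u * X * Z1 / P ^ 3 - a * X * Z / P ^ 3;
      0, 2 * a ^ 3 * r * u / P ^ 2, -(2 * a ^ 3 * u ^ 2 * X / (Z * P ^ 2))
        - a * u * X * Z1 / (Z ^ 2 * P) + a * X / (Z * P), 0],
    !![2 * a ^ 2 * r * u / P ^ 2, 0, 0, -(2 * a ^ 3 * r * u * Z / (X * P ^ 2))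
        + a * r * Z1 / (X * P);
      0, -(2 * a ^ 2 * r * u / P ^ 2), -(2 * a ^ 4 * u ^ 2 / P ^ 2) + a ^ 2 / P, 0;
      0, 2 * a ^ 4 * u ^ 2 * Z / (X * P ^ 2) - a ^ 2 * u * Z1 / (X * P) - a ^ 2 * Z / (X * P),
        -(2 * a ^ 2 * r * u / P ^ 2), 0;
      -(2 * a ^ 3 * r * u / P ^ 2), 0, 0, 2 * a ^ 2 * r * u / P ^ 2],
    !![2 * a ^ 4 * u ^ 2 / P ^ 2 - a ^ 2 / P, 0, 0, -(2 * a ^ 3 * u ^ 2 / P ^ 2) + a / P;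
      0, -(2 * a ^ 4 * u ^ 2 / P ^ 2) + a ^ 2 / P,
        2 * a ^ 2 * r * u * X / (Z * P ^ 2) + r * X * Z1 / (Z ^ 2 * P), 0;
      0, -(2 * a ^ 2 * r * u / P ^ 2), -(2 * a ^ 4 * u ^ 2 / P ^ 2) + a ^ 2 / P - Z2 / (2 * Z)
        + Z1 ^ 2 / (2 * Z ^ 2), 0;
      -(2 * a ^ 3 * u ^ 2 * X / (Z * P ^ 2)) - a * u * X * Z1 / (Z ^ 2 * P) + a * X / (Z * P), 0,
        0, 2 * a ^ 4 * u ^ 2 / P ^ 2 - a ^ 2 / P + Z2 / (2 * Z) - Z1 ^ 2 / (2 * Z ^ 2)],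
    !![0, -(2 * a ^ 3 * r * u * Z / (X * P ^ 2)) + a * r * Z1 / (X * P),
        2 * a ^ 3 * u ^ 2 / P ^ 2 - a / P, 0;
      -(6 * a ^ 3 * r * u * X * Z / P ^ 4) + a * r * X * Z1 / P ^ 3, 0, 0,
        6 * a ^ 2 * r * u * X * Z / P ^ 4 - r * X * Z1 / P ^ 3;
      6 * a ^ 3 * u ^ 2 * X * Z / P ^ 4 - a * u * X * Z1 / P ^ 3 - a * X * Z / P ^ 3, 0, 0,
        -(6 * a ^ 4 * u ^ 2 * Z ^ 2 / P ^ 4) + 4 * a ^ 2 * u * Z * Z1 / P ^ 3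
        + a ^ 2 * Z ^ 2 / P ^ 3 - Z * Z2 / (2 * P ^ 2) - Z1 ^ 2 / (2 * P ^ 2);
      0, -(2 * a ^ 2 * r * u / P ^ 2), 2 * a ^ 4 * u ^ 2 / P ^ 2 - a ^ 2 / P + Z2 / (2 * Z)
        - Z1 ^ 2 / (2 * Z ^ 2), 0]]

/-- The derivatives of `carterConn` along the frame vectors. -/
def carterConnDeriv (a r u X X1 X2 Z Z1 Z2 P : ℝ) : Fin 4 → Fin 4 → Tensor2 :=
  ![0, carterConnRadial a r u X X1 X2 Z Z1 P, carterConnPolar a r u X X1 Z Z1 Z2 P, 0]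

theorem hasDerivAt_carterConn_radial {a r u Z Z1 X2 : ℝ} {X X1 P : ℝ → ℝ} (hX : X r ≠ 0)
    (hP : P r ≠ 0) (h1 : HasDerivAt X (X1 r) r) (h2 : HasDerivAt X1 X2 r)
    (hZ : Z ≠ 0) (h3 : HasDerivAt P (2 * r) r) (c i j : Fin 4) :
    HasDerivAt (fun s => carterConn a s u (X s) (X1 s) Z Z1 (P s) c i j)
      (carterConnRadial a r u (X r) (X1 r) X2 Z Z1 (P r) c i j) r := by
  fin_cases c <;> fin_cases i <;> fin_cases j <;>
  simp only [carterConn, carterConnRadial, Fin.zero_eta, Fin.mk_one, Fin.reduceFinMk, cons_val,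
    of_apply] <;>
  -- The derivative stays a metavariable while the expression is taken apart along its syntax; the
  -- last goal compares what was found with the tabulated entry.
  (apply HasDerivAt.congr_deriv
   · repeat' first
      | exact hasDerivAt_const _ _
      | exact h1
      | exact h2
      | exact h3
      | exact hasDerivAt_id' _
      | apply HasDerivAt.fun_pow
      | apply HasDerivAt.fun_add
      | apply HasDerivAt.fun_sub
      | apply HasDerivAt.fun_neg
      | apply HasDerivAt.fun_div
      | apply HasDerivAt.fun_mul
      | simp [hX, hZ, hP]
   · (try field_simp) <;> (try ring))

theorem hasDerivAt_carterConn_polar {a r u X X1 Z2 : ℝ} {Z Z1 P : ℝ → ℝ} (hX : X ≠ 0)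
    (hP : P u ≠ 0) (h1 : HasDerivAt Z (Z1 u) u) (h2 : HasDerivAt Z1 Z2 u)
    (hZ : Z u ≠ 0) (h3 : HasDerivAt P (2 * a ^ 2 * u) u) (c i j : Fin 4) :
    HasDerivAt (fun s => carterConn a r s X X1 (Z s) (Z1 s) (P s) c i j)
      (carterConnPolar a r u X X1 (Z u) (Z1 u) Z2 (P u) c i j) u := by
  fin_cases c <;> fin_cases i <;> fin_cases j <;>
  simp only [carterConn, carterConnPolar, Fin.zero_eta, Fin.mk_one, Fin.reduceFinMk, cons_val,
    of_apply] <;>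
  (apply HasDerivAt.congr_deriv
   · repeat' first
      | exact hasDerivAt_const _ _
      | exact h1
      | exact h2
      | exact h3
      | exact hasDerivAt_id' _
      | apply HasDerivAt.fun_pow
      | apply HasDerivAt.fun_add
      | apply HasDerivAt.fun_sub
      | apply HasDerivAt.fun_neg
      | apply HasDerivAt.fun_div
      | apply HasDerivAt.fun_mul
      | simp [hX, hZ, hP]
   · (try field_simp) <;> (try ring))

/-! ### The radial and polar functions, and the frame components of the curvature. -/

/-- The derivative of `Δ_r`. -/
def deltaR' (a m Λ r : ℝ) : ℝ :=
  -(2 * Λ / 3) * r * (r ^ 2 + a ^ 2) + (1 - Λ / 3 * r ^ 2) * (2 * r) - 2 * m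

/-- The second derivative of `Δ_r`. -/
def deltaR'' (a Λ r : ℝ) : ℝ := 2 - 2 * Λ / 3 * a ^ 2 - 4 * Λ * r ^ 2

/-- The function `Δ_θ sin² θ` in terms of `u = cos θ`. -/
def polarFun (a Λ u : ℝ) : ℝ := (1 + a ^ 2 * Λ / 3 * u ^ 2) * (1 - u ^ 2)

/-- The derivative of `polarFun`. -/
def polarFun' (a Λ u : ℝ) : ℝ := -(2 * u) + a ^ 2 * Λ / 3 * (2 * u - 4 * u ^ 3)

/-- The second derivative of `polarFun`. -/
def polarFun'' (a Λ u : ℝ) : ℝ := -2 + a ^ 2 * Λ / 3 * (2 - 12 * u ^ 2)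

/-- The polynomial `P³ Re (-Ψ₂)`. -/
def weylNumRe (a m q r u : ℝ) : ℝ :=
  -(3 * a ^ 2 * u ^ 2 * m * r) + a ^ 2 * u ^ 2 * q ^ 2 + m * r ^ 3 - q ^ 2 * r ^ 2

/-- The polynomial `P³ Im Ψ₂`. -/
def weylNumIm (a m q r u : ℝ) : ℝ :=
  a * (u ^ 3 * a ^ 2 * m - 3 * u * m * r ^ 2 + 2 * u * q ^ 2 * r)

/-- The values of the metric functions and of their derivatives at a regular point. -/
structure CarterValues (a m q Λ r u X X1 X2 Z Z1 Z2 P : ℝ) : Prop where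
  P_eq : P = r ^ 2 + a ^ 2 * u ^ 2
  X_eq : X = deltaR a m q Λ r
  X1_eq : X1 = deltaR' a m Λ r
  X2_eq : X2 = deltaR'' a Λ r
  Z_eq : Z = polarFun a Λ u
  Z1_eq : Z1 = polarFun' a Λ u
  Z2_eq : Z2 = polarFun'' a Λ u
  P_ne : P ≠ 0
  X_ne : X ≠ 0
  Z_ne : Z ≠ 0

namespace CarterValues

variable {a m q Λ r u X X1 X2 Z Z1 Z2 P : ℝ}

-- The metric functions and their derivatives remain independent letters while denominators are
-- cleared. Their polynomial values enter only afterwards, so that each entry ends as a polynomial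
-- identity in r and u.
set_option maxHeartbeats 1000000 in
set_option maxRecDepth 4000 in
theorem frameCurv_zero_one (h : CarterValues a m q Λ r u X X1 X2 Z Z1 Z2 P) :
    frameCurv (carterConn a r u X X1 Z Z1 P) (carterConnDeriv a r u X X1 X2 Z Z1 Z2 P) 0 1 =
      !![0, (2 * weylNumRe a m q r u / P ^ 3 + Λ / 3 - q ^ 2 / P ^ 2) * (P / X), 0, 0;
        (2 * weylNumRe a m q r u / P ^ 3 + Λ / 3 - q ^ 2 / P ^ 2) * (X / P), 0, 0, 0;
        0, 0, 0, -(2 * weylNumIm a m q r u / P ^ 3) * (Z / P);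
        0, 0, 2 * weylNumIm a m q r u / P ^ 3 * (P / Z), 0] := by
  obtain ⟨hP, hX, hX1, hX2, hZ, hZ1, hZ2, hP0, hX0, hZ0⟩ := h
  ext i j
  fin_cases i <;> fin_cases j <;>
  simp only [frameCurv, carterConn, carterConnDeriv, carterConnRadial, carterConnPolar,
    Matrix.add_apply, Matrix.sub_apply, Matrix.neg_apply, Matrix.smul_apply, Matrix.mul_apply,
    Pi.zero_apply, Fin.sum_univ_four, smul_eq_mul, Fin.zero_eta, Fin.mk_one, Fin.reduceFinMk,
    Fin.isValue, cons_val, of_apply, mul_zero, zero_mul, add_zero, zero_add, zero_sub,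
    neg_zero, sub_self] <;>
  (try field_simp) <;>
  (try (subst hX hX1 hX2 hZ hZ1 hZ2 hP
        simp only [deltaR, deltaR', deltaR'', polarFun, polarFun', weylNumRe,
          weylNumIm]
        ring))

-- No term q²/P² occurs in this plane or in 03, 12, 13: such a plane joins the two Ricci
-- eigenspaces, so the eigenvalues Λ - q²/P² and Λ + q²/P² enter only through their mean.
set_option maxHeartbeats 1000000 in
set_option maxRecDepth 4000 in
theorem frameCurv_zero_two (h : CarterValues a m q Λ r u X X1 X2 Z Z1 Z2 P) :
    frameCurv (carterConn a r u X X1 Z Z1 P) (carterConnDeriv a r u X X1 X2 Z Z1 Z2 P) 0 2 =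
      !![0, 0, (-(weylNumRe a m q r u / P ^ 3) + Λ / 3) * (P / Z), 0;
        0, 0, 0, -(weylNumIm a m q r u / P ^ 3) * (X / P);
        (-(weylNumRe a m q r u / P ^ 3) + Λ / 3) * (X / P), 0, 0, 0;
        0, weylNumIm a m q r u / P ^ 3 * (P / Z), 0, 0] := by
  obtain ⟨hP, hX, hX1, hX2, hZ, hZ1, hZ2, hP0, hX0, hZ0⟩ := h
  ext i j
  fin_cases i <;> fin_cases j <;>
  simp only [frameCurv, carterConn, carterConnDeriv, carterConnRadial, carterConnPolar,
    Matrix.add_apply, Matrix.sub_apply, Matrix.neg_apply, Matrix.smul_apply, Matrix.mul_apply,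
    Pi.zero_apply, Fin.sum_univ_four, smul_eq_mul, Fin.zero_eta, Fin.mk_one, Fin.reduceFinMk,
    Fin.isValue, cons_val, of_apply, mul_zero, zero_mul, add_zero, zero_add, zero_sub,
    neg_zero, sub_self] <;>
  (try field_simp) <;>
  (try (subst hX hX1 hX2 hZ hZ1 hZ2 hP
        simp only [deltaR, deltaR', polarFun, polarFun', weylNumRe,
          weylNumIm]
        ring))

set_option maxHeartbeats 1000000 in
set_option maxRecDepth 4000 in
theorem frameCurv_zero_three (h : CarterValues a m q Λ r u X X1 X2 Z Z1 Z2 P) :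
    frameCurv (carterConn a r u X X1 Z Z1 P) (carterConnDeriv a r u X X1 X2 Z Z1 Z2 P) 0 3 =
      !![0, 0, 0, (-(weylNumRe a m q r u / P ^ 3) + Λ / 3) * (Z / P);
        0, 0, weylNumIm a m q r u / P ^ 3 * (X / P), 0;
        0, -(weylNumIm a m q r u / P ^ 3) * (Z / P), 0, 0;
        (-(weylNumRe a m q r u / P ^ 3) + Λ / 3) * (X / P), 0, 0, 0] := by
  obtain ⟨hP, hX, hX1, hX2, hZ, hZ1, hZ2, hP0, hX0, hZ0⟩ := h
  ext i j
  fin_cases i <;> fin_cases j <;>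
  simp only [frameCurv, carterConn, carterConnDeriv, carterConnRadial, carterConnPolar,
    Matrix.add_apply, Matrix.sub_apply, Matrix.smul_apply, Matrix.mul_apply,
    Pi.zero_apply, Fin.sum_univ_four, smul_eq_mul, Fin.zero_eta, Fin.mk_one, Fin.reduceFinMk,
    Fin.isValue, cons_val, of_apply, mul_zero, zero_mul, add_zero, zero_add,
    sub_self] <;>
  (try field_simp) <;>
  (try (subst hX hX1 hX2 hZ hZ1 hZ2 hP
        simp only [deltaR, deltaR', polarFun, polarFun', weylNumRe,
          weylNumIm]
        ring))

set_option maxHeartbeats 1000000 in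
set_option maxRecDepth 4000 in
theorem frameCurv_one_two (h : CarterValues a m q Λ r u X X1 X2 Z Z1 Z2 P) :
    frameCurv (carterConn a r u X X1 Z Z1 P) (carterConnDeriv a r u X X1 X2 Z Z1 Z2 P) 1 2 =
      !![0, 0, 0, -(weylNumIm a m q r u / P ^ 3) * (P / X);
        0, 0, (-(weylNumRe a m q r u / P ^ 3) + Λ / 3) * (P / Z), 0;
        0, -(-(weylNumRe a m q r u / P ^ 3) + Λ / 3) * (P / X), 0, 0;
        -(weylNumIm a m q r u / P ^ 3) * (P / Z), 0, 0, 0] := by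
  obtain ⟨hP, hX, hX1, hX2, hZ, hZ1, hZ2, hP0, hX0, hZ0⟩ := h
  ext i j
  fin_cases i <;> fin_cases j <;>
  simp only [frameCurv, carterConn, carterConnDeriv, carterConnRadial, carterConnPolar,
    Matrix.add_apply, Matrix.sub_apply, Matrix.smul_apply, Matrix.mul_apply,
    Fin.sum_univ_four, smul_eq_mul, Fin.zero_eta, Fin.mk_one, Fin.reduceFinMk,
    Fin.isValue, cons_val, of_apply, mul_zero, zero_mul, add_zero, zero_add,
    sub_self] <;>
  (try field_simp) <;>
  (try (subst hX hX1 hX2 hZ hZ1 hZ2 hP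
        simp only [deltaR, deltaR', polarFun, polarFun', weylNumRe,
          weylNumIm]
        ring))

set_option maxHeartbeats 1000000 in
set_option maxRecDepth 4000 in
theorem frameCurv_one_three (h : CarterValues a m q Λ r u X X1 X2 Z Z1 Z2 P) :
    frameCurv (carterConn a r u X X1 Z Z1 P) (carterConnDeriv a r u X X1 X2 Z Z1 Z2 P) 1 3 =
      !![0, 0, weylNumIm a m q r u / P ^ 3 * (P / X), 0;
        0, 0, 0, (-(weylNumRe a m q r u / P ^ 3) + Λ / 3) * (Z / P);
        weylNumIm a m q r u / P ^ 3 * (Z / P), 0, 0, 0;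
        0, -(-(weylNumRe a m q r u / P ^ 3) + Λ / 3) * (P / X), 0, 0] := by
  obtain ⟨hP, hX, hX1, hX2, hZ, hZ1, hZ2, hP0, hX0, hZ0⟩ := h
  ext i j
  fin_cases i <;> fin_cases j <;>
  simp only [frameCurv, carterConn, carterConnDeriv, carterConnRadial, carterConnPolar,
    Matrix.add_apply, Matrix.sub_apply, Matrix.smul_apply, Matrix.mul_apply,
    Pi.zero_apply, Fin.sum_univ_four, smul_eq_mul, Fin.zero_eta, Fin.mk_one, Fin.reduceFinMk,
    Fin.isValue, cons_val, of_apply, mul_zero, zero_mul, add_zero, zero_add, sub_zero,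
    sub_self] <;>
  (try field_simp) <;>
  (try (subst hX hX1 hX2 hZ hZ1 hZ2 hP
        simp only [deltaR, deltaR', polarFun, polarFun', weylNumRe,
          weylNumIm]
        ring))

set_option maxHeartbeats 1000000 in
set_option maxRecDepth 4000 in
theorem frameCurv_two_three (h : CarterValues a m q Λ r u X X1 X2 Z Z1 Z2 P) :
    frameCurv (carterConn a r u X X1 Z Z1 P) (carterConnDeriv a r u X X1 X2 Z Z1 Z2 P) 2 3 =
      !![0, 2 * weylNumIm a m q r u / P ^ 3 * (P / X), 0, 0;
        2 * weylNumIm a m q r u / P ^ 3 * (X / P), 0, 0, 0;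
        0, 0, 0, (2 * weylNumRe a m q r u / P ^ 3 + Λ / 3 + q ^ 2 / P ^ 2) * (Z / P);
        0, 0, -(2 * weylNumRe a m q r u / P ^ 3 + Λ / 3 + q ^ 2 / P ^ 2) * (P / Z), 0] := by
  obtain ⟨hP, hX, hX1, hX2, hZ, hZ1, hZ2, hP0, hX0, hZ0⟩ := h
  ext i j
  fin_cases i <;> fin_cases j <;>
  simp only [frameCurv, carterConn, carterConnDeriv, carterConnRadial, carterConnPolar,
    Matrix.add_apply, Matrix.sub_apply, Matrix.smul_apply, Matrix.mul_apply,
    Pi.zero_apply, Fin.sum_univ_four, smul_eq_mul, Fin.zero_eta, Fin.mk_one, Fin.reduceFinMk,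
    Fin.isValue, cons_val, of_apply, mul_zero, zero_mul, add_zero, zero_add, sub_zero,
    sub_self] <;>
  (try field_simp) <;>
  (try (subst hX hX1 hX2 hZ hZ1 hZ2 hP
        simp only [deltaR, deltaR', polarFun, polarFun', polarFun'', weylNumRe,
          weylNumIm]
        ring))

end CarterValues

/-! ### The Carter frame of the Kerr-Newman-de Sitter metric -/

/-- The Carter coframe `(dt - a sin² θ dφ) / Ξ`, `dr`, `d cos θ`, `(a dt - (r² + a²) dφ) / Ξ`. -/
def carterFrame (a Λ : ℝ) (y : Point) : Tensor2 :=
  !![1 / xi a Λ, 0, 0, -(a * (1 - Real.cos (y 2) ^ 2)) / xi a Λ;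
    0, 1, 0, 0;
    0, 0, -Real.sin (y 2), 0;
    a / xi a Λ, 0, 0, -(y 1 ^ 2 + a ^ 2) / xi a Λ]

/-- The frame dual to `carterFrame`. -/
def carterFrameInv (a Λ : ℝ) (y : Point) : Tensor2 :=
  !![xi a Λ * (y 1 ^ 2 + a ^ 2) / rhoSq a (y 1) (y 2), 0, 0,
      -(xi a Λ * a * (1 - Real.cos (y 2) ^ 2)) / rhoSq a (y 1) (y 2);
    0, 1, 0, 0;
    0, 0, -1 / Real.sin (y 2), 0;
    xi a Λ * a / rhoSq a (y 1) (y 2), 0, 0, -xi a Λ / rhoSq a (y 1) (y 2)]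

/-- The partial derivatives of `carterFrame`. -/
def carterFrameDeriv (a Λ : ℝ) (μ : Fin 4) (y : Point) : Tensor2 :=
  (![0, !![0, 0, 0, 0; 0, 0, 0, 0; 0, 0, 0, 0; 0, 0, 0, -(2 * y 1) / xi a Λ],
    !![0, 0, 0, -(2 * a * Real.cos (y 2) * Real.sin (y 2)) / xi a Λ; 0, 0, 0, 0;
      0, 0, -Real.cos (y 2), 0; 0, 0, 0, 0], 0] : Fin 4 → Tensor2) μ

/-- The second partial derivatives of `carterFrame`. -/
def carterFrameDeriv₂ (a Λ : ℝ) (y : Point) (μ ν : Fin 4) : Tensor2 :=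
  (![0, ![0, !![0, 0, 0, 0; 0, 0, 0, 0; 0, 0, 0, 0; 0, 0, 0, -2 / xi a Λ], 0, 0],
    ![0, 0, !![0, 0, 0, 2 * a * (Real.sin (y 2) ^ 2 - Real.cos (y 2) ^ 2) / xi a Λ; 0, 0, 0, 0;
      0, 0, Real.sin (y 2), 0; 0, 0, 0, 0], 0], 0] : Fin 4 → Fin 4 → Tensor2) μ ν

/-- The diagonal components of the metric in the Carter frame, from the radial and the polar
function. -/
def carterDiag (X Z P : ℝ) : Fin 4 → ℝ := ![-X / P, P / X, P / Z, Z / P]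

/-- The connection coefficients of the Carter frame as functions of the coordinates. -/
def kerrConn (a m q Λ : ℝ) (c : Fin 4) (y : Point) : Tensor2 :=
  carterConn a (y 1) (Real.cos (y 2)) (deltaR a m q Λ (y 1)) (deltaR' a m Λ (y 1))
    (polarFun a Λ (Real.cos (y 2))) (polarFun' a Λ (Real.cos (y 2))) (rhoSq a (y 1) (y 2)) c

/-- The derivatives of the connection coefficients along the frame. -/
def kerrConnDeriv (a m q Λ : ℝ) (y : Point) : Fin 4 → Fin 4 → Tensor2 :=
  carterConnDeriv a (y 1) (Real.cos (y 2)) (deltaR a m q Λ (y 1)) (deltaR' a m Λ (y 1))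
    (deltaR'' a Λ (y 1)) (polarFun a Λ (Real.cos (y 2))) (polarFun' a Λ (Real.cos (y 2)))
    (polarFun'' a Λ (Real.cos (y 2))) (rhoSq a (y 1) (y 2))

/-- The metric components in the Carter frame as functions of the coordinates. -/
def kerrDiag (a m q Λ : ℝ) (y : Point) : Fin 4 → ℝ :=
  carterDiag (deltaR a m q Λ (y 1)) (polarFun a Λ (Real.cos (y 2))) (rhoSq a (y 1) (y 2))

/-- The points at which the coordinates and the Carter frame are regular. -/
def regularSet (a m q Λ : ℝ) : Set Point :=
  {y | rhoSq a (y 1) (y 2) ≠ 0 ∧ deltaR a m q Λ (y 1) ≠ 0 ∧ deltaTheta a Λ (y 2) ≠ 0 ∧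
    Real.sin (y 2) ≠ 0}

theorem isOpen_regularSet (a m q Λ : ℝ) : IsOpen (regularSet a m q Λ) := by
  have h1 : Continuous fun y : Point => rhoSq a (y 1) (y 2) := by unfold rhoSq; fun_prop
  have h2 : Continuous fun y : Point => deltaR a m q Λ (y 1) := by unfold deltaR; fun_prop
  have h3 : Continuous fun y : Point => deltaTheta a Λ (y 2) := by unfold deltaTheta; fun_prop
  have h4 : Continuous fun y : Point => Real.sin (y 2) := by fun_prop
  exact (isOpen_ne_fun h1 continuous_const).inter ((isOpen_ne_fun h2 continuous_const).inter
    ((isOpen_ne_fun h3 continuous_const).inter (isOpen_ne_fun h4 continuous_const)))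

theorem eventually_update_mem {U : Set Point} (hU : IsOpen U) {y : Point} (hy : y ∈ U)
    (μ : Fin 4) : ∀ᶠ s in nhds (y μ), Function.update y μ s ∈ U := by
  have hc : Continuous fun s => Function.update y μ s := continuous_const.update μ continuous_id
  have := hc.tendsto (y μ)
  rw [Function.update_eq_self] at this
  exact this (hU.mem_nhds hy)

section

variable {a m q Λ : ℝ} {y : Point}

theorem polarFun_cos (a Λ θ : ℝ) :
    polarFun a Λ (Real.cos θ) = deltaTheta a Λ θ * Real.sin θ ^ 2 := by
  rw [polarFun, deltaTheta, Real.sin_sq]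

theorem polarFun_cos_ne (hy : y ∈ regularSet a m q Λ) : polarFun a Λ (Real.cos (y 2)) ≠ 0 := by
  rw [polarFun_cos]
  exact mul_ne_zero hy.2.2.1 (pow_ne_zero _ hy.2.2.2)

theorem carterValues (hy : y ∈ regularSet a m q Λ) :
    CarterValues a m q Λ (y 1) (Real.cos (y 2)) (deltaR a m q Λ (y 1)) (deltaR' a m Λ (y 1))
    (deltaR'' a Λ (y 1)) (polarFun a Λ (Real.cos (y 2))) (polarFun' a Λ (Real.cos (y 2)))
    (polarFun'' a Λ (Real.cos (y 2))) (rhoSq a (y 1) (y 2)) :=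
  ⟨rfl, rfl, rfl, rfl, rfl, rfl, rfl, hy.1, hy.2.1, polarFun_cos_ne hy⟩

theorem kerrDiag_ne (hy : y ∈ regularSet a m q Λ) (i : Fin 4) : kerrDiag a m q Λ y i ≠ 0 := by
  have h1 := hy.1
  have h2 := hy.2.1
  have h3 := polarFun_cos_ne hy
  fin_cases i <;> simp [kerrDiag, carterDiag, h1, h2, h3]

theorem carterFrame_mul_inv (hΞ : xi a Λ ≠ 0) (hy : y ∈ regularSet a m q Λ) :
    carterFrame a Λ y * carterFrameInv a Λ y = 1 := by
  have h1 := hy.1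
  have h2 := hy.2.2.2
  ext i j
  fin_cases i <;> fin_cases j <;>
  simp [carterFrame, carterFrameInv, Matrix.mul_apply, Fin.sum_univ_four] <;>
  field_simp <;> simp only [rhoSq] <;> ring

theorem kerrNewmanDeSitter_eq (hy : y ∈ regularSet a m q Λ) :
    kerrNewmanDeSitter a m q Λ y =
      (carterFrame a Λ y)ᵀ * diagonal (kerrDiag a m q Λ y) * carterFrame a Λ y := by
  have h1 := hy.1
  have h2 := hy.2.1
  have h3 := hy.2.2.1
  have h4 := hy.2.2.2
  ext i j
  fin_cases i <;> fin_cases j <;>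
  simp [kerrNewmanDeSitter, carterFrame, kerrDiag, carterDiag, Matrix.mul_apply,
    Fin.sum_univ_four, diagonal, polarFun_cos, ← Real.sin_sq] <;>
  field_simp

/-- Stationarity and axial symmetry: nothing depends on t or φ, so only the derivatives in r and θ
need to be supplied. -/
theorem hasPDeriv_of_radial_polar {M M₁ M₂ : Point → Tensor2}
    (f : ℝ → ℝ → Tensor2) (hf : ∀ y, M y = f (y 1) (y 2))
    (h1 : ∀ i j, HasDerivAt (fun s => f s (y 2) i j) (M₁ y i j) (y 1))
    (h2 : ∀ i j, HasDerivAt (fun s => f (y 1) s i j) (M₂ y i j) (y 2)) (μ : Fin 4) :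
    HasPDeriv M ((![0, M₁ y, M₂ y, 0] : Fin 4 → Tensor2) μ) μ y := by
  intro i j
  simp only [hf]
  match μ with
  | 0 =>
    have e1 : ∀ s, Function.update y 0 s 1 = y 1 := fun s => Function.update_of_ne (by decide) _ _
    have e2 : ∀ s, Function.update y 0 s 2 = y 2 := fun s => Function.update_of_ne (by decide) _ _
    simp only [e1, e2]
    exact hasDerivAt_const _ _
  | 1 =>
    have e2 : ∀ s, Function.update y 1 s 2 = y 2 := fun s => Function.update_of_ne (by decide) _ _
    simp only [e2, Function.update_self]
    exact h1 i j
  | 2 =>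
    have e1 : ∀ s, Function.update y 2 s 1 = y 1 := fun s => Function.update_of_ne (by decide) _ _
    simp only [e1, Function.update_self]
    exact h2 i j
  | 3 =>
    have e1 : ∀ s, Function.update y 3 s 1 = y 1 := fun s => Function.update_of_ne (by decide) _ _
    have e2 : ∀ s, Function.update y 3 s 2 = y 2 := fun s => Function.update_of_ne (by decide) _ _
    simp only [e1, e2]
    exact hasDerivAt_const _ _

end

/-! ### Derivatives of the frame data, metric compatibility and vanishing torsion. -/

section

variable {a m q Λ : ℝ} {y : Point}

theorem hasDerivAt_deltaR (a m q Λ r : ℝ) :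
    HasDerivAt (fun r => deltaR a m q Λ r) (deltaR' a m Λ r) r := by
  have h : (fun r => deltaR a m q Λ r) = fun r =>
      -(Λ / 3) * r ^ 4 + (1 - Λ * a ^ 2 / 3) * r ^ 2 + -(2 * m) * r + (a ^ 2 + q ^ 2) := by
    funext r
    unfold deltaR
    ring
  rw [h]
  apply HasDerivAt.congr_deriv
  · exact ((((hasDerivAt_id' r).fun_pow 4).const_mul _).add
      (((hasDerivAt_id' r).fun_pow 2).const_mul _)).add ((hasDerivAt_id' r).const_mul _)
      |>.add_const _
  · unfold deltaR'
    simp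
    ring

theorem hasDerivAt_deltaR' (a m Λ r : ℝ) :
    HasDerivAt (fun r => deltaR' a m Λ r) (deltaR'' a Λ r) r := by
  have h : (fun r => deltaR' a m Λ r) = fun r =>
      (2 - 2 * Λ / 3 * a ^ 2) * r + -(4 * Λ / 3) * r ^ 3 + -(2 * m) := by
    funext r
    unfold deltaR'
    ring
  rw [h]
  apply HasDerivAt.congr_deriv
  · exact (((hasDerivAt_id' r).const_mul _).add (((hasDerivAt_id' r).fun_pow 3).const_mul _)).add_const _
  · unfold deltaR''
    simp
    ring

theorem hasDerivAt_polarFun (a Λ u : ℝ) :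
    HasDerivAt (fun u => polarFun a Λ u) (polarFun' a Λ u) u := by
  have h : (fun u => polarFun a Λ u) = fun u =>
      (a ^ 2 * Λ / 3 - 1) * u ^ 2 + -(a ^ 2 * Λ / 3) * u ^ 4 + 1 := by
    funext r
    unfold polarFun
    ring
  rw [h]
  apply HasDerivAt.congr_deriv
  · exact ((((hasDerivAt_id' u).fun_pow 2).const_mul _).add
      (((hasDerivAt_id' u).fun_pow 4).const_mul _)).add_const _
  · unfold polarFun'
    simp
    ring

theorem hasDerivAt_polarFun' (a Λ u : ℝ) :
    HasDerivAt (fun u => polarFun' a Λ u) (polarFun'' a Λ u) u := by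
  have h : (fun u => polarFun' a Λ u) = fun u =>
      (2 * (a ^ 2 * Λ / 3) - 2) * u + -(4 * (a ^ 2 * Λ / 3)) * u ^ 3 := by
    funext r
    unfold polarFun'
    ring
  rw [h]
  apply HasDerivAt.congr_deriv
  · exact ((hasDerivAt_id' u).const_mul _).add (((hasDerivAt_id' u).fun_pow 3).const_mul _)
  · unfold polarFun''
    simp
    ring

theorem hasDerivAt_rhoSq_radial (a r θ : ℝ) :
    HasDerivAt (fun s => rhoSq a s θ) (2 * r) r := by
  unfold rhoSq
  simpa using ((hasDerivAt_id' r).fun_pow 2).add_const (a ^ 2 * Real.cos θ ^ 2)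

theorem hasDerivAt_rhoSq_polar (a r u : ℝ) :
    HasDerivAt (fun s => r ^ 2 + a ^ 2 * s ^ 2) (2 * a ^ 2 * u) u := by
  have := (((hasDerivAt_id' u).fun_pow 2).const_mul (a ^ 2)).const_add (r ^ 2)
  exact this.congr_deriv (by simp; ring)

theorem hasPDeriv_kerrConn (hy : y ∈ regularSet a m q Λ) (μ c : Fin 4) :
    HasPDeriv (kerrConn a m q Λ c)
      (∑ k, carterFrame a Λ y k μ • kerrConnDeriv a m q Λ y k c) μ y := by
  have h := hasPDeriv_of_radial_polar (y := y) (M := kerrConn a m q Λ c)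
    (M₁ := fun y => carterConnRadial a (y 1) (Real.cos (y 2)) (deltaR a m q Λ (y 1))
      (deltaR' a m Λ (y 1)) (deltaR'' a Λ (y 1)) (polarFun a Λ (Real.cos (y 2)))
      (polarFun' a Λ (Real.cos (y 2))) (rhoSq a (y 1) (y 2)) c)
    (M₂ := fun y => -Real.sin (y 2) • carterConnPolar a (y 1) (Real.cos (y 2))
      (deltaR a m q Λ (y 1)) (deltaR' a m Λ (y 1)) (polarFun a Λ (Real.cos (y 2)))
      (polarFun' a Λ (Real.cos (y 2))) (polarFun'' a Λ (Real.cos (y 2))) (rhoSq a (y 1) (y 2)) c)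
    (fun r θ => carterConn a r (Real.cos θ) (deltaR a m q Λ r) (deltaR' a m Λ r)
      (polarFun a Λ (Real.cos θ)) (polarFun' a Λ (Real.cos θ)) (rhoSq a r θ) c)
    (fun _ => rfl)
    (fun i j => hasDerivAt_carterConn_radial hy.2.1 hy.1 (hasDerivAt_deltaR a m q Λ _)
      (hasDerivAt_deltaR' a m Λ _) (polarFun_cos_ne hy) (hasDerivAt_rhoSq_radial a _ _) c i j)
    (fun i j => by
      -- The table is differentiated in u, so P has to be presented as a function of u; the chain
      -- rule then supplies du/dθ = -sin θ, which is also the polar component of the coframe.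
      have h1 := hasDerivAt_carterConn_polar (a := a) (r := y 1) (u := Real.cos (y 2))
        (X1 := deltaR' a m Λ (y 1)) (P := fun s => y 1 ^ 2 + a ^ 2 * s ^ 2) hy.2.1 hy.1
        (hasDerivAt_polarFun a Λ _) (hasDerivAt_polarFun' a Λ _) (polarFun_cos_ne hy)
        (hasDerivAt_rhoSq_polar a _ _) c i j
      have h2 := h1.scomp (y 2) (Real.hasDerivAt_cos (y 2))
      exact h2) μ
  refine h.congr' ?_
  fin_cases μ <;> simp [carterFrame, kerrConnDeriv, carterConnDeriv, Fin.sum_univ_four]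

theorem hasPDeriv_carterFrame (a Λ : ℝ) (y : Point) (μ : Fin 4) :
    HasPDeriv (carterFrame a Λ) (carterFrameDeriv a Λ μ y) μ y := by
  refine hasPDeriv_of_radial_polar (y := y)
    (M₁ := fun y => !![0, 0, 0, 0; 0, 0, 0, 0; 0, 0, 0, 0; 0, 0, 0, -(2 * y 1) / xi a Λ])
    (M₂ := fun y => !![0, 0, 0, -(2 * a * Real.cos (y 2) * Real.sin (y 2)) / xi a Λ; 0, 0, 0, 0;
      0, 0, -Real.cos (y 2), 0; 0, 0, 0, 0])
    (fun r θ => !![1 / xi a Λ, 0, 0, -(a * (1 - Real.cos θ ^ 2)) / xi a Λ; 0, 1, 0, 0;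
      0, 0, -Real.sin θ, 0; a / xi a Λ, 0, 0, -(r ^ 2 + a ^ 2) / xi a Λ]) (fun _ => rfl) ?_ ?_ μ
  · intro i j
    fin_cases i <;> fin_cases j <;> simp [hasDerivAt_const]
    have h := (((hasDerivAt_id' (y 1)).fun_pow 2).add_const (a ^ 2)).fun_neg.div_const (xi a Λ)
    simpa using h
  · intro i j
    fin_cases i <;> fin_cases j <;> simp [hasDerivAt_const]
    · exact (((((Real.hasDerivAt_cos (y 2)).fun_pow 2).const_sub 1).const_mul a).neg.div_const
        (xi a Λ)).congr_deriv (by simp; ring)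
    · exact (Real.hasDerivAt_sin (y 2)).neg

theorem hasPDeriv_carterFrameDeriv (a Λ : ℝ) (y : Point) (μ ν : Fin 4) :
    HasPDeriv (carterFrameDeriv a Λ ν) (carterFrameDeriv₂ a Λ y μ ν) μ y := by
  have h0 : HasPDeriv (fun _ => (0 : Tensor2)) 0 μ y := fun i j => hasDerivAt_const _ _
  match ν with
  | 0 => exact h0.congr' (by fin_cases μ <;> simp [carterFrameDeriv₂])
  | 3 => exact h0.congr' (by fin_cases μ <;> simp [carterFrameDeriv₂])
  | 1 =>
    refine (hasPDeriv_of_radial_polar (y := y)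
      (M₁ := fun y => !![0, 0, 0, 0; 0, 0, 0, 0; 0, 0, 0, 0; 0, 0, 0, -2 / xi a Λ])
      (M₂ := fun y => 0)
      (fun r θ => !![0, 0, 0, 0; 0, 0, 0, 0; 0, 0, 0, 0; 0, 0, 0, -(2 * r) / xi a Λ])
      (fun _ => rfl) ?_ ?_ μ).congr' ?_
    · intro i j
      fin_cases i <;> fin_cases j <;> simp [hasDerivAt_const]
      exact (((hasDerivAt_id' (y 1)).const_mul 2).neg.div_const (xi a Λ)).congr_deriv (by simp)
    · intro i j
      exact hasDerivAt_const _ _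
    · fin_cases μ <;> simp [carterFrameDeriv₂]
  | 2 =>
    refine (hasPDeriv_of_radial_polar (y := y) (M₁ := fun y => 0)
      (M₂ := fun y => !![0, 0, 0, 2 * a * (Real.sin (y 2) ^ 2 - Real.cos (y 2) ^ 2) / xi a Λ;
        0, 0, 0, 0; 0, 0, Real.sin (y 2), 0; 0, 0, 0, 0])
      (fun r θ => !![0, 0, 0, -(2 * a * Real.cos θ * Real.sin θ) / xi a Λ; 0, 0, 0, 0;
        0, 0, -Real.cos θ, 0; 0, 0, 0, 0])
      (fun _ => rfl) ?_ ?_ μ).congr' ?_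
    · intro i j
      exact hasDerivAt_const _ _
    · intro i j
      fin_cases i <;> fin_cases j <;> simp [hasDerivAt_const]
      · exact ((((Real.hasDerivAt_cos (y 2)).const_mul (2 * a)).mul
          (Real.hasDerivAt_sin (y 2))).neg.div_const (xi a Λ)).congr_deriv (by ring)
      · exact (Real.hasDerivAt_cos (y 2)).neg.congr_deriv (by simp)
    · fin_cases μ <;> simp [carterFrameDeriv₂]

/-- Equality of mixed partials is read off from the explicit table, so no smoothness theorem is
needed. -/
theorem carterFrameDeriv₂_symm (a Λ : ℝ) (y : Point) (μ ν : Fin 4) :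
    carterFrameDeriv₂ a Λ y μ ν = carterFrameDeriv₂ a Λ y ν μ := by
  fin_cases μ <;> fin_cases ν <;> simp [carterFrameDeriv₂]

theorem hasPDeriv_carterFrameInv (hΞ : xi a Λ ≠ 0) (hy : y ∈ regularSet a m q Λ) (μ : Fin 4) :
    HasPDeriv (carterFrameInv a Λ)
      (-(carterFrameInv a Λ y * carterFrameDeriv a Λ μ y * carterFrameInv a Λ y)) μ y := by
  have hP := hy.1
  have hs := hy.2.2.2
  have hr := hasDerivAt_rhoSq_radial a (y 1) (y 2)
  have hθ : HasDerivAt (fun s => rhoSq a (y 1) s)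
      (-(2 * a ^ 2 * Real.cos (y 2) * Real.sin (y 2))) (y 2) :=
    ((hasDerivAt_rhoSq_polar a (y 1) (Real.cos (y 2))).scomp (y 2)
      (Real.hasDerivAt_cos (y 2))).congr_deriv (by simp; ring)
  refine (hasPDeriv_of_radial_polar (y := y)
    (M₁ := fun y => -(carterFrameInv a Λ y * carterFrameDeriv a Λ 1 y * carterFrameInv a Λ y))
    (M₂ := fun y => -(carterFrameInv a Λ y * carterFrameDeriv a Λ 2 y * carterFrameInv a Λ y))
    (fun r θ => !![xi a Λ * (r ^ 2 + a ^ 2) / rhoSq a r θ, 0, 0,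
        -(xi a Λ * a * (1 - Real.cos θ ^ 2)) / rhoSq a r θ;
      0, 1, 0, 0; 0, 0, -1 / Real.sin θ, 0;
      xi a Λ * a / rhoSq a r θ, 0, 0, -xi a Λ / rhoSq a r θ])
    (fun _ => rfl) ?_ ?_ μ).congr' ?_
  · intro i j
    fin_cases i <;> fin_cases j <;>
    simp [carterFrameInv, carterFrameDeriv, hasDerivAt_const]
    · exact (((((hasDerivAt_id' (y 1)).fun_pow 2).add_const (a ^ 2)).const_mul (xi a Λ)).div hr
        hP).congr_deriv (by simp; field_simp; simp only [rhoSq]; ring)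
    · exact ((hasDerivAt_const (y 1) (-(xi a Λ * a * (1 - Real.cos (y 2) ^ 2)))).div hr
        hP).congr_deriv (by field_simp; simp)
    · exact ((hasDerivAt_const (y 1) (xi a Λ * a)).div hr hP).congr_deriv (by field_simp; simp)
    · exact ((hasDerivAt_const (y 1) (-xi a Λ)).div hr hP).congr_deriv (by field_simp; simp)
  · intro i j
    have hc := (Real.hasDerivAt_cos (y 2)).fun_pow 2
    fin_cases i <;> fin_cases j <;>
    simp [carterFrameInv, carterFrameDeriv, hasDerivAt_const]
    · exact ((hasDerivAt_const (y 2) (xi a Λ * (y 1 ^ 2 + a ^ 2))).div hθ hP).congr_deriv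
        (by field_simp; simp)
    · exact ((((hc.const_sub 1).const_mul (xi a Λ * a)).neg).div hθ hP).congr_deriv
        (by simp; field_simp; simp only [rhoSq]; ring)
    · exact ((hasDerivAt_const (y 2) (-1 : ℝ)).div (Real.hasDerivAt_sin (y 2)) hs).congr_deriv
        (by field_simp; simp)
    · exact ((hasDerivAt_const (y 2) (xi a Λ * a)).div hθ hP).congr_deriv (by field_simp; simp)
    · exact ((hasDerivAt_const (y 2) (-xi a Λ)).div hθ hP).congr_deriv (by field_simp; simp)
  · fin_cases μ <;> simp [carterFrameDeriv]

/-- The frame derivatives of `carterDiag`. -/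
def carterDiagDeriv (a r u X X1 Z Z1 P : ℝ) : Fin 4 → Fin 4 → ℝ :=
  ![0, ![-X1 / P + 2 * r * X / P ^ 2, 2 * r / X - P * X1 / X ^ 2, 2 * r / Z, -(2 * r * Z) / P ^ 2],
    ![2 * a ^ 2 * u * X / P ^ 2, 2 * a ^ 2 * u / X, 2 * a ^ 2 * u / Z - P * Z1 / Z ^ 2,
      Z1 / P - 2 * a ^ 2 * u * Z / P ^ 2], 0]

/-- Metric compatibility along each frame vector. The vanishing off-diagonal entries say that the
connection is skew with respect to the frame metric, up to the derivative of its diagonal. -/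
theorem carterConn_metric {a r u X X1 Z Z1 P : ℝ} (hX : X ≠ 0) (hZ : Z ≠ 0) (hP : P ≠ 0)
    (c : Fin 4) :
    diagonal (carterDiag X Z P) * carterConn a r u X X1 Z Z1 P c +
      (diagonal (carterDiag X Z P) * carterConn a r u X X1 Z Z1 P c)ᵀ =
    diagonal (carterDiagDeriv a r u X X1 Z Z1 P c) := by
  ext i j
  rw [Matrix.add_apply, Matrix.transpose_apply, Matrix.diagonal_mul, Matrix.diagonal_mul]
  fin_cases c <;> fin_cases i <;> fin_cases j <;>
  simp [carterDiag, carterConn, carterDiagDeriv] <;> field_simp <;> ring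

theorem hasPDeriv_kerrDiag (hy : y ∈ regularSet a m q Λ) (μ : Fin 4) :
    HasPDeriv (fun y => diagonal (kerrDiag a m q Λ y))
      (diagonal (kerrDiag a m q Λ y) *
          connForm (carterFrame a Λ y) (fun c => kerrConn a m q Λ c y) μ +
        (diagonal (kerrDiag a m q Λ y) *
          connForm (carterFrame a Λ y) (fun c => kerrConn a m q Λ c y) μ)ᵀ) μ y := by
  have hP := hy.1
  have hX := hy.2.1
  have hZ := polarFun_cos_ne hy
  -- The coordinate direction is expanded in frame directions, which reduces compatibility to
  -- `carterConn_metric` and leaves only the derivatives of four functions.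
  have e : diagonal (kerrDiag a m q Λ y) *
          connForm (carterFrame a Λ y) (fun c => kerrConn a m q Λ c y) μ +
        (diagonal (kerrDiag a m q Λ y) *
          connForm (carterFrame a Λ y) (fun c => kerrConn a m q Λ c y) μ)ᵀ
      = ∑ c, carterFrame a Λ y c μ • diagonal (carterDiagDeriv a (y 1) (Real.cos (y 2))
        (deltaR a m q Λ (y 1)) (deltaR' a m Λ (y 1)) (polarFun a Λ (Real.cos (y 2)))
        (polarFun' a Λ (Real.cos (y 2))) (rhoSq a (y 1) (y 2)) c) := by
    simp only [← carterConn_metric hX hZ hP, connForm, Finset.mul_sum, Matrix.transpose_sum,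
      smul_add, Finset.sum_add_distrib, Matrix.mul_smul, Matrix.transpose_smul]
    rfl
  rw [e]
  set D := carterDiagDeriv a (y 1) (Real.cos (y 2))
        (deltaR a m q Λ (y 1)) (deltaR' a m Λ (y 1)) (polarFun a Λ (Real.cos (y 2)))
        (polarFun' a Λ (Real.cos (y 2))) (rhoSq a (y 1) (y 2)) with hD
  have hr := hasDerivAt_rhoSq_radial a (y 1) (y 2)
  have hθ := hasDerivAt_rhoSq_polar a (y 1) (Real.cos (y 2))
  have hx := hasDerivAt_deltaR a m q Λ (y 1)
  have hz := hasDerivAt_polarFun a Λ (Real.cos (y 2))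
  refine (hasPDeriv_of_radial_polar (y := y) (M₁ := fun _ => diagonal (D 1))
    (M₂ := fun y => -Real.sin (y 2) • diagonal (D 2))
    (fun r θ => diagonal (carterDiag (deltaR a m q Λ r) (polarFun a Λ (Real.cos θ)) (rhoSq a r θ)))
    (fun _ => rfl) ?_ ?_ μ).congr' ?_
  · intro i j
    by_cases hij : i = j
    · subst hij
      simp only [diagonal_apply_eq]
      fin_cases i <;> simp [carterDiag, hD, carterDiagDeriv]
      · exact (hx.fun_neg.div hr hP).congr_deriv (by field_simp; ring)
      · exact (hr.div hx hX).congr_deriv (by field_simp)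
      · exact hr.div_const _
      · exact ((hasDerivAt_const _ _).div hr hP).congr_deriv (by field_simp; simp)
    · simpa only [diagonal_apply_ne _ hij] using hasDerivAt_const _ _
  · intro i j
    by_cases hij : i = j
    · subst hij
      simp only [diagonal_apply_eq, Matrix.smul_apply]
      have key : HasDerivAt (fun u => carterDiag (deltaR a m q Λ (y 1)) (polarFun a Λ u)
          (y 1 ^ 2 + a ^ 2 * u ^ 2) i) (D 2 i) (Real.cos (y 2)) := by
        have hP' : y 1 ^ 2 + a ^ 2 * Real.cos (y 2) ^ 2 ≠ 0 := hP
        fin_cases i <;> simp [carterDiag, hD, carterDiagDeriv]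
        · exact ((hasDerivAt_const _ _).div hθ hP').congr_deriv (by simp [rhoSq]; ring)
        · exact hθ.div_const _
        · exact (hθ.div hz hZ).congr_deriv (by simp only [rhoSq]; field_simp)
        · exact (hz.div hθ hP').congr_deriv (by simp only [rhoSq]; field_simp)
      exact key.scomp (y 2) (Real.hasDerivAt_cos (y 2))
    · simpa [diagonal_apply_ne _ hij] using hasDerivAt_const _ _
  · fin_cases μ <;> simp [carterFrame, hD, carterDiagDeriv, Fin.sum_univ_four]

set_option maxHeartbeats 1000000 in
theorem carterFrame_torsion (hΞ : xi a Λ ≠ 0) (hy : y ∈ regularSet a m q Λ) (μ ν c : Fin 4) :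
    (connForm (carterFrame a Λ y) (fun c => kerrConn a m q Λ c y) μ * carterFrame a Λ y +
      carterFrameDeriv a Λ μ y) c ν =
    (connForm (carterFrame a Λ y) (fun c => kerrConn a m q Λ c y) ν * carterFrame a Λ y +
      carterFrameDeriv a Λ ν y) c μ := by
  have hP := hy.1
  have hX := hy.2.1
  have hZ := polarFun_cos_ne hy
  have hP' : rhoSq a (y 1) (y 2) = y 1 ^ 2 + a ^ 2 * Real.cos (y 2) ^ 2 := rfl
  simp only [connForm, kerrConn]
  -- Vanishing torsion uses no special form of the radial and polar functions or of their
  -- derivatives; of the metric functions, only P needs its explicit value.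
  generalize rhoSq a (y 1) (y 2) = P at *
  generalize deltaR a m q Λ (y 1) = X at *
  generalize deltaR' a m Λ (y 1) = X1 at *
  generalize polarFun a Λ (Real.cos (y 2)) = Z at *
  generalize polarFun' a Λ (Real.cos (y 2)) = Z1 at *
  -- Exchanging the two directions reverses the equation, and for equal directions it is trivial;
  -- six pairs remain.
  wlog hμν : μ < ν generalizing μ ν
  · rcases (not_lt.1 hμν).lt_or_eq with h | h
    · exact (this ν μ h).symm
    · rw [h]
  fin_cases μ <;> fin_cases ν <;> first | (exfalso; revert hμν; decide) | skip
  all_goals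
    fin_cases c <;>
    simp only [carterFrame, carterConn, carterFrameDeriv, Matrix.add_apply, Matrix.smul_apply,
      Matrix.zero_apply, Matrix.mul_apply, Fin.sum_univ_four, smul_eq_mul, Fin.zero_eta,
      Fin.mk_one, Fin.reduceFinMk, Fin.isValue, cons_val, of_apply, mul_zero, zero_mul, add_zero,
      zero_add] <;>
    (try field_simp) <;> (try simp only [hP']) <;> (try ring)

end

/-! ### Tensors in a frame -/

/-- The coordinate components of the tensor with components `T` in the coframe `E`. -/
def pull (E : Tensor2) (T : Tensor4) : Tensor4 := fun α β γ δ =>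
  ∑ a, ∑ b, ∑ c, ∑ d, E a α * E b β * E c γ * E d δ * T a b c d

theorem pull_add (E : Tensor2) (S T : Tensor4) (α β γ δ : Fin 4) :
    pull E (S + T) α β γ δ = pull E S α β γ δ + pull E T α β γ δ := by
  simp only [pull, Pi.add_apply, mul_add, Finset.sum_add_distrib]

theorem pull_smul (E : Tensor2) (t : ℝ) (T : Tensor4) (α β γ δ : Fin 4) :
    pull E (t • T) α β γ δ = t * pull E T α β γ δ := by
  simp only [pull, Pi.smul_apply, smul_eq_mul, Finset.mul_sum]
  exact Finset.sum_congr rfl fun _ _ => Finset.sum_congr rfl fun _ _ =>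
    Finset.sum_congr rfl fun _ _ => Finset.sum_congr rfl fun _ _ => by ring

/-- The tensor `p_{αγ} q_{βδ}`. -/
def outer₁₃ (p q : Tensor2) : Tensor4 := fun α β γ δ => p α γ * q β δ

/-- The tensor `p_{αδ} q_{βγ}`. -/
def outer₁₄ (p q : Tensor2) : Tensor4 := fun α β γ δ => p α δ * q β γ

theorem conj_apply (E p : Tensor2) (α β : Fin 4) :
    (Eᵀ * p * E) α β = ∑ a, ∑ b, E a α * p a b * E b β := by
  simp only [Matrix.mul_apply, Matrix.transpose_apply, Finset.sum_mul]
  exact Finset.sum_comm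

theorem pull_outer₁₃ (E p q : Tensor2) :
    pull E (outer₁₃ p q) = outer₁₃ (Eᵀ * p * E) (Eᵀ * q * E) := by
  funext α β γ δ
  simp only [outer₁₃, conj_apply, pull, Finset.sum_mul_sum]
  exact Finset.sum_congr rfl fun a _ => Finset.sum_congr rfl fun b _ =>
    Finset.sum_congr rfl fun c _ => Finset.sum_congr rfl fun d _ => by ring

theorem pull_outer₁₄ (E p q : Tensor2) :
    pull E (outer₁₄ p q) = outer₁₄ (Eᵀ * p * E) (Eᵀ * q * E) := by
  funext α β γ δ
  simp only [outer₁₄, conj_apply, pull, Finset.sum_mul_sum]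
  refine Finset.sum_congr rfl fun a _ => Finset.sum_congr rfl fun b _ => ?_
  rw [Finset.sum_comm]
  exact Finset.sum_congr rfl fun c _ => Finset.sum_congr rfl fun d _ => by ring

section

variable {g : Metric} {x : Point} {E F : Tensor2} {d : Fin 4 → ℝ} {R : Fin 4 → Fin 4 → Tensor2}

theorem riemann_eq_pull (hg : g x = Eᵀ * diagonal d * E) (hEF : E * F = 1)
    (hR : ∀ κ l μ ν, riemannUp g x κ l μ ν
      = (F * (∑ k, ∑ l, (E k μ * E l ν) • R k l) * E) κ l) :
    riemann g x = pull E fun a b k l => d a * R k l a b := by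
  funext κ l μ ν
  have h1 : riemann g x κ l μ ν
      = (Eᵀ * (diagonal d * ∑ k, ∑ l, (E k μ * E l ν) • R k l) * E) κ l := by
    have : g x * (F * (∑ k, ∑ l, (E k μ * E l ν) • R k l) * E)
        = Eᵀ * diagonal d * (E * F) * (∑ k, ∑ l, (E k μ * E l ν) • R k l) * E := by
      rw [hg]
      noncomm_ring
    simp only [riemann, hR]
    rw [← Matrix.mul_apply, this, hEF, Matrix.mul_one]
    simp only [Matrix.mul_assoc]
  rw [h1, conj_apply]
  simp only [diagonal_mul, Matrix.sum_apply, Matrix.smul_apply, smul_eq_mul, Finset.mul_sum,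
    Finset.sum_mul, pull]
  exact Finset.sum_congr rfl fun _ _ => Finset.sum_congr rfl fun _ _ =>
    Finset.sum_congr rfl fun _ _ => Finset.sum_congr rfl fun _ _ => by ring

/-- The traced coordinate index meets one `E` and one `F`, whose product is a Kronecker delta, so
the trace may be taken in the frame. -/
theorem ricci_eq_conj (hEF : E * F = 1)
    (hR : ∀ κ l μ ν, riemannUp g x κ l μ ν
      = (F * (∑ k, ∑ l, (E k μ * E l ν) • R k l) * E) κ l) :
    ricci g x = Eᵀ * (of fun b l => ∑ k, R k l k b) * E := by
  ext μ ν
  have h1 : ∀ α, (F * (∑ k, ∑ l, (E k α * E l ν) • R k l) * E) α μ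
      = ∑ k, ∑ l, ∑ a, ∑ b, (E k α * F α a) * (E l ν * R k l a b * E b μ) := by
    intro α
    simp only [Matrix.mul_apply, Matrix.sum_apply, Matrix.smul_apply, smul_eq_mul,
      Finset.mul_sum, Finset.sum_mul]
    rw [Finset.sum_comm]
    refine Finset.sum_congr rfl fun k _ => ?_
    rw [Finset.sum_comm]
    refine Finset.sum_congr rfl fun l _ => ?_
    rw [Finset.sum_comm]
    exact Finset.sum_congr rfl fun _ _ => Finset.sum_congr rfl fun _ _ => by ring
  have h2 : ∀ k a, ∑ α, E k α * F α a = if k = a then 1 else 0 := by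
    intro k a
    rw [← Matrix.mul_apply, hEF, Matrix.one_apply]
  have h3 : ricci g x μ ν
      = ∑ k, ∑ l, ∑ a, ∑ b, (∑ α, E k α * F α a) * (E l ν * R k l a b * E b μ) := by
    simp only [ricci, hR, h1, Finset.sum_mul]
    rw [Finset.sum_comm]
    refine Finset.sum_congr rfl fun k _ => ?_
    rw [Finset.sum_comm]
    refine Finset.sum_congr rfl fun l _ => ?_
    rw [Finset.sum_comm]
    refine Finset.sum_congr rfl fun a _ => ?_
    rw [Finset.sum_comm]
  rw [h3, conj_apply]
  simp only [h2, ite_mul, one_mul, zero_mul, Finset.sum_ite_irrel, Finset.sum_const_zero,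
    Finset.sum_ite_eq, Finset.mem_univ, if_true, of_apply, Finset.mul_sum, Finset.sum_mul]
  rw [Finset.sum_comm_cycle]
  refine Finset.sum_congr rfl fun b _ => ?_
  rw [Finset.sum_comm]
  exact Finset.sum_congr rfl fun _ _ => Finset.sum_congr rfl fun _ _ => by ring

theorem inv_eq_conj (hg : g x = Eᵀ * diagonal d * E) (hEF : E * F = 1) (hd : ∀ i, d i ≠ 0) :
    (g x)⁻¹ = F * diagonal (fun i => (d i)⁻¹) * Fᵀ := by
  refine Matrix.inv_eq_left_inv ?_
  have h1 : Fᵀ * Eᵀ = 1 := by rw [← Matrix.transpose_mul, hEF, Matrix.transpose_one]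
  have h2 : diagonal (fun i => (d i)⁻¹) * diagonal d = 1 := by
    rw [diagonal_mul_diagonal]
    simp [hd]
  calc F * diagonal (fun i => (d i)⁻¹) * Fᵀ * g x
      = F * (diagonal (fun i => (d i)⁻¹) * (Fᵀ * Eᵀ) * diagonal d) * E := by rw [hg]; noncomm_ring
    _ = 1 := by rw [h1, Matrix.mul_one, h2, Matrix.mul_one, mul_eq_one_comm.1 hEF]

theorem scalarCurv_eq_trace (g : Metric) (x : Point) :
    scalarCurv g x = ((g x)⁻¹ * (ricci g x)ᵀ).trace := by
  simp [scalarCurv, Matrix.trace, Matrix.mul_apply]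

theorem scalarCurv_eq_of_diagonal {lam : Fin 4 → ℝ} (hg : g x = Eᵀ * diagonal d * E)
    (hEF : E * F = 1) (hd : ∀ i, d i ≠ 0)
    (hr : ricci g x = Eᵀ * diagonal (fun i => lam i * d i) * E) :
    scalarCurv g x = ∑ i, lam i := by
  have h1 : Fᵀ * Eᵀ = 1 := by rw [← Matrix.transpose_mul, hEF, Matrix.transpose_one]
  have h2 : (g x)⁻¹ * (ricci g x)ᵀ = F * (diagonal lam * E) := by
    rw [inv_eq_conj hg hEF hd, hr]
    have : diagonal (fun i => (d i)⁻¹) * diagonal (fun i => lam i * d i) = diagonal lam := by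
      rw [diagonal_mul_diagonal]
      congr 1
      funext i
      field_simp [hd i]
    calc F * diagonal (fun i => (d i)⁻¹) * Fᵀ * (Eᵀ * diagonal (fun i => lam i * d i) * E)ᵀ
        = F * (diagonal (fun i => (d i)⁻¹) * (Fᵀ * Eᵀ) * diagonal (fun i => lam i * d i)) * E := by
          simp only [Matrix.transpose_mul, Matrix.diagonal_transpose, Matrix.transpose_transpose]
          noncomm_ring
      _ = F * (diagonal lam * E) := by rw [h1, Matrix.mul_one, this, Matrix.mul_assoc]
  rw [scalarCurv_eq_trace, h2, Matrix.trace_mul_comm, Matrix.mul_assoc, hEF, Matrix.mul_one,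
    Matrix.trace_diagonal]

/-- The Weyl tensor, once the curvature has been decomposed in the frame. -/
theorem weyl_eq_pull {lam : Fin 4 → ℝ} {W : Tensor4} (hg : g x = Eᵀ * diagonal d * E)
    (hr : ricci g x = Eᵀ * diagonal (fun i => lam i * d i) * E)
    (hRm : riemann g x = pull E (W
      + (-(1 / 2) : ℝ) • (outer₁₄ (diagonal d) (diagonal fun i => lam i * d i)
        + outer₁₄ (diagonal fun i => lam i * d i) (diagonal d)
        + (-1 : ℝ) • outer₁₃ (diagonal d) (diagonal fun i => lam i * d i)
        + (-1 : ℝ) • outer₁₃ (diagonal fun i => lam i * d i) (diagonal d))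
      + (-(1 / 6) * scalarCurv g x) • (outer₁₃ (diagonal d) (diagonal d)
        + (-1 : ℝ) • outer₁₄ (diagonal d) (diagonal d)))) :
    weyl g x = pull E W := by
  funext κ l μ ν
  simp only [weyl, hRm, pull_add, pull_smul, pull_outer₁₃, pull_outer₁₄, ← hg, ← hr]
  simp only [outer₁₃, outer₁₄]
  ring

end

/-! ### The Levi-Civita symbol and tensors of type D -/

/-- The Vandermonde product of four indices is the sign of their arrangement times 1!·2!·3! = 12,
and it vanishes on a repetition. This polynomial form lets later component identities be settled by
`simp` and `ring`. -/
theorem leviCivitaSymbol_eq (a b c d : Fin 4) :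
    12 * leviCivitaSymbol a b c d = ((b : ℕ) - (a : ℕ) : ℤ) * ((c : ℕ) - (a : ℕ)) *
      ((d : ℕ) - (a : ℕ)) * ((c : ℕ) - (b : ℕ)) * ((d : ℕ) - (b : ℕ)) * ((d : ℕ) - (c : ℕ)) := by
  revert a b c d
  decide +kernel

theorem leviCivitaSymbol_cast (a b c d : Fin 4) :
    (leviCivitaSymbol a b c d : ℝ) = ((b : ℕ) - (a : ℕ)) * ((c : ℕ) - (a : ℕ)) *
      ((d : ℕ) - (a : ℕ)) * ((c : ℕ) - (b : ℕ)) * ((d : ℕ) - (b : ℕ)) * ((d : ℕ) - (c : ℕ)) / 12 := by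
  have := congrArg (fun n : ℤ => (n : ℝ)) (leviCivitaSymbol_eq a b c d)
  push_cast at this
  linarith

/-- The weights of the coordinate planes of a frame in a tensor of type D whose principal null
directions span the plane `01`. -/
def planeWeight : Tensor2 := !![2, 2, -1, -1; 2, 2, -1, -1; -1, -1, 2, 2; -1, -1, 2, 2]

/-- The Weyl tensor of type D with real part `w` and imaginary part `y`, in a frame in which the
metric has the diagonal components `d`. -/
def typeDWeyl (d : Fin 4 → ℝ) (w y : ℝ) : Tensor4 := fun a b c e =>
  w * planeWeight a b * (outer₁₃ (diagonal d) (diagonal d) a b c e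
    - outer₁₄ (diagonal d) (diagonal d) a b c e) - y * planeWeight a b * leviCivitaSymbol a b c e

theorem typeDWeyl_antisymm (d : Fin 4 → ℝ) (w y : ℝ) (a b c e : Fin 4) :
    typeDWeyl d w y a b e c = -typeDWeyl d w y a b c e := by
  simp only [typeDWeyl, outer₁₃, outer₁₄, leviCivitaSymbol_cast]
  ring

/-- The eigenvalues of the Ricci tensor. -/
def ricciEigen (Λ e : ℝ) : Fin 4 → ℝ := ![Λ - e, Λ - e, Λ + e, Λ + e]

/-- The Riemann tensor with type D Weyl part and Ricci eigenvalues `lam`. -/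
def typeDRiemann (d lam : Fin 4 → ℝ) (w y s : ℝ) : Tensor4 :=
  typeDWeyl d w y
      + (-(1 / 2) : ℝ) • (outer₁₄ (diagonal d) (diagonal fun i => lam i * d i)
        + outer₁₄ (diagonal fun i => lam i * d i) (diagonal d)
        + (-1 : ℝ) • outer₁₃ (diagonal d) (diagonal fun i => lam i * d i)
        + (-1 : ℝ) • outer₁₃ (diagonal fun i => lam i * d i) (diagonal d))
      + (-(1 / 6) * s) • (outer₁₃ (diagonal d) (diagonal d)
        + (-1 : ℝ) • outer₁₄ (diagonal d) (diagonal d))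

theorem typeDRiemann_antisymm (d lam : Fin 4 → ℝ) (w y s : ℝ) (a b c e : Fin 4) :
    typeDRiemann d lam w y s a b e c = -typeDRiemann d lam w y s a b c e := by
  simp only [typeDRiemann, Pi.add_apply, Pi.smul_apply, typeDWeyl_antisymm d w y a b c e,
    outer₁₃, outer₁₄, smul_eq_mul]
  ring

/-! ### The curvature of the Kerr-Newman-de Sitter metric -/

namespace CarterValues

variable {a m q Λ r u X X1 X2 Z Z1 Z2 P : ℝ}

-- Here the Riemann tensor is recognised as a type D Weyl part plus Ricci terms. The Levi-Civita
-- symbol appears without a volume factor because the four entries of `carterDiag` multiply to -1.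
set_option maxHeartbeats 2000000 in
theorem frameCurv_eq_typeDRiemann (h : CarterValues a m q Λ r u X X1 X2 Z Z1 Z2 P)
    (i j k l : Fin 4) :
    carterDiag X Z P i * frameCurv (carterConn a r u X X1 Z Z1 P)
        (carterConnDeriv a r u X X1 X2 Z Z1 Z2 P) k l i j =
      typeDRiemann (carterDiag X Z P) (ricciEigen Λ (q ^ 2 / P ^ 2))
        (weylNumRe a m q r u / P ^ 3) (weylNumIm a m q r u / P ^ 3) (4 * Λ) i j k l := by
  have hP := h.P_ne
  have hX := h.X_ne
  have hZ := h.Z_ne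
  wlog hkl : k < l generalizing k l
  · rcases (not_lt.1 hkl).lt_or_eq with h' | h'
    · rw [frameCurv_antisymm, typeDRiemann_antisymm, ← this l k h', Matrix.neg_apply, mul_neg]
    -- On the diagonal k = l both sides equal their own negatives, hence vanish.
    · have e1 := congrFun (congrFun (frameCurv_antisymm (carterConn a r u X X1 Z Z1 P)
        (carterConnDeriv a r u X X1 X2 Z Z1 Z2 P) k k) i) j
      have e2 := typeDRiemann_antisymm (carterDiag X Z P) (ricciEigen Λ (q ^ 2 / P ^ 2))
        (weylNumRe a m q r u / P ^ 3) (weylNumIm a m q r u / P ^ 3) (4 * Λ) i j k k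
      rw [Matrix.neg_apply, self_eq_neg] at e1
      rw [self_eq_neg] at e2
      rw [h', e1, e2, mul_zero]
  have key : (k = 0 ∧ l = 1) ∨ (k = 0 ∧ l = 2) ∨ (k = 0 ∧ l = 3) ∨ (k = 1 ∧ l = 2) ∨
      (k = 1 ∧ l = 3) ∨ (k = 2 ∧ l = 3) := by
    revert k l
    decide
  rcases key with ⟨rfl, rfl⟩ | ⟨rfl, rfl⟩ | ⟨rfl, rfl⟩ | ⟨rfl, rfl⟩ | ⟨rfl, rfl⟩ | ⟨rfl, rfl⟩
  · rw [h.frameCurv_zero_one]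
    fin_cases i <;> fin_cases j <;>
    simp [typeDRiemann, typeDWeyl, outer₁₃, outer₁₄, leviCivitaSymbol_cast, planeWeight,
      carterDiag, ricciEigen] <;>
    (try field_simp) <;> (try ring)
  · rw [h.frameCurv_zero_two]
    fin_cases i <;> fin_cases j <;>
    simp [typeDRiemann, typeDWeyl, outer₁₃, outer₁₄, leviCivitaSymbol_cast, planeWeight,
      carterDiag, ricciEigen] <;>
    (try field_simp) <;> (try ring)
  · rw [h.frameCurv_zero_three]
    fin_cases i <;> fin_cases j <;>
    simp [typeDRiemann, typeDWeyl, outer₁₃, outer₁₄, leviCivitaSymbol_cast, planeWeight,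
      carterDiag, ricciEigen] <;>
    (try field_simp) <;> (try ring)
  · rw [h.frameCurv_one_two]
    fin_cases i <;> fin_cases j <;>
    simp [typeDRiemann, typeDWeyl, outer₁₃, outer₁₄, leviCivitaSymbol_cast, planeWeight,
      carterDiag, ricciEigen] <;>
    (try field_simp) <;> (try ring)
  · rw [h.frameCurv_one_three]
    fin_cases i <;> fin_cases j <;>
    simp [typeDRiemann, typeDWeyl, outer₁₃, outer₁₄, leviCivitaSymbol_cast, planeWeight,
      carterDiag, ricciEigen] <;>
    (try field_simp) <;> (try ring)
  · rw [h.frameCurv_two_three]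
    fin_cases i <;> fin_cases j <;>
    simp [typeDRiemann, typeDWeyl, outer₁₃, outer₁₄, leviCivitaSymbol_cast, planeWeight,
      carterDiag, ricciEigen] <;>
    (try field_simp) <;> (try ring)

end CarterValues

section

variable {a m q Λ : ℝ} {x : Point}

theorem riemannUp_kerr (hΞ : xi a Λ ≠ 0) (hx : x ∈ regularSet a m q Λ) (κ l μ ν : Fin 4) :
    riemannUp (kerrNewmanDeSitter a m q Λ) x κ l μ ν =
      (carterFrameInv a Λ x * (∑ k, ∑ l, (carterFrame a Λ x k μ * carterFrame a Λ x l ν) •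
        frameCurv (fun c => kerrConn a m q Λ c x) (kerrConnDeriv a m q Λ x) k l) *
        carterFrame a Λ x) κ l :=
  riemannUp_eq_frameCurv (dE := fun μ y => carterFrameDeriv a Λ μ y)
    (ddE := carterFrameDeriv₂ a Λ x) (B := kerrConnDeriv a m q Λ x) (U := regularSet a m q Λ)
    (d := kerrDiag a m q Λ)
    (fun _ hy μ => eventually_update_mem (isOpen_regularSet a m q Λ) hy μ) hx
    (fun _ hy => kerrNewmanDeSitter_eq hy) (fun _ hy => carterFrame_mul_inv hΞ hy)
    (fun _ hy => kerrDiag_ne hy) (fun y _ => hasPDeriv_carterFrame a Λ y)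
    (fun _ hy => hasPDeriv_kerrDiag hy) (fun _ hy => carterFrame_torsion hΞ hy)
    (hasPDeriv_carterFrameInv hΞ hx) (hasPDeriv_carterFrameDeriv a Λ x)
    (carterFrameDeriv₂_symm a Λ x) (hasPDeriv_kerrConn hx) κ l μ ν

/-- The real part of the Weyl scalar `-Ψ₂`. -/
def kerrWeylRe (a m q : ℝ) (x : Point) : ℝ :=
  weylNumRe a m q (x 1) (Real.cos (x 2)) / rhoSq a (x 1) (x 2) ^ 3

/-- The imaginary part of the Weyl scalar `Ψ₂`. -/
def kerrWeylIm (a m q : ℝ) (x : Point) : ℝ :=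
  weylNumIm a m q (x 1) (Real.cos (x 2)) / rhoSq a (x 1) (x 2) ^ 3

/-- The eigenvalues of the Ricci tensor of the Kerr-Newman-de Sitter metric. -/
def kerrRicciEigen (a q Λ : ℝ) (x : Point) : Fin 4 → ℝ :=
  ricciEigen Λ (q ^ 2 / rhoSq a (x 1) (x 2) ^ 2)

theorem frameCurv_kerr (hx : x ∈ regularSet a m q Λ) (k l i j : Fin 4) :
    kerrDiag a m q Λ x i * frameCurv (fun c => kerrConn a m q Λ c x) (kerrConnDeriv a m q Λ x)
      k l i j = typeDRiemann (kerrDiag a m q Λ x) (kerrRicciEigen a q Λ x) (kerrWeylRe a m q x)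
        (kerrWeylIm a m q x) (4 * Λ) i j k l :=
  (carterValues hx).frameCurv_eq_typeDRiemann i j k l

/-- The Weyl part is trace-free: the weights of the three planes through a given axis are 2, -1, -1,
and the Levi-Civita part has no trace. The remaining terms reproduce the Ricci tensor because the
eigenvalues add up to 4Λ. -/
theorem typeDRiemann_trace {d : Fin 4 → ℝ} (hd : ∀ i, d i ≠ 0) (w y Λ e : ℝ) (j l : Fin 4) :
    ∑ k, (d k)⁻¹ * typeDRiemann d (ricciEigen Λ e) w y (4 * Λ) k j k l =
      diagonal (fun i => ricciEigen Λ e i * d i) j l := by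
  have h0 := hd 0
  have h1 := hd 1
  have h2 := hd 2
  have h3 := hd 3
  fin_cases j <;> fin_cases l <;>
    simp [typeDRiemann, typeDWeyl, outer₁₃, outer₁₄, leviCivitaSymbol_cast, planeWeight,
      ricciEigen, Fin.sum_univ_four] <;>
    (try field_simp) <;> (try ring)

theorem ricci_kerr (hΞ : xi a Λ ≠ 0) (hx : x ∈ regularSet a m q Λ) :
    ricci (kerrNewmanDeSitter a m q Λ) x = (carterFrame a Λ x)ᵀ *
      diagonal (fun i => kerrRicciEigen a q Λ x i * kerrDiag a m q Λ x i) *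
      carterFrame a Λ x := by
  rw [ricci_eq_conj (carterFrame_mul_inv hΞ hx) (riemannUp_kerr hΞ hx)]
  congr 2
  ext j l
  rw [kerrRicciEigen, ← typeDRiemann_trace (kerrDiag_ne hx) (kerrWeylRe a m q x)
    (kerrWeylIm a m q x), of_apply]
  refine Finset.sum_congr rfl fun k _ => ?_
  have h := frameCurv_kerr hx k l k j
  rw [kerrRicciEigen] at h
  rw [← h, inv_mul_cancel_left₀ (kerrDiag_ne hx k)]

theorem scalarCurv_kerr (hΞ : xi a Λ ≠ 0) (hx : x ∈ regularSet a m q Λ) :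
    scalarCurv (kerrNewmanDeSitter a m q Λ) x = 4 * Λ := by
  rw [scalarCurv_eq_of_diagonal (kerrNewmanDeSitter_eq hx) (carterFrame_mul_inv hΞ hx)
    (kerrDiag_ne hx) (ricci_kerr hΞ hx)]
  simp [kerrRicciEigen, ricciEigen, Fin.sum_univ_four]
  ring

/-- With the Ricci tensor and the scalar curvature identified, subtracting their contribution leaves
exactly the type D part. -/
theorem weyl_kerr (hΞ : xi a Λ ≠ 0) (hx : x ∈ regularSet a m q Λ) :
    weyl (kerrNewmanDeSitter a m q Λ) x = pull (carterFrame a Λ x)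
      (typeDWeyl (kerrDiag a m q Λ x) (kerrWeylRe a m q x) (kerrWeylIm a m q x)) := by
  refine weyl_eq_pull (kerrNewmanDeSitter_eq hx) (ricci_kerr hΞ hx) ?_
  rw [riemann_eq_pull (kerrNewmanDeSitter_eq hx) (carterFrame_mul_inv hΞ hx)
    (riemannUp_kerr hΞ hx), scalarCurv_kerr hΞ hx]
  congr 1
  funext i j k l
  exact frameCurv_kerr hx k l i j

end

/-! ### Contractions under a change of frame -/

theorem sum_comm_pairs (f : Fin 4 → Fin 4 → Fin 4 → Fin 4 → ℝ) :
    ∑ c, ∑ d, ∑ a, ∑ b, f a b c d = ∑ a, ∑ b, ∑ c, ∑ d, f a b c d := by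
  rw [Finset.sum_comm_cycle]
  refine Finset.sum_congr rfl fun a _ => ?_
  rw [Finset.sum_comm_cycle]

/-- A tensor with four indices as a matrix on pairs of indices. -/
def pairMatrix (T : Tensor4) : Matrix (Fin 4 × Fin 4) (Fin 4 × Fin 4) ℝ :=
  of fun p q => T p.1 p.2 q.1 q.2

/-- The action of `A` on pairs of indices. -/
def pairAct (A : Tensor2) : Matrix (Fin 4 × Fin 4) (Fin 4 × Fin 4) ℝ :=
  of fun p q => A p.1 q.1 * A p.2 q.2

theorem pairMatrix_injective : Function.Injective pairMatrix := by
  intro S T h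
  funext α β γ δ
  exact congrFun (congrFun h (α, β)) (γ, δ)

theorem pairAct_mul (A B : Tensor2) : pairAct (A * B) = pairAct A * pairAct B := by
  ext p q
  simp only [pairAct, of_apply, Matrix.mul_apply, Fintype.sum_prod_type, Finset.sum_mul_sum]
  exact Finset.sum_congr rfl fun _ _ => Finset.sum_congr rfl fun _ _ => by ring

theorem pairAct_transpose (A : Tensor2) : pairAct Aᵀ = (pairAct A)ᵀ := rfl

theorem pairAct_diagonal (d : Fin 4 → ℝ) :
    pairAct (diagonal d) = diagonal fun p => d p.1 * d p.2 := by
  ext p q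
  by_cases h : p = q
  · subst h
    simp [pairAct]
  · rw [diagonal_apply_ne _ h]
    by_cases h1 : p.1 = q.1
    · have h2 : p.2 ≠ q.2 := fun h2 => h (Prod.ext h1 h2)
      simp [pairAct, diagonal_apply_ne _ h2]
    · simp [pairAct, diagonal_apply_ne _ h1]

theorem pairAct_one : pairAct (1 : Tensor2) = 1 := by
  rw [← diagonal_one, pairAct_diagonal]
  simp

theorem pairMatrix_pull (E : Tensor2) (T : Tensor4) :
    pairMatrix (pull E T) = (pairAct E)ᵀ * pairMatrix T * pairAct E := by
  ext p q
  simp only [pairMatrix, pull, pairAct, of_apply, Matrix.mul_apply, Matrix.transpose_apply,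
    Fintype.sum_prod_type, Finset.sum_mul]
  symm
  rw [sum_comm_pairs]
  exact Finset.sum_congr rfl fun _ _ => Finset.sum_congr rfl fun _ _ =>
    Finset.sum_congr rfl fun _ _ => Finset.sum_congr rfl fun _ _ => by ring

theorem pairMatrix_raise₃₄ (h : Tensor2) (T : Tensor4) :
    pairMatrix (raise₃₄ h T) = pairMatrix T * (pairAct h)ᵀ := by
  ext p q
  simp only [pairMatrix, raise₃₄, raise₃, raise₄, pairAct, of_apply, Matrix.mul_apply,
    Matrix.transpose_apply, Fintype.sum_prod_type, Finset.mul_sum]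
  exact Finset.sum_congr rfl fun _ _ => Finset.sum_congr rfl fun _ _ => by ring

theorem pairMatrix_raise₁₂ (h : Tensor2) (T : Tensor4) :
    pairMatrix (raise₁₂ h T) = pairAct h * pairMatrix T := by
  ext p q
  simp only [pairMatrix, raise₁₂, raise₁, raise₂, pairAct, of_apply, Matrix.mul_apply,
    Fintype.sum_prod_type, Finset.mul_sum]
  exact Finset.sum_congr rfl fun _ _ => Finset.sum_congr rfl fun _ _ => by ring

/-- The full contraction `S_{αβγδ} T^{αβγδ}`. -/
def contract₂ (h : Tensor2) (S T : Tensor4) : ℝ :=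
  (pairMatrix S * (pairAct h * (pairMatrix T * (pairAct h)ᵀ))ᵀ).trace

/-- The full contraction `S_{αβ}^{γδ} T_{γδ}^{κλ} U_{κλ}^{αβ}`. -/
def contract₃ (h : Tensor2) (S T U : Tensor4) : ℝ :=
  (pairMatrix S * (pairAct h)ᵀ * (pairMatrix T * (pairAct h)ᵀ) *
    (pairMatrix U * (pairAct h)ᵀ)).trace

theorem sum_eq_contract₂ (h : Tensor2) (S T : Tensor4) :
    ∑ α, ∑ β, ∑ γ, ∑ δ, S α β γ δ * raise₁₂ h (raise₃₄ h T) α β γ δ = contract₂ h S T := by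
  rw [contract₂, ← pairMatrix_raise₃₄, ← pairMatrix_raise₁₂]
  simp only [Matrix.trace, Matrix.diag, Matrix.mul_apply, Matrix.transpose_apply,
    Fintype.sum_prod_type, pairMatrix, of_apply]

theorem sum_eq_contract₃ (h : Tensor2) (S T U : Tensor4) :
    ∑ α, ∑ β, ∑ μ, ∑ ν, ∑ o, ∑ ρ,
      raise₃₄ h S α β μ ν * raise₃₄ h T μ ν o ρ * raise₃₄ h U o ρ α β = contract₃ h S T U := by
  rw [contract₃, ← pairMatrix_raise₃₄, ← pairMatrix_raise₃₄, ← pairMatrix_raise₃₄]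
  simp only [Matrix.trace, Matrix.diag, Matrix.mul_apply, Fintype.sum_prod_type, pairMatrix,
    of_apply, Finset.sum_mul]
  refine Finset.sum_congr rfl fun α _ => Finset.sum_congr rfl fun β _ => ?_
  exact sum_comm_pairs _

/-! ### Contraction of a tensor of rank four with one of rank two. -/

/-- The contraction `T_{oαβρ} Y^{αβ}`. -/
def contr (T : Tensor4) (Y : Tensor2) : Tensor2 := of fun o ρ => ∑ α, ∑ β, Y α β * T o α β ρ

theorem contra_eq (h P : Tensor2) : contra h P = h * P * hᵀ := by
  ext μ ν
  simp only [contra, Matrix.mul_apply, Matrix.transpose_apply, Finset.sum_mul]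
  rw [Finset.sum_comm]
  exact Finset.sum_congr rfl fun _ _ => Finset.sum_congr rfl fun _ _ => by ring

theorem mixed_eq (h P : Tensor2) : mixed h P = P * hᵀ := by
  ext μ ν
  simp only [mixed, Matrix.mul_apply, Matrix.transpose_apply]
  exact Finset.sum_congr rfl fun _ _ => by ring

theorem contr_raise₄ (h : Tensor2) (T : Tensor4) (Y : Tensor2) :
    contr (raise₄ h T) Y = contr T Y * hᵀ := by
  ext o ρ
  simp only [contr, raise₄, Matrix.mul_apply, Matrix.transpose_apply, of_apply, Finset.mul_sum,
    Finset.sum_mul]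
  rw [Finset.sum_comm_cycle]
  symm
  exact Finset.sum_congr rfl fun _ _ => Finset.sum_congr rfl fun _ _ =>
    Finset.sum_congr rfl fun _ _ => by ring

theorem contr_raise₁ (h : Tensor2) (T : Tensor4) (Y : Tensor2) :
    contr (raise₁ h T) Y = h * contr T Y := by
  ext o ρ
  simp only [contr, raise₁, Matrix.mul_apply, of_apply, Finset.mul_sum]
  rw [Finset.sum_comm_cycle]
  exact Finset.sum_congr rfl fun _ _ => Finset.sum_congr rfl fun _ _ =>
    Finset.sum_congr rfl fun _ _ => by ring

theorem contr_raise₁₄ (h : Tensor2) (T : Tensor4) (Y : Tensor2) :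
    contr (raise₁₄ h T) Y = h * contr T Y * hᵀ := by
  rw [raise₁₄, contr_raise₁, contr_raise₄, Matrix.mul_assoc]

theorem contr_pull (E : Tensor2) (W : Tensor4) (Y : Tensor2) :
    contr (pull E W) Y = Eᵀ * contr W (E * Y * Eᵀ) * E := by
  ext o ρ
  have h1 : ∀ b c, (E * Y * Eᵀ) b c = ∑ α, ∑ β, E b α * Y α β * E c β := by
    intro b c
    have := conj_apply Eᵀ Y b c
    rw [Matrix.transpose_transpose] at this
    exact this
  rw [conj_apply]
  simp only [contr, pull, of_apply, h1, Finset.mul_sum, Finset.sum_mul]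
  conv_lhs => rw [sum_comm_pairs]
  refine Finset.sum_congr rfl fun a _ => ?_
  conv_rhs => rw [← Finset.sum_comm_cycle]
  refine Finset.sum_congr rfl fun b _ => ?_
  conv_lhs => rw [sum_comm_pairs]
  exact Finset.sum_congr rfl fun _ _ => Finset.sum_congr rfl fun _ _ =>
    Finset.sum_congr rfl fun _ _ => Finset.sum_congr rfl fun _ _ => by ring

/-! ### The Levi-Civita symbol under a change of frame, and the dual as a matrix product. -/

/-- The Levi-Civita symbol as a real tensor. -/
def epsilon : Tensor4 := fun α β γ δ => (leviCivitaSymbol α β γ δ : ℝ)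

theorem sum_mul_epsilon (V : Tensor2) :
    ∑ α, ∑ β, ∑ γ, ∑ δ, V 0 α * V 1 β * V 2 γ * V 3 δ * epsilon α β γ δ = V.det := by
  simp [epsilon, leviCivitaSymbol_cast, Matrix.det_succ_row_zero,
    Fin.sum_univ_succ, Fin.succAbove]
  ring

/-- The component at (a, b, c, d) is the determinant of the columns of `F` selected by these
indices. That matrix factors as a selection matrix, whose determinant is the symbol, times `Fᵀ`. -/
theorem pull_epsilon (F : Tensor2) : pull F epsilon = F.det • epsilon := by
  funext a b c d
  have h1 := sum_mul_epsilon (of fun i j => F j (![a, b, c, d] i))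
  have h2 : (of fun i j => F j (![a, b, c, d] i) : Tensor2)
      = (of fun i j => if ![a, b, c, d] i = j then (1 : ℝ) else 0) * Fᵀ := by
    ext i j
    simp [Matrix.mul_apply]
  have h3 : (of fun i j : Fin 4 => if ![a, b, c, d] i = j then (1 : ℝ) else 0).det
      = epsilon a b c d := by
    rw [epsilon, leviCivitaSymbol, ← eq_intCast (Int.castRingHom ℝ), RingHom.map_det]
    congr 1
    ext i j
    simp [apply_ite]
  have h4 : (of fun i j => F j (![a, b, c, d] i) : Tensor2).det = epsilon a b c d * F.det := by
    rw [h2, Matrix.det_mul, Matrix.det_transpose, h3]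
  rw [h4] at h1
  rw [Pi.smul_apply, Pi.smul_apply, Pi.smul_apply, Pi.smul_apply, smul_eq_mul, mul_comm, ← h1]
  rfl

theorem pairMatrix_weylDual (g : Metric) (x : Point) :
    pairMatrix (weylDual g x) = (1 / 2 * √|(g x).det|) •
      (pairMatrix epsilon * (pairAct (g x)⁻¹ * pairMatrix (weyl g x))) := by
  rw [← pairMatrix_raise₁₂]
  ext p q
  simp only [pairMatrix, weylDual, of_apply, Matrix.mul_apply, Fintype.sum_prod_type, leviCivita,
    Matrix.smul_apply, smul_eq_mul, Finset.mul_sum, epsilon]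
  exact Finset.sum_congr rfl fun _ _ => Finset.sum_congr rfl fun _ _ => by ring

/-! ### The algebra of bivector maps that preserve two orthogonal planes -/

/-- The matrix with the entry `s` for index pairs in the planes `01` and `23`, and `t` otherwise. -/
def planeMix (s t : ℝ) : Tensor2 := !![s, s, t, t; s, s, t, t; t, t, s, s; t, t, s, s]

/-- The bivector map that acts on self-dual bivectors by `w₁ + i y₁` in the planes `01` and `23`
and by `w₂ + i y₂` in the others, for the diagonal metric `d`. -/
def planeMap (d : Fin 4 → ℝ) (w₁ y₁ w₂ y₂ : ℝ) : Tensor4 := fun a b c e =>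
  planeMix w₁ w₂ a b * (outer₁₃ (diagonal d) (diagonal d) a b c e
    - outer₁₄ (diagonal d) (diagonal d) a b c e) - planeMix y₁ y₂ a b * epsilon a b c e

theorem typeDWeyl_eq_planeMap (d : Fin 4 → ℝ) (w y : ℝ) :
    typeDWeyl d w y = planeMap d (2 * w) (2 * y) (-w) (-y) := by
  funext a b c e
  have h : ∀ t, planeMix (2 * t) (-t) a b = t * planeWeight a b := by
    intro t
    fin_cases a <;> fin_cases b <;> simp [planeMix, planeWeight, mul_comm]
  simp only [typeDWeyl, planeMap, h, epsilon]

/-- The symbol itself is the element -i of the algebra, in all planes alike and for every `d`. This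
turns duality into a multiplication. -/
theorem epsilon_eq_planeMap (d : Fin 4 → ℝ) : epsilon = planeMap d 0 (-1) 0 (-1) := by
  funext a b c e
  have h : ∀ t, planeMix t t a b = t := by
    intro t
    fin_cases a <;> fin_cases b <;> simp [planeMix]
  simp only [planeMap, h]
  ring

theorem planeMap_antisymm_right (d : Fin 4 → ℝ) (w₁ y₁ w₂ y₂ : ℝ) (a b c e : Fin 4) :
    planeMap d w₁ y₁ w₂ y₂ a b e c = -planeMap d w₁ y₁ w₂ y₂ a b c e := by
  simp only [planeMap, outer₁₃, outer₁₄, epsilon, leviCivitaSymbol_cast]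
  ring

theorem planeMap_antisymm_left (d : Fin 4 → ℝ) (w₁ y₁ w₂ y₂ : ℝ) (a b c e : Fin 4) :
    planeMap d w₁ y₁ w₂ y₂ b a c e = -planeMap d w₁ y₁ w₂ y₂ a b c e := by
  have h : ∀ s t, planeMix s t b a = planeMix s t a b := by
    intro s t
    fin_cases a <;> fin_cases b <;> simp [planeMix]
  simp only [planeMap, outer₁₃, outer₁₄, epsilon, leviCivitaSymbol_cast, h]
  ring

theorem sum_antisymm {f g : Fin 4 → Fin 4 → ℝ} (hf : ∀ p q, f q p = -f p q)
    (hg : ∀ p q, g q p = -g p q) :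
    ∑ p, ∑ q, f p q * g p q = 2 * (f 0 1 * g 0 1 + f 0 2 * g 0 2 + f 0 3 * g 0 3
      + f 1 2 * g 1 2 + f 1 3 * g 1 3 + f 2 3 * g 2 3) := by
  have h0 : ∀ p, f p p = 0 := fun p => self_eq_neg.1 (hf p p)
  simp only [Fin.sum_univ_four, h0, hf 0 1, hf 0 2, hf 0 3, hf 1 2, hf 1 3, hf 2 3, hg 0 1,
    hg 0 2, hg 0 3, hg 1 2, hg 1 3, hg 2 3]
  ring

theorem ext_antisymm {S T : Tensor4} (hSl : ∀ a b c e, S b a c e = -S a b c e)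
    (hSr : ∀ a b c e, S a b e c = -S a b c e) (hTl : ∀ a b c e, T b a c e = -T a b c e)
    (hTr : ∀ a b c e, T a b e c = -T a b c e)
    (h : ∀ a b c e, a < b → c < e → S a b c e = T a b c e) : S = T := by
  funext a b c e
  have h1 : ∀ a b c e, a < b → S a b c e = T a b c e := by
    intro a b c e hab
    rcases lt_trichotomy c e with hc | hc | hc
    · exact h a b c e hab hc
    · subst hc
      rw [self_eq_neg.1 (hSr a b c c), self_eq_neg.1 (hTr a b c c)]
    · rw [hSr a b e c, hTr a b e c, h a b e c hab hc]
  rcases lt_trichotomy a b with hc | hc | hc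
  · exact h1 a b c e hc
  · subst hc
    rw [self_eq_neg.1 (hSl a a c e), self_eq_neg.1 (hTl a a c e)]
  · rw [hSl b a c e, hTl b a c e, h1 b a c e hc]

/-- The six coordinate planes; together with `ext_antisymm` they reduce 256 components to 36. -/
theorem pair_cases : ∀ a b : Fin 4, a < b → (a = 0 ∧ b = 1) ∨ (a = 0 ∧ b = 2) ∨
    (a = 0 ∧ b = 3) ∨ (a = 1 ∧ b = 2) ∨ (a = 1 ∧ b = 3) ∨ (a = 2 ∧ b = 3) := by decide

-- Composition is complex multiplication because the Lorentzian star squares to -1 on bivectors and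
-- sends a plane to its complement, which carries the same coefficients. The factor 2 arises since
-- the sum over (p, q) meets every plane twice.
set_option maxHeartbeats 1000000 in
theorem sum_planeMap_mul_planeMap {X Z P : ℝ} (hX : X ≠ 0) (hZ : Z ≠ 0) (hP : P ≠ 0)
    (w₁ y₁ w₂ y₂ v₁ x₁ v₂ x₂ : ℝ) :
    (fun a b c e => ∑ p, ∑ q, planeMap (carterDiag X Z P) w₁ y₁ w₂ y₂ a b p q *
      ((carterDiag X Z P p)⁻¹ * (carterDiag X Z P q)⁻¹ *
        planeMap (carterDiag X Z P) v₁ x₁ v₂ x₂ p q c e)) =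
    planeMap (carterDiag X Z P) (2 * (w₁ * v₁ - y₁ * x₁)) (2 * (w₁ * x₁ + y₁ * v₁))
      (2 * (w₂ * v₂ - y₂ * x₂)) (2 * (w₂ * x₂ + y₂ * v₂)) := by
  set d := carterDiag X Z P with hd
  refine ext_antisymm (fun a b c e => ?_) (fun a b c e => ?_) (planeMap_antisymm_left _ _ _ _ _)
    (planeMap_antisymm_right _ _ _ _ _) (fun a b c e hab hce => ?_)
  · simp only [planeMap_antisymm_left d _ _ _ _ a b, neg_mul, Finset.sum_neg_distrib]
  · simp only [planeMap_antisymm_right d _ _ _ _ _ _ c e, mul_neg, Finset.sum_neg_distrib]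
  · rw [sum_antisymm (fun p q => planeMap_antisymm_right d _ _ _ _ _ _ p q)
      (fun p q => by rw [planeMap_antisymm_left d _ _ _ _ p q]; ring)]
    rcases pair_cases a b hab with ⟨rfl, rfl⟩ | ⟨rfl, rfl⟩ | ⟨rfl, rfl⟩ | ⟨rfl, rfl⟩ |
      ⟨rfl, rfl⟩ | ⟨rfl, rfl⟩ <;>
    rcases pair_cases c e hce with ⟨rfl, rfl⟩ | ⟨rfl, rfl⟩ | ⟨rfl, rfl⟩ | ⟨rfl, rfl⟩ |
      ⟨rfl, rfl⟩ | ⟨rfl, rfl⟩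
    all_goals
      simp [planeMap, planeMix, outer₁₃, outer₁₄, epsilon, leviCivitaSymbol_cast, hd, carterDiag]
    all_goals
      try field_simp
      try ring

/-- Raising a pair of indices with the inverse of the diagonal metric `d`. -/
def pairInv (d : Fin 4 → ℝ) : Matrix (Fin 4 × Fin 4) (Fin 4 × Fin 4) ℝ :=
  pairAct (diagonal fun i => (d i)⁻¹)

theorem pairMatrix_planeMap_mul {X Z P : ℝ} (hX : X ≠ 0) (hZ : Z ≠ 0) (hP : P ≠ 0)
    (w₁ y₁ w₂ y₂ v₁ x₁ v₂ x₂ : ℝ) :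
    pairMatrix (planeMap (carterDiag X Z P) w₁ y₁ w₂ y₂) * pairInv (carterDiag X Z P) *
      pairMatrix (planeMap (carterDiag X Z P) v₁ x₁ v₂ x₂) =
    pairMatrix (planeMap (carterDiag X Z P) (2 * (w₁ * v₁ - y₁ * x₁)) (2 * (w₁ * x₁ + y₁ * v₁))
      (2 * (w₂ * v₂ - y₂ * x₂)) (2 * (w₂ * x₂ + y₂ * v₂))) := by
  rw [← sum_planeMap_mul_planeMap hX hZ hP, Matrix.mul_assoc, pairInv, pairAct_diagonal]
  ext p q
  rw [Matrix.mul_apply, Fintype.sum_prod_type]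
  simp only [diagonal_mul]
  rfl

/-- Two planes carry the first coefficient and four the second, each counted in two orders; the
imaginary parts are off-diagonal and drop out. -/
theorem trace_planeMap {d : Fin 4 → ℝ} (hd : ∀ i, d i ≠ 0) (w₁ y₁ w₂ y₂ : ℝ) :
    (pairMatrix (planeMap d w₁ y₁ w₂ y₂) * pairInv d).trace = 4 * w₁ + 8 * w₂ := by
  have h0 := hd 0
  have h1 := hd 1
  have h2 := hd 2
  have h3 := hd 3
  rw [pairInv, pairAct_diagonal]
  simp [Matrix.trace, mul_diagonal, Fintype.sum_prod_type, Fin.sum_univ_four, pairMatrix,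
    planeMap, planeMix, outer₁₃, outer₁₄, epsilon, leviCivitaSymbol_cast]
  field_simp
  ring

theorem transpose_pairMatrix_planeMap (d : Fin 4 → ℝ) (w₁ y₁ w₂ y₂ : ℝ) :
    (pairMatrix (planeMap d w₁ y₁ w₂ y₂))ᵀ = pairMatrix (planeMap d w₁ y₁ w₂ y₂) := by
  ext p q
  obtain ⟨a, b⟩ := p
  obtain ⟨c, e⟩ := q
  refine congrFun (congrFun (congrFun (congrFun (ext_antisymm
    (S := fun a b c e => planeMap d w₁ y₁ w₂ y₂ c e a b)
    (fun a b c e => planeMap_antisymm_right d _ _ _ _ c e a b)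
    (fun a b c e => planeMap_antisymm_left d _ _ _ _ c e a b)
    (planeMap_antisymm_left d _ _ _ _) (planeMap_antisymm_right d _ _ _ _)
    fun a b c e hab hce => ?_) a) b) c) e
  rcases pair_cases a b hab with ⟨rfl, rfl⟩ | ⟨rfl, rfl⟩ | ⟨rfl, rfl⟩ | ⟨rfl, rfl⟩ |
      ⟨rfl, rfl⟩ | ⟨rfl, rfl⟩ <;>
    rcases pair_cases c e hce with ⟨rfl, rfl⟩ | ⟨rfl, rfl⟩ | ⟨rfl, rfl⟩ | ⟨rfl, rfl⟩ |
      ⟨rfl, rfl⟩ | ⟨rfl, rfl⟩ <;>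
    simp [planeMap, planeMix, outer₁₃, outer₁₄, epsilon, leviCivitaSymbol_cast] <;> norm_num

/-- At an axis of the plane 01 the weights give 2p - s - s, and similarly on 23 with p and s
exchanged. The imaginary part pairs the Levi-Civita symbol with a symmetric tensor and contributes
nothing. -/
theorem contr_typeDWeyl {d : Fin 4 → ℝ} (hd : ∀ i, d i ≠ 0) (w y p s : ℝ) :
    contr (typeDWeyl d w y)
      (diagonal fun i => (![p, p, s, s] : Fin 4 → ℝ) i * (d i)⁻¹) =
    diagonal fun i => 2 * w * (p - s) * (![-1, -1, 1, 1] : Fin 4 → ℝ) i * d i := by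
  have h0 := hd 0
  have h1 := hd 1
  have h2 := hd 2
  have h3 := hd 3
  ext i j
  simp only [contr, of_apply, Matrix.diagonal_apply, ite_mul, zero_mul, Finset.sum_ite_eq,
    Finset.mem_univ, if_true]
  fin_cases i <;> fin_cases j <;>
    simp [Fin.sum_univ_four, typeDWeyl, planeWeight, outer₁₃, outer₁₄, leviCivitaSymbol_cast] <;>
    (try field_simp) <;> (try ring)

/-! ### The invariants as traces -/

section

variable (g : Metric) (x : Point)

theorem I1_eq : I1 g x = contract₂ (g x)⁻¹ (weyl g x) (weyl g x) := sum_eq_contract₂ _ _ _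

theorem K2_eq : K2 g x = contract₂ (g x)⁻¹ (weylDual g x) (weyl g x) := sum_eq_contract₂ _ _ _

theorem I3_eq : I3 g x = contract₃ (g x)⁻¹ (weyl g x) (weyl g x) (weyl g x) :=
  sum_eq_contract₃ _ _ _ _

theorem I4_eq : I4 g x = -contract₃ (g x)⁻¹ (weyl g x) (weylDual g x) (weyl g x) :=
  congrArg Neg.neg (sum_eq_contract₃ _ _ _ _)

theorem I6_eq : I6 g x =
    (ricci g x * ((g x)⁻¹ * ricci g x * ((g x)⁻¹)ᵀ)ᵀ).trace := by
  rw [← contra_eq]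
  rfl

theorem I7_eq : I7 g x = (mixed (g x)⁻¹ (ricci g x) * mixed (g x)⁻¹ (ricci g x) *
    mixed (g x)⁻¹ (ricci g x)).trace := by
  simp only [I7, Matrix.trace, Matrix.diag, Matrix.mul_apply, Finset.sum_mul]
  refine Finset.sum_congr rfl fun _ _ => Finset.sum_comm

theorem I8_eq : I8 g x = (mixed (g x)⁻¹ (ricci g x) * mixed (g x)⁻¹ (ricci g x) *
    (mixed (g x)⁻¹ (ricci g x) * mixed (g x)⁻¹ (ricci g x))).trace := by
  simp only [I8, Matrix.trace, Matrix.diag, Matrix.mul_apply, Finset.sum_mul, Finset.mul_sum,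
    mul_assoc]
  refine Finset.sum_congr rfl fun _ _ => ?_
  rw [Finset.sum_comm]
  exact Finset.sum_congr rfl fun _ _ => Finset.sum_comm

theorem mixedK_eq (P Q : Tensor2) : mixedK g x P Q =
    (contr (weyl g x) (contra (g x)⁻¹ P) * ((g x)⁻¹)ᵀ * mixed (g x)⁻¹ Q).trace := by
  rw [← contr_raise₄]
  simp only [mixedK, Matrix.trace, Matrix.diag, Matrix.mul_apply, contr, of_apply, Finset.sum_mul]
  refine Finset.sum_congr rfl fun α _ => ?_
  conv_rhs => rw [← Finset.sum_comm_cycle]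
  exact Finset.sum_congr rfl fun _ _ => Finset.sum_congr rfl fun _ _ =>
    Finset.sum_congr rfl fun _ _ => by ring

theorem mixedKDual_eq (P Q : Tensor2) : mixedKDual g x P Q =
    -(contr (weylDual g x) (contra (g x)⁻¹ P) * ((g x)⁻¹)ᵀ * mixed (g x)⁻¹ Q).trace := by
  rw [← contr_raise₄]
  simp only [mixedKDual, Matrix.trace, Matrix.diag, Matrix.mul_apply, contr, of_apply,
    Finset.sum_mul]
  refine congrArg Neg.neg (Finset.sum_congr rfl fun α _ => ?_)
  conv_rhs => rw [← Finset.sum_comm_cycle]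
  exact Finset.sum_congr rfl fun _ _ => Finset.sum_congr rfl fun _ _ =>
    Finset.sum_congr rfl fun _ _ => by ring

theorem sum_contr_mul_contr (C D : Tensor4) (Y V : Tensor2) :
    ∑ α, ∑ β, ∑ μ, ∑ ν, ∑ o, ∑ ρ, Y α β * V μ ν * (C o α β ρ * D ρ μ ν o) =
      (contr C Y * contr D V).trace := by
  have h1 : (contr C Y * contr D V).trace
      = ∑ o, ∑ ρ, ∑ α, ∑ β, ∑ μ, ∑ ν, Y α β * V μ ν * (C o α β ρ * D ρ μ ν o) := by
    simp only [Matrix.trace, Matrix.diag, Matrix.mul_apply, contr, of_apply, Finset.sum_mul,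
      Finset.mul_sum]
    refine Finset.sum_congr rfl fun _ _ => Finset.sum_congr rfl fun _ _ => ?_
    rw [sum_comm_pairs]
    exact Finset.sum_congr rfl fun _ _ => Finset.sum_congr rfl fun _ _ =>
      Finset.sum_congr rfl fun _ _ => Finset.sum_congr rfl fun _ _ => by ring
  rw [h1]
  conv_rhs => rw [sum_comm_pairs]
  refine Finset.sum_congr rfl fun _ _ => Finset.sum_congr rfl fun _ _ => ?_
  rw [sum_comm_pairs]

theorem sum_contr_mul_contr' (C D : Tensor4) (Y V : Tensor2) :
    ∑ α, ∑ β, ∑ μ, ∑ ν, ∑ o, ∑ ρ, Y α β * V μ ν * (C o α β ρ * D o μ ν ρ) =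
      (contr C Y * (contr D V)ᵀ).trace :=
  sum_contr_mul_contr C (fun ρ μ ν o => D o μ ν ρ) Y V

theorem mixedL_eq (P Q : Tensor2) : mixedL g x P Q =
    (contr (weyl g x) (contra (g x)⁻¹ P) * ((g x)⁻¹)ᵀ *
      (contr (weyl g x) (contra (g x)⁻¹ Q) * ((g x)⁻¹)ᵀ)).trace -
    (contr (weylDual g x) (contra (g x)⁻¹ P) * ((g x)⁻¹)ᵀ *
      (contr (weylDual g x) (contra (g x)⁻¹ Q) * ((g x)⁻¹)ᵀ)).trace := by
  simp only [← contr_raise₄, ← sum_contr_mul_contr, mixedL, mul_sub, Finset.sum_sub_distrib]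

theorem mixedLDual_eq (P Q : Tensor2) : mixedLDual g x P Q =
    -((contr (weylDual g x) (contra (g x)⁻¹ P) * ((g x)⁻¹)ᵀ *
      (contr (weyl g x) (contra (g x)⁻¹ Q) * ((g x)⁻¹)ᵀ)).trace +
    (contr (weyl g x) (contra (g x)⁻¹ P) * ((g x)⁻¹)ᵀ *
      (contr (weylDual g x) (contra (g x)⁻¹ Q) * ((g x)⁻¹)ᵀ)).trace) := by
  simp only [← contr_raise₄, ← sum_contr_mul_contr, mixedLDual, mul_add, Finset.sum_add_distrib]

/-- The matrix `T^{oαβρ} Y_{αβ}` with both free indices raised. -/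
def contrUp (h : Tensor2) (T : Tensor4) (Y : Tensor2) : Tensor2 := h * contr T Y * hᵀ

theorem I15_eq : I15 g x = 1 / 16 *
    ((contr (weyl g x) (contra (g x)⁻¹ (ricci g x)) *
      (contrUp (g x)⁻¹ (weyl g x) (contra (g x)⁻¹ (ricci g x)))ᵀ).trace +
    (contr (weylDual g x) (contra (g x)⁻¹ (ricci g x)) *
      (contrUp (g x)⁻¹ (weylDual g x) (contra (g x)⁻¹ (ricci g x)))ᵀ).trace) := by
  simp only [contrUp, ← contr_raise₁₄, ← sum_contr_mul_contr', I15, mul_add,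
    Finset.sum_add_distrib]

/-- The cubic contractions in I₁₆ and I₁₇ are nested: `T` absorbs one copy of `Y`, `C` absorbs the
result, and the trace pairs this with `S` contracted with the other copy. -/
theorem sum_contr₃ (C S T : Tensor4) (Y : Tensor2) :
    ∑ α, ∑ β, ∑ μ, ∑ ν, ∑ o, ∑ η, ∑ σ, ∑ ρ,
      Y α β * Y μ ν * (C o η σ ρ * S o α β ρ * T η μ ν σ) =
    (contr S Y * (contr C (contr T Y))ᵀ).trace := by
  have h1 : (contr S Y * (contr C (contr T Y))ᵀ).trace = ∑ o, ∑ ρ, ∑ α, ∑ β, ∑ η, ∑ σ, ∑ μ, ∑ ν,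
      Y α β * Y μ ν * (C o η σ ρ * S o α β ρ * T η μ ν σ) := by
    simp only [Matrix.trace, Matrix.diag, Matrix.mul_apply, Matrix.transpose_apply, contr,
      of_apply, Finset.sum_mul, Finset.mul_sum]
    refine Finset.sum_congr rfl fun _ _ => Finset.sum_congr rfl fun _ _ => ?_
    conv_rhs => rw [sum_comm_pairs]
    refine Finset.sum_congr rfl fun _ _ => Finset.sum_congr rfl fun _ _ => ?_
    conv_rhs => rw [sum_comm_pairs]
    exact Finset.sum_congr rfl fun _ _ => Finset.sum_congr rfl fun _ _ =>
      Finset.sum_congr rfl fun _ _ => Finset.sum_congr rfl fun _ _ => by ring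
  rw [h1]
  conv_rhs => rw [sum_comm_pairs]
  refine Finset.sum_congr rfl fun _ _ => Finset.sum_congr rfl fun _ _ => ?_
  conv_lhs => rw [sum_comm_pairs]
  refine Finset.sum_congr rfl fun _ _ => ?_
  conv_rhs => rw [Finset.sum_comm]
  refine Finset.sum_congr rfl fun _ _ => ?_
  conv_lhs => rw [sum_comm_pairs]
  exact Finset.sum_comm

theorem I16_eq : I16 g x = -(1 / 32) *
    ((contrUp (g x)⁻¹ (weyl g x) (contra (g x)⁻¹ (ricci g x)) * (contr (weyl g x)
      (contrUp (g x)⁻¹ (weyl g x) (contra (g x)⁻¹ (ricci g x))))ᵀ).trace +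
    (contrUp (g x)⁻¹ (weylDual g x) (contra (g x)⁻¹ (ricci g x)) * (contr (weyl g x)
      (contrUp (g x)⁻¹ (weylDual g x) (contra (g x)⁻¹ (ricci g x))))ᵀ).trace -
    (contrUp (g x)⁻¹ (weylDual g x) (contra (g x)⁻¹ (ricci g x)) * (contr (weylDual g x)
      (contrUp (g x)⁻¹ (weyl g x) (contra (g x)⁻¹ (ricci g x))))ᵀ).trace +
    (contrUp (g x)⁻¹ (weyl g x) (contra (g x)⁻¹ (ricci g x)) * (contr (weylDual g x)
      (contrUp (g x)⁻¹ (weylDual g x) (contra (g x)⁻¹ (ricci g x))))ᵀ).trace) := by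
  simp only [contrUp, ← contr_raise₁₄, ← sum_contr₃, I16, mul_add, mul_sub,
    Finset.sum_add_distrib, Finset.sum_sub_distrib]

theorem I17_eq : I17 g x = 1 / 32 *
    ((contrUp (g x)⁻¹ (weyl g x) (contra (g x)⁻¹ (ricci g x)) * (contr (weylDual g x)
      (contrUp (g x)⁻¹ (weyl g x) (contra (g x)⁻¹ (ricci g x))))ᵀ).trace +
    (contrUp (g x)⁻¹ (weylDual g x) (contra (g x)⁻¹ (ricci g x)) * (contr (weylDual g x)
      (contrUp (g x)⁻¹ (weylDual g x) (contra (g x)⁻¹ (ricci g x))))ᵀ).trace -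
    (contrUp (g x)⁻¹ (weylDual g x) (contra (g x)⁻¹ (ricci g x)) * (contr (weyl g x)
      (contrUp (g x)⁻¹ (weyl g x) (contra (g x)⁻¹ (ricci g x))))ᵀ).trace +
    (contrUp (g x)⁻¹ (weyl g x) (contra (g x)⁻¹ (ricci g x)) * (contr (weyl g x)
      (contrUp (g x)⁻¹ (weylDual g x) (contra (g x)⁻¹ (ricci g x))))ᵀ).trace) := by
  simp only [contrUp, ← contr_raise₁₄, ← sum_contr₃, I17, mul_add, mul_sub,
    Finset.sum_add_distrib, Finset.sum_sub_distrib]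

end

/-! ### The invariants at a point with a Weyl tensor of type D -/

/-- A frame `E` with dual `F` at a point, in which the metric is diagonal, the Weyl tensor is of
type D, and the planes `01` and `23` are the eigenspaces of the Ricci tensor. -/
structure IsTypeDFrame (g : Metric) (x : Point) (E F : Tensor2) (X Z P w y Λ e : ℝ) : Prop where
  X_ne : X ≠ 0
  Z_ne : Z ≠ 0
  P_ne : P ≠ 0
  metric_eq : g x = Eᵀ * diagonal (carterDiag X Z P) * E
  mul_eq_one : E * F = 1
  det_pos : 0 < E.det
  ricci_eq : ricci g x = Eᵀ * diagonal (fun i => ricciEigen Λ e i * carterDiag X Z P i) * E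
  weyl_eq : weyl g x = pull E (typeDWeyl (carterDiag X Z P) w y)

/-! ### Calculus of two-tensors that are diagonal in a frame. -/

/-- The mixed components of a tensor with the eigenvalues `f` in a frame. -/
def frameDiag (E F : Tensor2) (f : Fin 4 → ℝ) : Tensor2 := Eᵀ * diagonal f * Fᵀ

/-- The covariant components of a tensor with the eigenvalues `f` in a frame. -/
def frameLow (E : Tensor2) (d f : Fin 4 → ℝ) : Tensor2 := Eᵀ * diagonal (fun i => f i * d i) * E

/-- The contravariant components of a tensor with the eigenvalues `f` in a frame. -/
def frameUp (F : Tensor2) (d f : Fin 4 → ℝ) : Tensor2 :=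
  F * diagonal (fun i => f i * (d i)⁻¹) * Fᵀ

section

variable {E F : Tensor2} {d : Fin 4 → ℝ}

theorem frameDiag_mul (hEF : E * F = 1) (f k : Fin 4 → ℝ) :
    frameDiag E F f * frameDiag E F k = frameDiag E F fun i => f i * k i := by
  have h1 : Fᵀ * Eᵀ = 1 := by rw [← Matrix.transpose_mul, hEF, Matrix.transpose_one]
  simp only [frameDiag]
  rw [← diagonal_mul_diagonal]
  calc Eᵀ * diagonal f * Fᵀ * (Eᵀ * diagonal k * Fᵀ)
      = Eᵀ * (diagonal f * (Fᵀ * Eᵀ) * diagonal k) * Fᵀ := by noncomm_ring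
    _ = _ := by rw [h1, Matrix.mul_one]

theorem trace_frameDiag (hEF : E * F = 1) (f : Fin 4 → ℝ) :
    (frameDiag E F f).trace = ∑ i, f i := by
  have h1 : Fᵀ * Eᵀ = 1 := by rw [← Matrix.transpose_mul, hEF, Matrix.transpose_one]
  rw [frameDiag, Matrix.trace_mul_comm, ← Matrix.mul_assoc, h1, Matrix.one_mul,
    Matrix.trace_diagonal]

theorem transpose_frameLow (f : Fin 4 → ℝ) : (frameLow E d f)ᵀ = frameLow E d f := by
  simp only [frameLow, Matrix.transpose_mul, Matrix.diagonal_transpose,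
    Matrix.transpose_transpose, Matrix.mul_assoc]

theorem transpose_frameUp (f : Fin 4 → ℝ) : (frameUp F d f)ᵀ = frameUp F d f := by
  simp only [frameUp, Matrix.transpose_mul, Matrix.diagonal_transpose,
    Matrix.transpose_transpose, Matrix.mul_assoc]

theorem frameLow_mul_frameUp (hEF : E * F = 1) (hd : ∀ i, d i ≠ 0) (f k : Fin 4 → ℝ) :
    frameLow E d f * frameUp F d k = frameDiag E F fun i => f i * k i := by
  have h2 : diagonal (fun i => f i * d i) * diagonal (fun i => k i * (d i)⁻¹)
      = diagonal fun i => f i * k i := by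
    rw [diagonal_mul_diagonal]
    congr 1
    funext i
    field_simp [hd i]
  simp only [frameLow, frameUp, frameDiag]
  rw [← h2]
  calc Eᵀ * diagonal (fun i => f i * d i) * E * (F * diagonal (fun i => k i * (d i)⁻¹) * Fᵀ)
      = Eᵀ * (diagonal (fun i => f i * d i) * (E * F) * diagonal (fun i => k i * (d i)⁻¹)) * Fᵀ := by
        noncomm_ring
    _ = _ := by rw [hEF, Matrix.mul_one]

theorem frameUp_mul_frameDiag (hEF : E * F = 1) (f k : Fin 4 → ℝ) :
    frameUp F d f * frameDiag E F k = frameUp F d fun i => f i * k i := by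
  have h1 : Fᵀ * Eᵀ = 1 := by rw [← Matrix.transpose_mul, hEF, Matrix.transpose_one]
  have h2 : diagonal (fun i => f i * (d i)⁻¹) * diagonal k
      = diagonal fun i => f i * k i * (d i)⁻¹ := by
    rw [diagonal_mul_diagonal]
    congr 1
    funext i
    ring
  simp only [frameUp, frameDiag]
  rw [← h2]
  calc F * diagonal (fun i => f i * (d i)⁻¹) * Fᵀ * (Eᵀ * diagonal k * Fᵀ)
      = F * (diagonal (fun i => f i * (d i)⁻¹) * (Fᵀ * Eᵀ) * diagonal k) * Fᵀ := by noncomm_ring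
    _ = _ := by rw [h1, Matrix.mul_one]

theorem contr_pull_frameUp (hEF : E * F = 1) (hd : ∀ i, d i ≠ 0) (w y p s : ℝ) :
    contr (pull E (typeDWeyl d w y)) (frameUp F d ![p, p, s, s]) =
      frameLow E d fun i => 2 * w * (p - s) * (![-1, -1, 1, 1] : Fin 4 → ℝ) i := by
  have h1 : Fᵀ * Eᵀ = 1 := by rw [← Matrix.transpose_mul, hEF, Matrix.transpose_one]
  have h2 : E * frameUp F d ![p, p, s, s] * Eᵀ
      = diagonal fun i => (![p, p, s, s] : Fin 4 → ℝ) i * (d i)⁻¹ := by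
    rw [frameUp]
    calc E * (F * diagonal (fun i => (![p, p, s, s] : Fin 4 → ℝ) i * (d i)⁻¹) * Fᵀ) * Eᵀ
        = E * F * diagonal (fun i => (![p, p, s, s] : Fin 4 → ℝ) i * (d i)⁻¹) * (Fᵀ * Eᵀ) := by
          noncomm_ring
      _ = _ := by rw [hEF, h1, Matrix.one_mul, Matrix.mul_one]
  rw [contr_pull, h2, contr_typeDWeyl hd, frameLow]

end

namespace IsTypeDFrame

variable {g : Metric} {x : Point} {E F : Tensor2} {X Z P w y Λ e : ℝ}

theorem diag_ne (h : IsTypeDFrame g x E F X Z P w y Λ e) (i : Fin 4) :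
    carterDiag X Z P i ≠ 0 := by
  have h1 := h.X_ne
  have h2 := h.Z_ne
  have h3 := h.P_ne
  fin_cases i <;> simp [carterDiag, h1, h2, h3]

theorem inv_eq (h : IsTypeDFrame g x E F X Z P w y Λ e) :
    (g x)⁻¹ = frameUp F (carterDiag X Z P) fun _ => 1 := by
  rw [inv_eq_conj h.metric_eq h.mul_eq_one h.diag_ne, frameUp]
  simp

theorem inv_eq' (h : IsTypeDFrame g x E F X Z P w y Λ e) :
    (g x)⁻¹ = F * diagonal (fun i => (carterDiag X Z P i)⁻¹) * Fᵀ :=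
  inv_eq_conj h.metric_eq h.mul_eq_one h.diag_ne

theorem inv_transpose (h : IsTypeDFrame g x E F X Z P w y Λ e) : ((g x)⁻¹)ᵀ = (g x)⁻¹ := by
  rw [h.inv_eq, transpose_frameUp]

theorem ricci_eq_frameLow (h : IsTypeDFrame g x E F X Z P w y Λ e) :
    ricci g x = frameLow E (carterDiag X Z P) (ricciEigen Λ e) := h.ricci_eq

theorem low_mul_inv (h : IsTypeDFrame g x E F X Z P w y Λ e) (f : Fin 4 → ℝ) :
    frameLow E (carterDiag X Z P) f * (g x)⁻¹ = frameDiag E F f := by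
  rw [h.inv_eq, frameLow_mul_frameUp h.mul_eq_one h.diag_ne]
  simp

theorem inv_mul_low_mul_inv (h : IsTypeDFrame g x E F X Z P w y Λ e) (f : Fin 4 → ℝ) :
    (g x)⁻¹ * frameLow E (carterDiag X Z P) f * (g x)⁻¹ = frameUp F (carterDiag X Z P) f := by
  rw [Matrix.mul_assoc, h.low_mul_inv, h.inv_eq, frameUp_mul_frameDiag h.mul_eq_one]
  simp

theorem pairAct_inv (h : IsTypeDFrame g x E F X Z P w y Λ e) :
    pairAct (g x)⁻¹ = pairAct F * pairInv (carterDiag X Z P) * (pairAct F)ᵀ := by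
  rw [h.inv_eq', pairAct_mul, pairAct_mul, pairAct_transpose]
  rfl

theorem pairAct_inv_transpose (h : IsTypeDFrame g x E F X Z P w y Λ e) :
    (pairAct (g x)⁻¹)ᵀ = pairAct (g x)⁻¹ := by
  rw [← pairAct_transpose, h.inv_transpose]

theorem pairAct_mul_eq_one (h : IsTypeDFrame g x E F X Z P w y Λ e) :
    pairAct E * pairAct F = 1 := by
  rw [← pairAct_mul, h.mul_eq_one, pairAct_one]

theorem pairAct_transpose_mul (h : IsTypeDFrame g x E F X Z P w y Λ e) :
    (pairAct F)ᵀ * (pairAct E)ᵀ = 1 := by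
  rw [← Matrix.transpose_mul, h.pairAct_mul_eq_one, Matrix.transpose_one]

/-- The frame metric has determinant -1, so √|det g| = |det E|. Positivity of det E removes the
absolute value; this is where the orientation fixes the sign of every dual. -/
theorem sqrt_det_mul_det (h : IsTypeDFrame g x E F X Z P w y Λ e) :
    √|(g x).det| * F.det = 1 := by
  have h1 := h.X_ne
  have h2 := h.Z_ne
  have h3 := h.P_ne
  have hprod : ∏ i, carterDiag X Z P i = -1 := by
    simp [Fin.prod_univ_four, carterDiag]
    field_simp
  have hdet : (g x).det = -(E.det ^ 2) := by
    rw [h.metric_eq, Matrix.det_mul, Matrix.det_mul, Matrix.det_transpose, Matrix.det_diagonal,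
      hprod]
    ring
  rw [hdet, abs_neg, abs_of_nonneg (sq_nonneg _), Real.sqrt_sq h.det_pos.le, ← Matrix.det_mul,
    h.mul_eq_one, Matrix.det_one]

/-- Duality is multiplication by -i, and -i(w + iy) = y - iw. The factor 1/2 in the dual cancels the
2 in the composition rule. -/
theorem weylDual_eq (h : IsTypeDFrame g x E F X Z P w y Λ e) :
    weylDual g x = pull E (typeDWeyl (carterDiag X Z P) y (-w)) := by
  apply pairMatrix_injective
  -- The transformation law of the symbol, with one pair of frame factors moved across; its
  -- determinant will cancel √|det g|.
  have hε : pairMatrix epsilon * pairAct F = F.det • ((pairAct E)ᵀ * pairMatrix epsilon) := by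
    have h1 := pairMatrix_pull F epsilon
    rw [pull_epsilon] at h1
    have h2 : pairMatrix (F.det • epsilon) = F.det • pairMatrix epsilon := rfl
    have h3 : (pairAct E)ᵀ * (pairAct F)ᵀ = 1 := mul_eq_one_comm.1 h.pairAct_transpose_mul
    rw [h2] at h1
    rw [← Matrix.mul_smul, h1, ← Matrix.mul_assoc, ← Matrix.mul_assoc, h3, Matrix.one_mul]
  have hdual : pairMatrix epsilon * pairInv (carterDiag X Z P) *
      pairMatrix (typeDWeyl (carterDiag X Z P) w y) =
      (2 : ℝ) • pairMatrix (typeDWeyl (carterDiag X Z P) y (-w)) := by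
    rw [epsilon_eq_planeMap (carterDiag X Z P), typeDWeyl_eq_planeMap, typeDWeyl_eq_planeMap,
      pairMatrix_planeMap_mul h.X_ne h.Z_ne h.P_ne]
    ext p q
    simp only [pairMatrix, planeMap, of_apply, Matrix.smul_apply, smul_eq_mul]
    have hm : ∀ s t : ℝ, planeMix (2 * s) (2 * t) p.1 p.2 = 2 * planeMix s t p.1 p.2 := by
      intro s t
      generalize p.1 = i
      generalize p.2 = j
      fin_cases i <;> fin_cases j <;> simp [planeMix]
    rw [hm, hm]
    ring_nf
  rw [pairMatrix_weylDual, h.pairAct_inv, h.weyl_eq, pairMatrix_pull, pairMatrix_pull]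
  calc (1 / 2 * √|(g x).det|) • (pairMatrix epsilon * (pairAct F * pairInv (carterDiag X Z P) *
        (pairAct F)ᵀ * ((pairAct E)ᵀ * pairMatrix (typeDWeyl (carterDiag X Z P) w y) * pairAct E)))
      = (1 / 2 * √|(g x).det|) • (pairMatrix epsilon * pairAct F * pairInv (carterDiag X Z P) *
        ((pairAct F)ᵀ * (pairAct E)ᵀ) * pairMatrix (typeDWeyl (carterDiag X Z P) w y) *
        pairAct E) := by
        simp only [Matrix.mul_assoc]
    _ = (1 / 2 * (√|(g x).det| * F.det)) • ((pairAct E)ᵀ * (pairMatrix epsilon *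
        pairInv (carterDiag X Z P) * pairMatrix (typeDWeyl (carterDiag X Z P) w y)) *
        pairAct E) := by
        rw [hε, h.pairAct_transpose_mul, Matrix.mul_one]
        simp only [Matrix.smul_mul, smul_smul, Matrix.mul_assoc]
        rw [mul_assoc (1 / 2 : ℝ)]
    _ = _ := by
        rw [hdual, h.sqrt_det_mul_det, Matrix.mul_smul, Matrix.smul_mul, smul_smul]
        norm_num

/-- All frame factors cancel under the trace. The planes then contribute 2(4·4 + 8·1) = 48 times the
real part of the product of the two complex scalars. -/
theorem contract₂_eq (h : IsTypeDFrame g x E F X Z P w y Λ e) (w₁ y₁ w₂ y₂ : ℝ) :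
    contract₂ (g x)⁻¹ (pull E (typeDWeyl (carterDiag X Z P) w₁ y₁))
      (pull E (typeDWeyl (carterDiag X Z P) w₂ y₂)) = 48 * (w₁ * w₂ - y₁ * y₂) := by
  rw [contract₂, Matrix.transpose_mul, Matrix.transpose_mul, Matrix.transpose_transpose,
    h.pairAct_inv_transpose, h.pairAct_inv, pairMatrix_pull, pairMatrix_pull,
    Matrix.transpose_mul, Matrix.transpose_mul, Matrix.transpose_transpose,
    typeDWeyl_eq_planeMap, typeDWeyl_eq_planeMap, transpose_pairMatrix_planeMap]
  set A := pairMatrix (planeMap (carterDiag X Z P) (2 * w₁) (2 * y₁) (-w₁) (-y₁)) with hA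
  set B := pairMatrix (planeMap (carterDiag X Z P) (2 * w₂) (2 * y₂) (-w₂) (-y₂)) with hB
  set D := pairInv (carterDiag X Z P) with hD
  have h1 : (pairAct E)ᵀ * A * pairAct E * (pairAct F * D * (pairAct F)ᵀ *
      ((pairAct E)ᵀ * (B * pairAct E)) * (pairAct F * D * (pairAct F)ᵀ)) =
      (pairAct E)ᵀ * (A * D * B * D * (pairAct F)ᵀ) := by
    calc (pairAct E)ᵀ * A * pairAct E * (pairAct F * D * (pairAct F)ᵀ *
          ((pairAct E)ᵀ * (B * pairAct E)) * (pairAct F * D * (pairAct F)ᵀ))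
        = (pairAct E)ᵀ * (A * (pairAct E * pairAct F) * D * ((pairAct F)ᵀ * (pairAct E)ᵀ) * B *
          (pairAct E * pairAct F) * D * (pairAct F)ᵀ) := by simp only [Matrix.mul_assoc]
      _ = _ := by rw [h.pairAct_mul_eq_one, h.pairAct_transpose_mul]; simp only [Matrix.mul_one]
  rw [h1, Matrix.trace_mul_comm, Matrix.mul_assoc, h.pairAct_transpose_mul, Matrix.mul_one, hA,
    hB, hD, pairMatrix_planeMap_mul h.X_ne h.Z_ne h.P_ne, trace_planeMap h.diag_ne]
  ring

/-- Two compositions give the factor 4, and the trace gives 4·8 - 8·1 = 24: in all 96 times the real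
part of the triple product. -/
theorem contract₃_eq (h : IsTypeDFrame g x E F X Z P w y Λ e) (w₁ y₁ w₂ y₂ w₃ y₃ : ℝ) :
    contract₃ (g x)⁻¹ (pull E (typeDWeyl (carterDiag X Z P) w₁ y₁))
      (pull E (typeDWeyl (carterDiag X Z P) w₂ y₂))
      (pull E (typeDWeyl (carterDiag X Z P) w₃ y₃)) =
    96 * ((w₁ * w₂ - y₁ * y₂) * w₃ - (w₁ * y₂ + y₁ * w₂) * y₃) := by
  have h1 : ∀ T : Tensor4, pairMatrix (pull E T) * (pairAct (g x)⁻¹)ᵀ =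
      (pairAct E)ᵀ * (pairMatrix T * pairInv (carterDiag X Z P)) * (pairAct F)ᵀ := by
    intro T
    rw [h.pairAct_inv_transpose, h.pairAct_inv, pairMatrix_pull]
    calc (pairAct E)ᵀ * pairMatrix T * pairAct E *
          (pairAct F * pairInv (carterDiag X Z P) * (pairAct F)ᵀ)
        = (pairAct E)ᵀ * (pairMatrix T * (pairAct E * pairAct F) * pairInv (carterDiag X Z P)) *
          (pairAct F)ᵀ := by simp only [Matrix.mul_assoc]
      _ = _ := by rw [h.pairAct_mul_eq_one, Matrix.mul_one]
  have h2 : ∀ A B : Matrix (Fin 4 × Fin 4) (Fin 4 × Fin 4) ℝ,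
      (pairAct E)ᵀ * A * (pairAct F)ᵀ * ((pairAct E)ᵀ * B * (pairAct F)ᵀ) =
      (pairAct E)ᵀ * (A * B) * (pairAct F)ᵀ := by
    intro A B
    calc (pairAct E)ᵀ * A * (pairAct F)ᵀ * ((pairAct E)ᵀ * B * (pairAct F)ᵀ)
        = (pairAct E)ᵀ * (A * ((pairAct F)ᵀ * (pairAct E)ᵀ) * B) * (pairAct F)ᵀ := by
          simp only [Matrix.mul_assoc]
      _ = _ := by rw [h.pairAct_transpose_mul, Matrix.mul_one]
  rw [contract₃, h1, h1, h1, h2, h2, Matrix.trace_mul_comm, ← Matrix.mul_assoc,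
    h.pairAct_transpose_mul, Matrix.one_mul, ← Matrix.mul_assoc, ← Matrix.mul_assoc,
    typeDWeyl_eq_planeMap, typeDWeyl_eq_planeMap, typeDWeyl_eq_planeMap,
    pairMatrix_planeMap_mul h.X_ne h.Z_ne h.P_ne, pairMatrix_planeMap_mul h.X_ne h.Z_ne h.P_ne,
    trace_planeMap h.diag_ne]
  ring

theorem I1_eq (h : IsTypeDFrame g x E F X Z P w y Λ e) : I1 g x = 48 * (w ^ 2 - y ^ 2) := by
  rw [CurvInv.I1_eq, h.weyl_eq, h.contract₂_eq]
  ring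

theorem K2_eq (h : IsTypeDFrame g x E F X Z P w y Λ e) : K2 g x = 96 * (w * y) := by
  rw [CurvInv.K2_eq, h.weylDual_eq, h.weyl_eq, h.contract₂_eq]
  ring

theorem I3_eq (h : IsTypeDFrame g x E F X Z P w y Λ e) :
    I3 g x = 96 * (w ^ 3 - 3 * w * y ^ 2) := by
  rw [CurvInv.I3_eq, h.weyl_eq, h.contract₃_eq]
  ring

theorem I4_eq (h : IsTypeDFrame g x E F X Z P w y Λ e) :
    I4 g x = -(96 * (3 * w ^ 2 * y - y ^ 3)) := by
  rw [CurvInv.I4_eq, h.weylDual_eq, h.weyl_eq, h.contract₃_eq]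
  ring

theorem I5_eq (h : IsTypeDFrame g x E F X Z P w y Λ e) : I5 g x = 4 * Λ := by
  rw [I5, scalarCurv_eq_of_diagonal h.metric_eq h.mul_eq_one h.diag_ne h.ricci_eq]
  simp [ricciEigen, Fin.sum_univ_four]
  ring

theorem mixed_ricci (h : IsTypeDFrame g x E F X Z P w y Λ e) :
    mixed (g x)⁻¹ (ricci g x) = frameDiag E F (ricciEigen Λ e) := by
  rw [mixed_eq, h.inv_transpose, h.ricci_eq_frameLow, h.low_mul_inv]

theorem contra_low (h : IsTypeDFrame g x E F X Z P w y Λ e) (f : Fin 4 → ℝ) :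
    contra (g x)⁻¹ (frameLow E (carterDiag X Z P) f) = frameUp F (carterDiag X Z P) f := by
  rw [contra_eq, h.inv_transpose, h.inv_mul_low_mul_inv]

theorem I6_eq (h : IsTypeDFrame g x E F X Z P w y Λ e) :
    I6 g x = 4 * e ^ 2 + 4 * Λ ^ 2 := by
  rw [CurvInv.I6_eq, ← contra_eq, h.ricci_eq_frameLow, h.contra_low, transpose_frameUp,
    frameLow_mul_frameUp h.mul_eq_one h.diag_ne, trace_frameDiag h.mul_eq_one]
  simp [ricciEigen, Fin.sum_univ_four]
  ring

theorem I7_eq (h : IsTypeDFrame g x E F X Z P w y Λ e) :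
    I7 g x = 4 * Λ * (Λ ^ 2 + 3 * e ^ 2) := by
  rw [CurvInv.I7_eq, h.mixed_ricci, frameDiag_mul h.mul_eq_one, frameDiag_mul h.mul_eq_one,
    trace_frameDiag h.mul_eq_one]
  simp [ricciEigen, Fin.sum_univ_four]
  ring

theorem I8_eq (h : IsTypeDFrame g x E F X Z P w y Λ e) :
    I8 g x = 4 * (Λ ^ 4 + 6 * Λ ^ 2 * e ^ 2 + e ^ 4) := by
  rw [CurvInv.I8_eq, h.mixed_ricci, frameDiag_mul h.mul_eq_one, frameDiag_mul h.mul_eq_one,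
    trace_frameDiag h.mul_eq_one]
  simp [ricciEigen, Fin.sum_univ_four]
  ring

theorem contr_weyl_ricci (h : IsTypeDFrame g x E F X Z P w y Λ e) :
    contr (weyl g x) (contra (g x)⁻¹ (ricci g x)) =
      frameLow E (carterDiag X Z P) fun i =>
        2 * w * (Λ - e - (Λ + e)) * (![-1, -1, 1, 1] : Fin 4 → ℝ) i := by
  rw [h.ricci_eq_frameLow, h.contra_low, h.weyl_eq]
  exact contr_pull_frameUp h.mul_eq_one h.diag_ne _ _ _ _

theorem contr_weylDual_ricci (h : IsTypeDFrame g x E F X Z P w y Λ e) :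
    contr (weylDual g x) (contra (g x)⁻¹ (ricci g x)) =
      frameLow E (carterDiag X Z P) fun i =>
        2 * y * (Λ - e - (Λ + e)) * (![-1, -1, 1, 1] : Fin 4 → ℝ) i := by
  rw [h.ricci_eq_frameLow, h.contra_low, h.weylDual_eq]
  exact contr_pull_frameUp h.mul_eq_one h.diag_ne _ _ _ _

theorem I9_eq (h : IsTypeDFrame g x E F X Z P w y Λ e) : I9 g x = -(16 * w * e ^ 2) := by
  rw [I9, mixedK_eq, h.contr_weyl_ricci, h.inv_transpose, h.low_mul_inv, h.mixed_ricci,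
    frameDiag_mul h.mul_eq_one, trace_frameDiag h.mul_eq_one]
  simp [ricciEigen, Fin.sum_univ_four]
  ring

theorem I10_eq (h : IsTypeDFrame g x E F X Z P w y Λ e) : I10 g x = 16 * y * e ^ 2 := by
  rw [I10, mixedKDual_eq, h.contr_weylDual_ricci, h.inv_transpose, h.low_mul_inv, h.mixed_ricci,
    frameDiag_mul h.mul_eq_one, trace_frameDiag h.mul_eq_one]
  simp [ricciEigen, Fin.sum_univ_four]
  ring

theorem I11_eq (h : IsTypeDFrame g x E F X Z P w y Λ e) :
    I11 g x = 64 * e ^ 2 * (w ^ 2 - y ^ 2) := by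
  rw [I11, mixedL_eq, h.contr_weyl_ricci, h.contr_weylDual_ricci, h.inv_transpose, h.low_mul_inv,
    h.low_mul_inv, frameDiag_mul h.mul_eq_one, frameDiag_mul h.mul_eq_one,
    trace_frameDiag h.mul_eq_one, trace_frameDiag h.mul_eq_one]
  simp [Fin.sum_univ_four]
  ring

theorem I12_eq (h : IsTypeDFrame g x E F X Z P w y Λ e) :
    I12 g x = -(128 * e ^ 2 * (w * y)) := by
  rw [I12, mixedLDual_eq, h.contr_weyl_ricci, h.contr_weylDual_ricci, h.inv_transpose,
    h.low_mul_inv, h.low_mul_inv, frameDiag_mul h.mul_eq_one, frameDiag_mul h.mul_eq_one,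
    trace_frameDiag h.mul_eq_one, trace_frameDiag h.mul_eq_one]
  simp [Fin.sum_univ_four]
  ring

theorem contrUp_weyl (h : IsTypeDFrame g x E F X Z P w y Λ e) :
    contrUp (g x)⁻¹ (weyl g x) (contra (g x)⁻¹ (ricci g x)) =
      frameUp F (carterDiag X Z P) ![4 * w * e, 4 * w * e, -(4 * w * e), -(4 * w * e)] := by
  rw [contrUp, h.contr_weyl_ricci, h.inv_transpose, h.inv_mul_low_mul_inv]
  congr 1
  funext i
  fin_cases i <;> simp <;> ring

theorem contrUp_weylDual (h : IsTypeDFrame g x E F X Z P w y Λ e) :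
    contrUp (g x)⁻¹ (weylDual g x) (contra (g x)⁻¹ (ricci g x)) =
      frameUp F (carterDiag X Z P) ![4 * y * e, 4 * y * e, -(4 * y * e), -(4 * y * e)] := by
  rw [contrUp, h.contr_weylDual_ricci, h.inv_transpose, h.inv_mul_low_mul_inv]
  congr 1
  funext i
  fin_cases i <;> simp <;> ring

theorem I15_eq (h : IsTypeDFrame g x E F X Z P w y Λ e) :
    I15 g x = 4 * e ^ 2 * (w ^ 2 + y ^ 2) := by
  rw [CurvInv.I15_eq, h.contrUp_weyl, h.contrUp_weylDual, h.contr_weyl_ricci,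
    h.contr_weylDual_ricci, transpose_frameUp, transpose_frameUp,
    frameLow_mul_frameUp h.mul_eq_one h.diag_ne, frameLow_mul_frameUp h.mul_eq_one h.diag_ne,
    trace_frameDiag h.mul_eq_one, trace_frameDiag h.mul_eq_one]
  simp [Fin.sum_univ_four]
  ring

/-- Evaluates each of the eight cubic terms in I₁₆ and I₁₇. In both invariants the third and fourth
terms cancel, and the first two combine to w² + y². -/
theorem trace_frameUp_mul_contr (h : IsTypeDFrame g x E F X Z P w y Λ e) (v u p s : ℝ) :
    (frameUp F (carterDiag X Z P) ![p, p, -p, -p] *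
      (contr (pull E (typeDWeyl (carterDiag X Z P) v u))
        (frameUp F (carterDiag X Z P) ![s, s, -s, -s]))ᵀ).trace = -(16 * v * p * s) := by
  rw [contr_pull_frameUp h.mul_eq_one h.diag_ne, transpose_frameLow, Matrix.trace_mul_comm,
    frameLow_mul_frameUp h.mul_eq_one h.diag_ne, trace_frameDiag h.mul_eq_one]
  simp [Fin.sum_univ_four]
  ring

theorem I16_eq (h : IsTypeDFrame g x E F X Z P w y Λ e) :
    I16 g x = 8 * e ^ 2 * w * (w ^ 2 + y ^ 2) := by
  rw [CurvInv.I16_eq, h.contrUp_weyl, h.contrUp_weylDual, h.weylDual_eq, h.weyl_eq]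
  simp only [h.trace_frameUp_mul_contr]
  ring

theorem I17_eq (h : IsTypeDFrame g x E F X Z P w y Λ e) :
    I17 g x = -(8 * e ^ 2 * y * (w ^ 2 + y ^ 2)) := by
  rw [CurvInv.I17_eq, h.contrUp_weyl, h.contrUp_weylDual, h.weylDual_eq, h.weyl_eq]
  simp only [h.trace_frameUp_mul_contr]
  ring

theorem tracefreeRicci_eq (h : IsTypeDFrame g x E F X Z P w y Λ e) :
    tracefreeRicci g x = frameLow E (carterDiag X Z P) ![-e, -e, e, e] := by
  have h1 : tracefreeRicci g x = ricci g x - Λ • g x := by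
    have h5 := h.I5_eq
    rw [I5] at h5
    ext i j
    simp only [tracefreeRicci, h5, Matrix.sub_apply, Matrix.smul_apply, smul_eq_mul]
    ring
  rw [h1, h.ricci_eq, h.metric_eq, frameLow]
  have h2 : diagonal (fun i => (![-e, -e, e, e] : Fin 4 → ℝ) i * carterDiag X Z P i) =
      diagonal (fun i => ricciEigen Λ e i * carterDiag X Z P i) -
        Λ • diagonal (carterDiag X Z P) := by
    ext i j
    by_cases hij : i = j
    · subst hij
      simp only [Matrix.sub_apply, Matrix.smul_apply, diagonal_apply_eq, smul_eq_mul]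
      fin_cases i <;> simp [ricciEigen] <;> ring
    · simp [hij]
  rw [h2, Matrix.mul_sub, Matrix.sub_mul, Matrix.mul_smul, Matrix.smul_mul]

/-- The eigenvalues -e, -e, e, e of the trace-free part have equal squares, so the square is a
multiple of the metric, as for any non-null electromagnetic field. -/
theorem tracefreeRicciSq_eq (h : IsTypeDFrame g x E F X Z P w y Λ e) :
    tracefreeRicciSq g x =
      frameLow E (carterDiag X Z P) ![e ^ 2, e ^ 2, e ^ 2, e ^ 2] := by
  have h1 : tracefreeRicciSq g x = mixed (g x)⁻¹ (tracefreeRicci g x) * tracefreeRicci g x := rfl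
  have h2 : Fᵀ * Eᵀ = 1 := by rw [← Matrix.transpose_mul, h.mul_eq_one, Matrix.transpose_one]
  rw [h1, mixed_eq, h.inv_transpose, h.tracefreeRicci_eq, h.low_mul_inv, frameDiag, frameLow,
    frameLow]
  have h3 : diagonal (fun i => (![e ^ 2, e ^ 2, e ^ 2, e ^ 2] : Fin 4 → ℝ) i *
      carterDiag X Z P i) = diagonal ![-e, -e, e, e] *
        diagonal (fun i => (![-e, -e, e, e] : Fin 4 → ℝ) i * carterDiag X Z P i) := by
    rw [diagonal_mul_diagonal]
    congr 1
    funext i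
    fin_cases i <;> simp <;> ring
  rw [h3]
  set D := diagonal (fun i => (![-e, -e, e, e] : Fin 4 → ℝ) i * carterDiag X Z P i)
  calc Eᵀ * diagonal ![-e, -e, e, e] * Fᵀ * (Eᵀ * D * E)
      = Eᵀ * diagonal ![-e, -e, e, e] * (Fᵀ * Eᵀ) * D * E := by simp only [Matrix.mul_assoc]
    _ = _ := by rw [h2, Matrix.mul_one, ← Matrix.mul_assoc]

/-- Case p = s of the contraction rule: contracting with a multiple of the metric takes a trace of
the Weyl tensor. -/
theorem contr_weyl_tracefreeRicciSq (h : IsTypeDFrame g x E F X Z P w y Λ e) :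
    contr (weyl g x) (contra (g x)⁻¹ (tracefreeRicciSq g x)) = 0 := by
  rw [h.tracefreeRicciSq_eq, h.contra_low, h.weyl_eq,
    contr_pull_frameUp h.mul_eq_one h.diag_ne, frameLow]
  simp

theorem contr_weylDual_tracefreeRicciSq (h : IsTypeDFrame g x E F X Z P w y Λ e) :
    contr (weylDual g x) (contra (g x)⁻¹ (tracefreeRicciSq g x)) = 0 := by
  rw [h.tracefreeRicciSq_eq, h.contra_low, h.weylDual_eq,
    contr_pull_frameUp h.mul_eq_one h.diag_ne, frameLow]
  simp

end IsTypeDFrame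

/-! ### The Kerr–Newman–(anti) de Sitter metric as an instance. -/

section

variable {a m q Λ : ℝ} {x : Point}

theorem det_carterFrame (a Λ : ℝ) (x : Point) : (carterFrame a Λ x).det =
    Real.sin (x 2) * rhoSq a (x 1) (x 2) / xi a Λ ^ 2 := by
  simp [carterFrame, Matrix.det_succ_row_zero, Fin.sum_univ_succ, Fin.succAbove, rhoSq]
  ring

theorem isTypeDFrame_kerr (hΞ : xi a Λ ≠ 0) (hx : x ∈ regularSet a m q Λ)
    (hs : 0 < Real.sin (x 2)) :
    IsTypeDFrame (kerrNewmanDeSitter a m q Λ) x (carterFrame a Λ x) (carterFrameInv a Λ x)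
      (deltaR a m q Λ (x 1)) (polarFun a Λ (Real.cos (x 2))) (rhoSq a (x 1) (x 2))
      (kerrWeylRe a m q x) (kerrWeylIm a m q x) Λ (q ^ 2 / rhoSq a (x 1) (x 2) ^ 2) where
  X_ne := hx.2.1
  Z_ne := polarFun_cos_ne hx
  P_ne := hx.1
  metric_eq := kerrNewmanDeSitter_eq hx
  mul_eq_one := carterFrame_mul_inv hΞ hx
  det_pos := by
    have hP : 0 < rhoSq a (x 1) (x 2) :=
      lt_of_le_of_ne (by unfold rhoSq; positivity) (Ne.symm hx.1)
    rw [det_carterFrame]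
    positivity
  ricci_eq := ricci_kerr hΞ hx
  weyl_eq := weyl_kerr hΞ hx

end

end CurvInv
end

theorem mainTheorem1 (a m q Λ : ℝ) (t r θ φ : ℝ)
    (hθ0 : 0 < θ) (hθπ : θ < Real.pi)
    (hρ : CurvInv.rhoSq a r θ ≠ 0) (hΔr : CurvInv.deltaR a m q Λ r ≠ 0)
    (hΔθ : CurvInv.deltaTheta a Λ θ ≠ 0) (hΞ : CurvInv.xi a Λ ≠ 0) :
    let g : CurvInv.Metric := CurvInv.kerrNewmanDeSitter a m q Λ
    let p : CurvInv.Point := ![t, r, θ, φ]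
    CurvInv.I1 g p = CurvInv.closedI1 a m q r (Real.cos θ) ∧
    CurvInv.K2 g p = CurvInv.closedK2 a m q r (Real.cos θ) ∧
    CurvInv.I3 g p = CurvInv.closedI3 a m q r (Real.cos θ) ∧
    CurvInv.I4 g p = CurvInv.closedI4 a m q r (Real.cos θ) ∧
    CurvInv.I5 g p = 4 * Λ ∧
    CurvInv.I6 g p = 4 * q ^ 4 / (r ^ 2 + a ^ 2 * Real.cos θ ^ 2) ^ 4 + 4 * Λ ^ 2 ∧
    CurvInv.I7 g p = CurvInv.closedI7 a q Λ r (Real.cos θ) ∧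
    CurvInv.I8 g p = CurvInv.closedI8 a q Λ r (Real.cos θ) ∧
    CurvInv.I9 g p = CurvInv.closedI9 a m q r (Real.cos θ) ∧
    CurvInv.I10 g p = CurvInv.closedI10 a m q r (Real.cos θ) ∧
    CurvInv.I11 g p = CurvInv.closedI11 a m q r (Real.cos θ) ∧
    CurvInv.I12 g p = CurvInv.closedI12 a m q r (Real.cos θ) ∧
    CurvInv.I15 g p = CurvInv.closedI15 a m q r (Real.cos θ) ∧
    CurvInv.I16 g p = CurvInv.closedI16 a m q r (Real.cos θ) ∧
    CurvInv.I17 g p = CurvInv.closedI17 a m q r (Real.cos θ) ∧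
    (CurvInv.I13 g p = 0 ∧ CurvInv.I14 g p = 0) ∧
    (∀ Q : CurvInv.Tensor2,
      CurvInv.mixedK g p (CurvInv.tracefreeRicciSq g p) Q = 0 ∧
      CurvInv.mixedKDual g p (CurvInv.tracefreeRicciSq g p) Q = 0 ∧
      CurvInv.mixedL g p (CurvInv.tracefreeRicciSq g p) Q = 0 ∧
      CurvInv.mixedLDual g p (CurvInv.tracefreeRicciSq g p) Q = 0) := by
  intro g p
  have hs : 0 < Real.sin θ := Real.sin_pos_of_pos_of_lt_pi hθ0 hθπ
  have hp : p ∈ CurvInv.regularSet a m q Λ := ⟨hρ, hΔr, hΔθ, hs.ne'⟩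
  have h := CurvInv.isTypeDFrame_kerr hΞ hp hs
  -- The coordinates of the point reduce definitionally, so the scalars can be restated in r and θ
  -- before denominators are cleared.
  have hw : CurvInv.kerrWeylRe a m q p =
      CurvInv.weylNumRe a m q r (Real.cos θ) / (r ^ 2 + a ^ 2 * Real.cos θ ^ 2) ^ 3 := rfl
  have hy : CurvInv.kerrWeylIm a m q p =
      CurvInv.weylNumIm a m q r (Real.cos θ) / (r ^ 2 + a ^ 2 * Real.cos θ ^ 2) ^ 3 := rfl
  have he : q ^ 2 / CurvInv.rhoSq a (p 1) (p 2) ^ 2 =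
      q ^ 2 / (r ^ 2 + a ^ 2 * Real.cos θ ^ 2) ^ 2 := rfl
  have hP : r ^ 2 + a ^ 2 * Real.cos θ ^ 2 ≠ 0 := hρ
  rw [hw, hy, he] at h
  have hK := fun Q => CurvInv.mixedK_eq g p (CurvInv.tracefreeRicciSq g p) Q
  have hK' := fun Q => CurvInv.mixedKDual_eq g p (CurvInv.tracefreeRicciSq g p) Q
  have hL := fun Q => CurvInv.mixedL_eq g p (CurvInv.tracefreeRicciSq g p) Q
  have hL' := fun Q => CurvInv.mixedLDual_eq g p (CurvInv.tracefreeRicciSq g p) Q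
  -- In each of the four functionals every term has a factor in which the first argument is
  -- contracted with the Weyl tensor or its dual; this factor is zero, whatever the second argument
  -- is.
  simp only [g, h.contr_weyl_tracefreeRicciSq, h.contr_weylDual_tracefreeRicciSq,
    Matrix.zero_mul, Matrix.trace_zero, sub_zero, add_zero, neg_zero] at hK hK' hL hL'
  refine ⟨?_, ?_, ?_, ?_, h.I5_eq, ?_, ?_, ?_, ?_, ?_, ?_, ?_, ?_, ?_, ?_,
    ⟨hK _, hK' _⟩, fun Q => ⟨hK Q, hK' Q, hL Q, hL' Q⟩⟩
  · rw [h.I1_eq, CurvInv.closedI1, CurvInv.weylNumRe, CurvInv.weylNumIm]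
    field_simp
    ring
  · rw [h.K2_eq, CurvInv.closedK2, CurvInv.weylNumRe, CurvInv.weylNumIm]
    field_simp
  · rw [h.I3_eq, CurvInv.closedI3, CurvInv.weylNumRe, CurvInv.weylNumIm]
    field_simp
    ring
  · rw [h.I4_eq, CurvInv.closedI4, CurvInv.weylNumRe, CurvInv.weylNumIm]
    field_simp
    ring
  · rw [h.I6_eq]
    field_simp
  -- The long bracket is Λ²P⁴ + 3q⁴ with the power of P expanded; the closed form of I₈ arises
  -- likewise from Λ⁴P⁸ and Λ²q⁴P⁴.
  · rw [h.I7_eq, CurvInv.closedI7]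
    field_simp
    ring
  · rw [h.I8_eq, CurvInv.closedI8]
    field_simp
    ring
  · rw [h.I9_eq, CurvInv.closedI9, CurvInv.weylNumRe]
    field_simp
  · rw [h.I10_eq, CurvInv.closedI10, CurvInv.weylNumIm]
    field_simp
  · rw [h.I11_eq, CurvInv.closedI11, CurvInv.weylNumRe, CurvInv.weylNumIm]
    field_simp
    ring
  · rw [h.I12_eq, CurvInv.closedI12, CurvInv.weylNumRe, CurvInv.weylNumIm]
    field_simp
  -- With z = ζ²(mζ - q²)/P³ and |ζ|² = P, the sum w² + y² equals (a²c²m² + (mr - q²)²)/P⁴; this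
  -- explains the short factor here and in I₁₆ and I₁₇.
  · rw [h.I15_eq, CurvInv.closedI15, CurvInv.weylNumRe, CurvInv.weylNumIm]
    field_simp
    ring
  · rw [h.I16_eq, CurvInv.closedI16, CurvInv.weylNumRe, CurvInv.weylNumIm]
    field_simp
    ring
  · rw [h.I17_eq, CurvInv.closedI17, CurvInv.weylNumRe, CurvInv.weylNumIm]
    field_simp
    ring
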